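/- **Model.** Jobs arrive to a server of capacity $1$ in a Poisson process of rate $\lambda>0$. Their resource requirements are i.i.d. copies of a random variable $V\in(0,1]$, their durations are i.i.d. $\mathrm{Exp}(1)$. The state is the finite list of the requirements of the jobs present, in order of arrival. A (measurable) Markovian policy selects in each state a set of jobs, of total requirement at most $1$, which are served simultaneously. The system is *stable* under a policy if the expected time to return to the empty state (after having left it) is finite, i.e. the empty state is positive recurrent. For $K=2^L$, $L\ge 0$, a job of requirement $v$ is of type $k=\lceil Kv\rceil\in\{1,\dots,K\}$; $q_k$ is the number of type-$k$ jobs present. A service option is a vector $M\in\mathbb N^K$ with $\sum_k kM^{(k)}\le K$. The 2-bucket efficient set $E^{2B}_K$ consists of the options with $2^{L-\ell}$ jobs of type $2^\ell$ ($0\le \ell\le L$), and, for each $k\in\{1,\dots,K\}$ that is not a power of two, with $\ell=\lceil\log_2 k\rceil$, the option with $2^{L-\ell}$ jobs of type $k$ and $2^{L-\ell}$ jobs of type $2^\ell-k$. - *2B $K$-EMW*: in each state choose $M\in E^{2B}_K$ maximizing $\sum_k M^{(k)}q_k$ (ties, and the jobs chosen within a type, are arbitrary) and serve $\min(M^{(k)},q_k)$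 jobs of each type $k$. - *2B $K$-EnMSR* (nonpreemptive Markovian service rate): an irreducible finite-state continuous-time Markov chain, evolving independently of the queue, prescribes a service option, i.e. a number of slots for each type; the slots are filled with jobs of that type in order of arrival. Every slot (occupied or not) completes at rate $1$, and the chain may move at completions as well as spontaneously; it may give up a slot only when that slot completes, so no job is ever preempted. At most $K$ states of the chain are working states, and these have options in $E^{2B}_K$; in the other states, through which the chain switches between working states, the option is componentwise at most that of some working state. The chain may be chosen depending on $\lambda$, the law of $V$ and $K$; the system is stable under 2B $K$-EnMSR if for some such chain every state without jobs (paired with any state of the chain) is positive recurrent. **Theorem.** Suppose that $V$ has a weakly decreasing probability density function $f_V:(0,1]\to[0,\infty)$. Then both families, 2B $K$-EMW and 2B $K$-EnMSR ($K=2^L$, $L=0,1,2,\dots$), are throughput-optimal: for every $\lambda>0$, if some Markovian policy makes the system stable, then so does 2B $K$-EMW for some $K$ and so does 2B $K$-EnMSR for some $K$. Moreover, for every $0<\lambda<1/\mathbb E V$ the system is stable under 2B $K$-EMW and under 2B $K$-EnMSR with $K=2^L$, where $$L=\max\Bigl\{0,\ \Bigl\lfloor-\log_2\Bigl(\tfrac1\lambda-\mathbb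 E V\Bigr)\Bigr\rfloor+1\Bigr\}.$$ -/

import Mathlib

open MeasureTheory ProbabilityTheory

namespace MSJ

/-! ### Markov jump processes on a measurable space and positive recurrence -/

section JumpProcess

variable {S : Type} [MeasurableSpace S]

/-- The embedded jump chain of the Markov jump process with jump rates `Q` (`Q x B` is the rate at
which the process jumps from `x` into `B`): from `x` the next state has law `Q x / Q x univ`.
If the total rate is zero (or infinite) the state is absorbing. -/
noncomputable def jumpKernel (Q : Kernel S S) : Kernel S S :=
  open Classical in
  { toFun := fun x => if Q x Set.univ = 0 ∨ Q x Set.univ = ⊤ then Measure.dirac x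
      else (Q x Set.univ)⁻¹ • Q x
    measurable' := by
      have hQ : Measurable fun x => Q x Set.univ := Q.measurable_coe MeasurableSet.univ
      refine Measurable.ite ?_ Measure.measurable_dirac ?_
      · exact (hQ (measurableSet_singleton 0)).union (hQ (measurableSet_singleton ⊤))
      · refine Measure.measurable_of_measurable_coe _ fun B hB => ?_
        simp only [Measure.smul_apply, smul_eq_mul]
        exact hQ.inv.mul (Q.measurable_coe hB) }

instance (Q : Kernel S S) : IsMarkovKernel (jumpKernel Q) := by
  refine ⟨fun x => ⟨?_⟩⟩
  change (if Q x Set.univ = 0 ∨ Q x Set.univ = ⊤ then Measure.dirac x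
      else (Q x Set.univ)⁻¹ • Q x) Set.univ = 1
  split_ifs with h
  · simp
  · push Not at h
    simp [ENNReal.inv_mul_cancel h.1 h.2]

instance : IsProbabilityMeasure (expMeasure 1) := isProbabilityMeasure_expMeasure one_pos

/-- One step of the chain of pairs (state, normalised holding time): the next state is drawn from
the jump chain and comes with an independent `Exp(1)` variable. -/
noncomputable def stepKernel (Q : Kernel S S) : Kernel (S × ℝ) (S × ℝ) :=
  ((jumpKernel Q).comap Prod.fst measurable_fst).prod (Kernel.const (S × ℝ) (expMeasure 1))

instance (Q : Kernel S S) : IsMarkovKernel (stepKernel Q) := by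
  unfold stepKernel; infer_instance

/-- Law of the sequence `(X₀, E₀), (X₁, E₁), …`, where `X` is the jump chain started at `x₀` and
the `Eₙ` are i.i.d. `Exp(1)`, independent of `X`. The process stays in its `n`-th state for the
time `Eₙ / Q Xₙ univ`, an exponential time with rate `Q Xₙ univ`. -/
noncomputable def pathLaw (Q : Kernel S S) (x₀ : S) : Measure (ℕ → S × ℝ) :=
  Kernel.trajMeasure (X := fun _ => S × ℝ) ((Measure.dirac x₀).prod (expMeasure 1))
    (fun n => (stepKernel Q).comap
      (fun h : (i : Finset.Iic n) → S × ℝ => h ⟨n, Finset.mem_Iic.2 le_rfl⟩)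
      (measurable_pi_apply _))

/-- The time at which the process returns to `x₀` for the first time after having left it
(`⊤` if it never does). -/
noncomputable def returnTime (Q : Kernel S S) (x₀ : S) (ω : ℕ → S × ℝ) : ENNReal :=
  ⨅ (n : ℕ) (_ : (ω n).1 = x₀ ∧ ∃ m < n, (ω m).1 ≠ x₀),
    ∑ i ∈ Finset.range n, ENNReal.ofReal (ω i).2 / Q (ω i).1 Set.univ

/-- The state `x₀` is positive recurrent: its expected return time is finite. -/
def PositiveRecurrent (Q : Kernel S S) (x₀ : S) : Prop :=
  ∫⁻ ω, returnTime Q x₀ ω ∂(pathLaw Q x₀) < ⊤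

end JumpProcess

/-! ### The queueing system -/

/-- Resource requirements. -/
abbrev Requirement : Type := Set.Ioc (0 : ℝ) 1

/-- States of the system: finite sequences of the requirements of the jobs present, in the order
of arrival. -/
abbrev JobList : Type := Σ N : ℕ, (Fin N → Requirement)

namespace JobList

/-- The system without jobs. -/
def empty : JobList := ⟨0, Fin.elim0⟩

/-- A job with requirement `v` arrives. -/
def arrive (x : JobList) (v : Requirement) : JobList := ⟨x.1 + 1, Fin.snoc x.2 v⟩

/-- Job number `i` leaves. -/
def remove : (x : JobList) → Fin x.1 → JobList
  | ⟨0, _⟩, i => i.elim0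
  | ⟨N + 1, v⟩, i => ⟨N, fun j => v (i.succAbove j)⟩

theorem measurable_mk (N : ℕ) : Measurable fun v : Fin N → Requirement => (⟨N, v⟩ : JobList) :=
  Measurable.of_le_map (iInf_le _ N)

theorem measurable_of_mk {β : Type*} [MeasurableSpace β] {g : JobList → β}
    (h : ∀ N, Measurable fun v : Fin N → Requirement => g ⟨N, v⟩) : Measurable g := by
  intro B hB
  refine MeasurableSpace.measurableSet_iInf.2 fun N => ?_
  exact h N hB

theorem measurable_remove (N : ℕ) (i : Fin N) :
    Measurable fun v : Fin N → Requirement => remove ⟨N, v⟩ i := by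
  cases N with
  | zero => exact i.elim0
  | succ N =>
    exact (measurable_mk N).comp (measurable_pi_lambda _ fun j => measurable_pi_apply _)

theorem measurable_arrive (N : ℕ) :
    Measurable fun p : (Fin N → Requirement) × Requirement => arrive ⟨N, p.1⟩ p.2 := by
  refine (measurable_mk (N + 1)).comp (measurable_pi_lambda _ fun j => ?_)
  refine Fin.lastCases ?_ (fun i => ?_) j
  · simpa using measurable_snd
  · simp only [Fin.snoc_castSucc]
    exact (measurable_pi_apply i).comp measurable_fst

end JobList

open JobList

/-- A (measurable) Markovian scheduling policy: in state `x` it serves the set `serve x` of jobs,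
whose total requirement is at most the capacity `1`. -/
structure MarkovPolicy where
  serve : (x : JobList) → Finset (Fin x.1)
  capacity : ∀ x, ∑ i ∈ serve x, (x.2 i : ℝ) ≤ 1
  measurable_serve : ∀ (N : ℕ) (A : Finset (Fin N)),
    MeasurableSet {v : Fin N → Requirement | serve ⟨N, v⟩ = A}

theorem measurable_arrival_map {S : Type} [MeasurableSpace S] (μ : Measure Requirement)
    [SFinite μ] (g : JobList → S) (hg : Measurable g) :
    Measurable fun x : JobList => μ.map fun v => g (arrive x v) := by
  refine measurable_of_mk fun N => ?_
  have hm := hg.comp (measurable_arrive N)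
  have h := (Measure.measurable_map _ hm).comp
    (Measurable.map_prodMk_left (α := Fin N → Requirement) (ν := μ))
  have h' : (fun v : Fin N → Requirement => μ.map fun w => g (arrive ⟨N, v⟩ w))
      = Measure.map (g ∘ fun p : (Fin N → Requirement) × Requirement => arrive ⟨N, p.1⟩ p.2)
        ∘ fun v => μ.map (Prod.mk v) := by
    funext v
    rw [Function.comp_apply, Measure.map_map hm measurable_prodMk_left]
    rfl
  rw [h']
  exact h

/-- The jump rates of the system under the policy `π`: jobs arrive at rate `lam` with requirements
sampled from `μ`, and each job in service leaves at rate `1`. -/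
noncomputable def MarkovPolicy.rates (π : MarkovPolicy) (lam : ℝ) (μ : Measure Requirement)
    [SFinite μ] : Kernel JobList JobList where
  toFun x := ENNReal.ofReal lam • μ.map (arrive x)
    + ∑ i ∈ π.serve x, Measure.dirac (remove x i)
  measurable' := by
    refine Measurable.add ?_ ?_
    · refine Measure.measurable_of_measurable_coe _ fun B hB => ?_
      simp only [Measure.smul_apply, smul_eq_mul]
      exact ((Measure.measurable_coe hB).comp
        (measurable_arrival_map μ id measurable_id)).const_mul _
    · classical
      refine measurable_of_mk fun N => ?_
      have h : ∀ v : Fin N → Requirement,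
          ∑ i ∈ π.serve ⟨N, v⟩, Measure.dirac (remove ⟨N, v⟩ i)
            = ∑ i : Fin N, if i ∈ π.serve ⟨N, v⟩ then Measure.dirac (remove ⟨N, v⟩ i) else 0 := by
        intro v
        rw [Finset.sum_ite_mem, Finset.univ_inter]
      simp only [h]
      refine Finset.measurable_sum _ fun i _ => Measurable.ite ?_
        (Measure.measurable_dirac.comp (measurable_remove N i)) measurable_const
      have : {v : Fin N → Requirement | i ∈ π.serve ⟨N, v⟩}
          = ⋃ A ∈ {A : Finset (Fin N) | i ∈ A}, {v | π.serve ⟨N, v⟩ = A} := by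
        ext v; simp
      rw [this]
      exact MeasurableSet.biUnion (Set.to_countable _) fun A _ => π.measurable_serve N A

/-- The system with arrival rate `lam` and requirement law `μ` is stable under `π`: the empty state
is positive recurrent. -/
def MarkovPolicy.Stable (π : MarkovPolicy) (lam : ℝ) (μ : Measure Requirement) [SFinite μ] : Prop :=
  PositiveRecurrent (π.rates lam μ) JobList.empty

/-! ### Discretization and service options -/

/-- The type of a job under `K`-discretization: `k` iff the requirement is in
`((k - 1) / K, k / K]`. -/
noncomputable def jobType (K : ℕ) (v : Requirement) : ℕ := ⌈(K : ℝ) * (v : ℝ)⌉₊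

/-- The number of type-`k` jobs in the system. -/
noncomputable def typeCount (K : ℕ) (x : JobList) (k : ℕ) : ℕ :=
  (Finset.univ.filter fun i : Fin x.1 => jobType K (x.2 i) = k).card

/-- The admissible service options under `K`-discretization; `M k` is the number of type-`k` jobs
served by `M`. -/
def serviceOptions (K : ℕ) : Set (ℕ →₀ ℕ) :=
  {M | M.support ⊆ Finset.Icc 1 K ∧ M.sum (fun k m => k * m) ≤ K}

/-- The 2-bucket efficient set for `K = 2 ^ L`. For `k` not a power of two, `ℓ = ⌈log₂ k⌉` and
hence `0 < 2 ^ ℓ - k`. -/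
def twoBucketSet (L : ℕ) : Set (ℕ →₀ ℕ) :=
  {M | ∃ ℓ ≤ L, M = Finsupp.single (2 ^ ℓ) (2 ^ (L - ℓ))} ∪
  {M | ∃ k ∈ Finset.Icc 1 (2 ^ L), (¬ ∃ j : ℕ, k = 2 ^ j) ∧
    M = Finsupp.single k (2 ^ (L - Nat.clog 2 k))
      + Finsupp.single (2 ^ Nat.clog 2 k - k) (2 ^ (L - Nat.clog 2 k))}

/-- `⟨M, q⟩` for the vector `q` of numbers of jobs of each type in state `x`. -/
noncomputable def weight (K : ℕ) (x : JobList) (M : ℕ →₀ ℕ) : ℕ :=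
  M.sum fun k m => m * typeCount K x k

/-- `π` is a `K`-discretized MaxWeight policy with candidate set `E`: in every state it uses an
option `M ∈ E` of maximal weight (ties and the choice of jobs within a type being arbitrary), and
serves as many jobs of each type `k` as possible up to `M k`. -/
def MarkovPolicy.IsMaxWeight (π : MarkovPolicy) (K : ℕ) (E : Set (ℕ →₀ ℕ)) : Prop :=
  ∀ x : JobList, ∃ M ∈ E, (∀ M' ∈ E, weight K x M' ≤ weight K x M) ∧
    ∀ k, ((π.serve x).filter fun i => jobType K (x.2 i) = k).card = min (M k) (typeCount K x k)

/-- Stability under 2-Bucket `K`-Efficient MaxWeight, `K = 2 ^ L`. -/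
def StableTwoBucketEMW (L : ℕ) (lam : ℝ) (μ : Measure Requirement) [SFinite μ] : Prop :=
  ∀ π : MarkovPolicy, π.IsMaxWeight (2 ^ L) (twoBucketSet L) → π.Stable lam μ

/-! ### Nonpreemptive Markovian service rate policies -/

/-- The jobs in service when `u k` slots are reserved for type-`k` jobs and the jobs of each type
are served in the order of arrival: job `i` is in service iff fewer than `u (type of i)` jobs of
its type precede it. -/
noncomputable def inService (K : ℕ) (u : ℕ →₀ ℕ) (x : JobList) : Finset (Fin x.1) :=
  Finset.univ.filter fun i =>
    (Finset.univ.filter fun j => j < i ∧ jobType K (x.2 j) = jobType K (x.2 i)).card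
      < u (jobType K (x.2 i))

/-- A `K`-discretized nonpreemptive Markovian service rate policy. The modulating process is an
irreducible continuous-time Markov chain with finitely many states, whose evolution does not depend
on the queue; in state `s` there are `slots s k` slots for type-`k` jobs. A slot, occupied or not,
completes at rate `1`, and a completion of a type-`k` slot moves the modulating process to
`afterCompletion s k`; in addition the process moves from `s` to `s'` at rate `switchRate s s'`.
It never preempts: a slot can be given up only when it completes. -/
structure NMSRPolicy (K : ℕ) where
  n : ℕ
  n_pos : 0 < n
  slots : Fin n → ℕ →₀ ℕ
  slots_mem : ∀ s, slots s ∈ serviceOptions K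
  switchRate : Fin n → Fin n → NNReal
  afterCompletion : Fin n → ℕ → Fin n
  switch_nonpreemptive : ∀ s s', switchRate s s' ≠ 0 → slots s ≤ slots s'
  completion_nonpreemptive : ∀ s k, slots s k ≠ 0 →
    slots s - Finsupp.single k 1 ≤ slots (afterCompletion s k)
  irreducible : ∀ s s', Relation.ReflTransGen
    (fun a b => switchRate a b ≠ 0 ∨ ∃ k, slots a k ≠ 0 ∧ afterCompletion a k = b) s s'

theorem measurable_of_jobTypes {β : Type*} [MeasurableSpace β] (K N : ℕ)
    (g : (Fin N → ℕ) → β) :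
    Measurable fun v : Fin N → Requirement => g fun i => jobType K (v i) := by
  refine (Measurable.of_discrete (f := g)).comp (measurable_pi_lambda _ fun i => ?_)
  exact Nat.measurable_ceil.comp ((measurable_subtype_coe.comp (measurable_pi_apply i)).const_mul _)

/-- The jump rates of the system under an nMSR policy; the state is the pair (state of the
modulating process, jobs present). The four parts are: arrivals, spontaneous moves of the
modulating process, completions of slots that are occupied by a job (which leaves), and completions
of empty slots. -/
noncomputable def NMSRPolicy.rates {K : ℕ} (P : NMSRPolicy K) (lam : ℝ) (μ : Measure Requirement)
    [SFinite μ] : Kernel (Fin P.n × JobList) (Fin P.n × JobList) where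
  toFun p := ENNReal.ofReal lam • μ.map (fun v => (p.1, arrive p.2 v))
    + ∑ s', P.switchRate p.1 s' • Measure.dirac (s', p.2)
    + ∑ i ∈ inService K (P.slots p.1) p.2,
        Measure.dirac (P.afterCompletion p.1 (jobType K (p.2.2 i)), remove p.2 i)
    + ∑ k ∈ (P.slots p.1).support,
        (P.slots p.1 k - typeCount K p.2 k) • Measure.dirac (P.afterCompletion p.1 k, p.2)
  measurable' := by
    refine measurable_from_prod_countable_right fun s => ?_
    refine Measurable.add (M := Measure (Fin P.n × JobList)) (Measurable.add
      (M := Measure (Fin P.n × JobList)) (Measurable.add (M := Measure (Fin P.n × JobList))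
      ?_ ?_) ?_) ?_
    · refine Measure.measurable_of_measurable_coe _ fun B hB => ?_
      simp only [Measure.smul_apply, smul_eq_mul]
      exact ((Measure.measurable_coe hB).comp
        (measurable_arrival_map μ (fun y => (s, y)) measurable_prodMk_left)).const_mul _
    · change Measurable fun y : JobList => ∑ s', P.switchRate s s' • Measure.dirac (s', y)
      refine Finset.measurable_sum Finset.univ fun s' _ => ?_
      refine Measure.measurable_of_measurable_coe _ fun B hB => ?_
      simp only [Measure.smul_apply]
      exact ((Measure.measurable_coe hB).comp
        (Measure.measurable_dirac.comp measurable_prodMk_left)).const_smul _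
    · refine measurable_of_mk fun N => ?_
      simp only [inService, Finset.sum_filter]
      refine Finset.measurable_sum (M := Measure (Fin P.n × JobList)) Finset.univ fun i _ => Measurable.ite ?_ ?_ measurable_const
      · exact measurableSet_setOfPred.2 (measurable_of_jobTypes K N fun t =>
          (Finset.univ.filter fun j => j < i ∧ t j = t i).card < P.slots s (t i))
      · exact Measure.measurable_dirac.comp
          ((measurable_of_jobTypes K N fun t => P.afterCompletion s (t i)).prodMk
            (measurable_remove N i))
    · change Measurable fun y : JobList => ∑ k ∈ (P.slots s).support,
        (P.slots s k - typeCount K y k) • Measure.dirac (P.afterCompletion s k, y)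
      refine Finset.measurable_sum (P.slots s).support fun k _ => ?_
      refine measurable_of_mk fun N => ?_
      refine Measure.measurable_of_measurable_coe _ fun B hB => ?_
      simp only [Measure.smul_apply, nsmul_eq_mul]
      refine Measurable.mul ?_ ((Measure.measurable_coe hB).comp (Measure.measurable_dirac.comp
        (measurable_prodMk_left.comp (measurable_mk N))))
      exact measurable_of_jobTypes K N fun t =>
        ((P.slots s k - (Finset.univ.filter fun i => t i = k).card : ℕ) : ENNReal)

/-- The system is stable under the nMSR policy `P`: the states without jobs are positive
recurrent. -/
def NMSRPolicy.Stable {K : ℕ} (P : NMSRPolicy K) (lam : ℝ) (μ : Measure Requirement) [SFinite μ] :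
    Prop :=
  ∀ s, PositiveRecurrent (P.rates lam μ) (s, JobList.empty)

/-- `P` selects its service options from `E`: it has at most `K` working states, whose options are
in `E`; in every other state it is switching between working states, and its slots are part of
those of a working state. -/
def NMSRPolicy.IsEfficient {K : ℕ} (P : NMSRPolicy K) (E : Set (ℕ →₀ ℕ)) : Prop :=
  ∃ W : Finset (Fin P.n), W.card ≤ K ∧ (∀ w ∈ W, P.slots w ∈ E) ∧
    ∀ s ∉ W, ∃ w ∈ W, P.slots s ≤ P.slots w

/-- Stability under 2-Bucket `K`-Efficient nMSR, `K = 2 ^ L`: for a suitable modulating process,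
which is selected offline from `lam` and `μ`, the system is stable. -/
def StableTwoBucketEnMSR (L : ℕ) (lam : ℝ) (μ : Measure Requirement) [SFinite μ] : Prop :=
  ∃ P : NMSRPolicy (2 ^ L), P.IsEfficient (twoBucketSet L) ∧ P.Stable lam μ

/-- A family of policies, of which `stable L lam` says that its `L`-th member stabilizes the system
with arrival rate `lam`, is throughput-optimal: whenever some policy stabilizes the system, so does
a member of the family. -/
def ThroughputOptimal (μ : Measure Requirement) [SFinite μ] (stable : ℕ → ℝ → Prop) : Prop :=
  ∀ lam : ℝ, 0 < lam → (∃ π : MarkovPolicy, π.Stable lam μ) → ∃ L, stable L lam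

/-! ### MaxWeight policies exist, and nMSR policies do not preempt -/

theorem card_filter_rank_lt {ι : Type*} [LinearOrder ι] (A : Finset ι) (n : ℕ) :
    (A.filter fun i => (A.filter fun j => j < i).card < n).card = min n A.card := by
  induction A using Finset.induction_on_max with
  | empty => simp
  | insert a s ha ih =>
    have has : a ∉ s := fun h => lt_irrefl _ (ha a h)
    have h1 : ((insert a s).filter fun j => j < a) = s := by
      ext j; simp only [Finset.mem_filter, Finset.mem_insert]
      exact ⟨fun h => h.1.resolve_left h.2.ne, fun h => ⟨Or.inr h, ha j h⟩⟩
    have h2 : ∀ i ∈ s, ((insert a s).filter fun j => j < i) = s.filter fun j => j < i := by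
      intro i hi
      rw [Finset.filter_insert, if_neg (ha i hi).not_gt]
    have h3 : (s.filter fun i => ((insert a s).filter fun j => j < i).card < n)
        = s.filter fun i => (s.filter fun j => j < i).card < n :=
      Finset.filter_congr fun i hi => by rw [h2 i hi]
    rw [Finset.filter_insert, h1, h3, Finset.card_insert_of_notMem has]
    split_ifs with h
    · rw [Finset.card_insert_of_notMem (fun h' => has (Finset.mem_filter.1 h').1), ih]
      omega
    · rw [ih]; omega

/-- With `u k` slots for type-`k` jobs, `min (u k) (number of type-k jobs)` of them are served. -/
theorem card_inService (K : ℕ) (u : ℕ →₀ ℕ) (x : JobList) (k : ℕ) :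
    ((inService K u x).filter fun i => jobType K (x.2 i) = k).card
      = min (u k) (typeCount K x k) := by
  rw [typeCount, ← card_filter_rank_lt, inService, Finset.filter_filter, Finset.filter_filter]
  congr 1
  ext i
  simp only [Finset.mem_filter, Finset.mem_univ, true_and, Finset.filter_filter]
  constructor
  · rintro ⟨h, rfl⟩
    exact ⟨rfl, by simpa only [and_comm] using h⟩
  · rintro ⟨rfl, h⟩
    exact ⟨by simpa only [and_comm] using h, rfl⟩

/-- Admissible service options respect the capacity of the server. -/
theorem capacity_inService (K : ℕ) (hK : 0 < K) (u : ℕ →₀ ℕ) (hu : u ∈ serviceOptions K)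
    (x : JobList) : ∑ i ∈ inService K u x, (x.2 i : ℝ) ≤ 1 := by
  have hK' : (0 : ℝ) < K := by exact_mod_cast hK
  have hmaps : ∀ i ∈ inService K u x, jobType K (x.2 i) ∈ u.support := by
    intro i hi
    have := (Finset.mem_filter.1 hi).2
    exact Finsupp.mem_support_iff.2 (by omega)
  have h1 : ∑ i ∈ inService K u x, (K : ℝ) * (x.2 i : ℝ)
      ≤ ∑ i ∈ inService K u x, (jobType K (x.2 i) : ℝ) :=
    Finset.sum_le_sum fun i _ => Nat.le_ceil _
  have h2 : ∑ i ∈ inService K u x, jobType K (x.2 i) ≤ K := by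
    rw [← Finset.sum_fiberwise_of_maps_to hmaps]
    refine le_trans (Finset.sum_le_sum fun k _ => ?_) hu.2
    rw [Finset.sum_congr rfl fun i hi => (Finset.mem_filter.1 hi).2, Finset.sum_const,
      card_inService, smul_eq_mul, mul_comm]
    exact Nat.mul_le_mul_left _ (min_le_left _ _)
  have h3 : ∑ i ∈ inService K u x, (jobType K (x.2 i) : ℝ) ≤ K := by exact_mod_cast h2
  rw [← Finset.mul_sum] at h1
  have h4 : (K : ℝ) * ∑ i ∈ inService K u x, (x.2 i : ℝ) ≤ K * 1 := by linarith
  exact le_of_mul_le_mul_left h4 hK'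

/-- MaxWeight policies exist: choose any maximizer and serve the jobs of each type in the order of
arrival. -/
theorem exists_isMaxWeight (K : ℕ) (hK : 0 < K) (E : Set (ℕ →₀ ℕ)) (hE : E ⊆ serviceOptions K)
    (hne : E.Nonempty) : ∃ π : MarkovPolicy, π.IsMaxWeight K E := by
  have hmax : ∀ q : ℕ → ℕ, ∃ M ∈ E, ∀ M' ∈ E,
      (M'.sum fun k m => m * q k) ≤ M.sum fun k m => m * q k := by
    intro q
    have hb : BddAbove ((fun M : ℕ →₀ ℕ => M.sum fun k m => m * q k) '' E) := by
      refine ⟨∑ k ∈ Finset.Icc 1 K, K * q k, ?_⟩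
      rintro _ ⟨M, hM, rfl⟩
      obtain ⟨hs, hw⟩ := hE hM
      refine (Finset.sum_le_sum fun k hk => Nat.mul_le_mul_right (q k) ?_).trans
        (Finset.sum_le_sum_of_subset hs)
      have h2 : k * M k ≤ M.sum fun k m => k * m :=
        Finset.single_le_sum (f := fun k => k * M k) (fun _ _ => Nat.zero_le _) hk
      have := (Finset.mem_Icc.1 (hs hk)).1
      nlinarith
    obtain ⟨M, hM, hMs⟩ := Nat.sSup_mem (hne.image _) hb
    exact ⟨M, hM, fun M' hM' => (le_csSup hb ⟨M', hM', rfl⟩).trans hMs.ge⟩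
  choose σ hσE hσ using hmax
  refine ⟨⟨fun x => inService K (σ (typeCount K x)) x,
    fun x => capacity_inService K hK _ (hE (hσE _)) x, fun N A => ?_⟩,
    fun x => ⟨_, hσE _, hσ _, card_inService K _ x⟩⟩
  refine measurableSet_setOfPred.2 (measurable_of_jobTypes K N fun t =>
    (Finset.univ.filter fun i => (Finset.univ.filter fun j => j < i ∧ t j = t i).card
      < σ (fun k => (Finset.univ.filter fun i => t i = k).card) (t i)) = A)

theorem twoBucketSet_subset (L : ℕ) : twoBucketSet L ⊆ serviceOptions (2 ^ L) := by
  rintro M (⟨l, hl, rfl⟩ | ⟨k, hk, hp, rfl⟩)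
  · refine ⟨Finsupp.support_single_subset.trans ?_, ?_⟩
    · simp [Nat.one_le_two_pow, Nat.pow_le_pow_right, hl]
    · rw [Finsupp.sum_single_index (by simp), ← pow_add, Nat.add_sub_cancel' hl]
  · obtain ⟨hk1, hk2⟩ := Finset.mem_Icc.1 hk
    have hlt : k < 2 ^ Nat.clog 2 k :=
      lt_of_le_of_ne (Nat.le_pow_clog one_lt_two k) fun h => hp ⟨_, h⟩
    have hl : Nat.clog 2 k ≤ L := Nat.clog_le_of_le_pow hk2
    have hle : 2 ^ Nat.clog 2 k ≤ 2 ^ L := Nat.pow_le_pow_right two_pos hl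
    refine ⟨Finsupp.support_add.trans (Finset.union_subset
      (Finsupp.support_single_subset.trans ?_) (Finsupp.support_single_subset.trans ?_)), ?_⟩
    · simpa using ⟨hk1, hk2⟩
    · simp only [Finset.singleton_subset_iff, Finset.mem_Icc]; omega
    · rw [Finsupp.sum_add_index' (by simp) (by simp [mul_add]),
        Finsupp.sum_single_index (by simp), Finsupp.sum_single_index (by simp), ← add_mul,
        Nat.add_sub_cancel' hlt.le, ← pow_add, Nat.add_sub_cancel' hl]

/-- 2-bucket efficient MaxWeight policies exist. -/
theorem exists_twoBucketEMW (L : ℕ) :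
    ∃ π : MarkovPolicy, π.IsMaxWeight (2 ^ L) (twoBucketSet L) :=
  exists_isMaxWeight _ (by positivity) _ (twoBucketSet_subset L)
    ⟨_, Or.inl ⟨0, Nat.zero_le _, rfl⟩⟩

/-- No preemption at completions: a job `i` in service that is not the one that leaves stays in
service (it has number `j` among the remaining jobs). -/
theorem NMSRPolicy.mem_inService_remove {K : ℕ} (P : NMSRPolicy K) (s : Fin P.n) (N : ℕ)
    (v : Fin (N + 1) → Requirement) (i : Fin (N + 1)) (hi : i ∈ inService K (P.slots s) ⟨N + 1, v⟩)
    (j : Fin N) (hj : i.succAbove j ∈ inService K (P.slots s) ⟨N + 1, v⟩) :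
    j ∈ inService K (P.slots (P.afterCompletion s (jobType K (v i)))) (remove ⟨N + 1, v⟩ i) := by
  simp only [inService, Finset.mem_filter, Finset.mem_univ, true_and, remove] at hi hj ⊢
  set a := jobType K (v i) with ha
  set b := jobType K (v (i.succAbove j)) with hb
  have hnp : P.slots s b - Finsupp.single a 1 b ≤ P.slots (P.afterCompletion s a) b :=
    P.completion_nonpreemptive s a (by omega) b
  refine Finset.mem_filter.2 ⟨Finset.mem_univ _, ?_⟩
  change (Finset.univ.filter fun m : Fin N => m < j ∧ jobType K (v (i.succAbove m)) = b).card
    < P.slots (P.afterCompletion s a) b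
  have himg : ((Finset.univ.filter fun m : Fin N => m < j ∧ jobType K (v (i.succAbove m)) = b).image
      i.succAbove) ⊆ (Finset.univ.filter fun m => m < i.succAbove j ∧ jobType K (v m) = b) := by
    intro m hm
    simp only [Finset.mem_image, Finset.mem_filter, Finset.mem_univ, true_and] at hm ⊢
    obtain ⟨m, ⟨h1, h2⟩, rfl⟩ := hm
    exact ⟨(Fin.strictMono_succAbove i) h1, h2⟩
  have hcard := Finset.card_image_of_injective
    (Finset.univ.filter fun m : Fin N => m < j ∧ jobType K (v (i.succAbove m)) = b)
    (Fin.succAbove_right_injective (p := i))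
  by_cases hab : a = b
  · rw [hab, Finsupp.single_eq_same] at hnp
    by_cases hlt : i < i.succAbove j
    · have : ((Finset.univ.filter fun m : Fin N =>
          m < j ∧ jobType K (v (i.succAbove m)) = b).image i.succAbove)
          ⊂ (Finset.univ.filter fun m => m < i.succAbove j ∧ jobType K (v m) = b) := by
        refine Finset.ssubset_iff_subset_ne.2 ⟨himg, fun h => ?_⟩
        have : i ∈ (Finset.univ.filter fun m => m < i.succAbove j ∧ jobType K (v m) = b) := by
          simp [hlt, ← ha, hab]
        rw [← h] at this
        obtain ⟨m, -, hm⟩ := Finset.mem_image.1 this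
        exact Fin.succAbove_ne i m hm
      have := Finset.card_lt_card this
      rw [hab]
      omega
    · have hlt' : i.succAbove j < i := lt_of_le_of_ne (not_lt.1 hlt) (Fin.succAbove_ne i j)
      have : (Finset.univ.filter fun m => m < i.succAbove j ∧ jobType K (v m) = b)
          ⊂ (Finset.univ.filter fun m => m < i ∧ jobType K (v m) = b) := by
        refine Finset.ssubset_iff_subset_ne.2 ⟨fun m hm => ?_, fun h => ?_⟩
        · simp only [Finset.mem_filter, Finset.mem_univ, true_and] at hm ⊢
          exact ⟨hm.1.trans hlt', hm.2⟩
        · have : i.succAbove j ∈ (Finset.univ.filter fun m => m < i ∧ jobType K (v m) = b) := by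
            simp [hlt', ← hb]
          rw [← h] at this
          simp at this
      have := Finset.card_lt_card this
      have := Finset.card_le_card himg
      rw [hab] at hi ⊢
      omega
  · rw [Finsupp.single_eq_of_ne (Ne.symm hab)] at hnp
    have := Finset.card_le_card himg
    omega

end MSJ

/-! Necessity. The total requirement of the jobs present grows at mean rate `λ E V` and is depleted
at mean rate at most `1`, the capacity, whatever the policy. If `λ E V ≥ 1`, its expectation on the
event that the empty state has not been revisited never decreases along the jump chain and is
positive after one jump. A finite mean return time would send this expectation to `0` by dominated
convergence. So stability forces `λ E V < 1` (`MarkovPolicy.Stable.load_lt_one`).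

Sufficiency. Put `p k = λ P(type k)`. Rounding a requirement up to a multiple of `1/K` adds at most
`1/K`, so `∑ k p k ≤ λ (K E V + 1)`, which is below `K` as soon as `K (1/λ - E V) > 1`; this is what
the choice of `L` ensures. The types are intervals of equal length, so a decreasing density makes
`p` decreasing. The combinatorial core is `exists_twoBucket_decomposition`: such a `p` is an exact
nonnegative combination of two-bucket options. Each option fills the capacity `K` exactly, so the
coefficients sum to `∑ k p k / K < 1`, and the slack can be spread so that every type is served
strictly faster than it arrives (`exists_twoBucket_fractions`).

Both policies are then stable by Foster's criterion with a quadratic Lyapunov function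
(`positiveRecurrent_of_quadratic_drift`). MaxWeight uses an option at least as heavy as the average
over the fractions. The nMSR chain cycles through the options, holds each for a long time
proportional to its fraction, and lets its slots run out before the next one starts, so that the
time lost to switching is relatively negligible. There a solution of the Poisson equation is added
to each queue length, which replaces the momentary number of slots by its long-run average
(`NMSRPolicy.stable_of_poisson`).

The quadratic drift is negative only when many jobs are present, and the state space is uncountable.
The remaining states are handled by a bounded auxiliary function built from a quantity `d` that some
transition lowers at a uniformly positive rate (`positiveRecurrent_of_drift`). -/

namespace MSJ

open JobList

set_option linter.unusedSectionVars false

/-! ### Return times and Foster's criterion for the embedded jump chain. -/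

section JumpProcess

variable {S : Type} [MeasurableSpace S]

/-- The integrand `e * exp (-e)` is the density of the Gamma law with parameters `2` and `1`. -/
theorem lintegral_ofReal_expMeasure_one : ∫⁻ e, ENNReal.ofReal e ∂(expMeasure 1) = 1 := by
  have h : expMeasure 1 = volume.withDensity (exponentialPDF 1) := rfl
  rw [h, lintegral_withDensity_eq_lintegral_mul _ (by unfold exponentialPDF; fun_prop) (by fun_prop),
    ← lintegral_gammaPDF_eq_one (a := 2) (r := 1) two_pos one_pos]
  refine lintegral_congr fun x => ?_
  rcases lt_or_ge x 0 with hx | hx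
  · simp [exponentialPDF_of_neg hx, gammaPDF_of_neg hx]
  · rw [Pi.mul_apply, exponentialPDF_of_nonneg hx, gammaPDF_of_nonneg hx,
      ← ENNReal.ofReal_mul (by positivity)]
    congr 1
    norm_num
    ring

theorem lintegral_pathLaw_zero (Q : Kernel S S) (x₀ : S) (φ : S × ℝ → ENNReal)
    (hφ : Measurable φ) :
    ∫⁻ ω, φ (ω 0) ∂(pathLaw Q x₀) = ∫⁻ e, φ (x₀, e) ∂(expMeasure 1) := by
  let κ : (n : ℕ) → Kernel ((i : Finset.Iic n) → S × ℝ) (S × ℝ) := fun n =>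
    (stepKernel Q).comap
      (fun h : (i : Finset.Iic n) → S × ℝ => h ⟨n, Finset.mem_Iic.2 le_rfl⟩)
      (measurable_pi_apply _)
  have hP : pathLaw Q x₀ = Kernel.trajMeasure (X := fun _ => S × ℝ)
      ((Measure.dirac x₀).prod (expMeasure 1)) κ := rfl
  let ψ : ((i : Finset.Iic 0) → S × ℝ) → ENNReal := fun h => φ (h ⟨0, Finset.mem_Iic.2 le_rfl⟩)
  have hψ : Measurable ψ := hφ.comp (measurable_pi_apply _)
  have h1 : ∫⁻ ω, φ (ω 0) ∂(pathLaw Q x₀)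
      = ∫⁻ h, ψ h ∂((pathLaw Q x₀).map (Preorder.frestrictLe 0)) := by
    rw [lintegral_map hψ (by fun_prop)]
    rfl
  rw [h1, hP, Kernel.trajMeasure, Measure.map_comp _ _ (by fun_prop),
    Kernel.traj_map_frestrictLe, Kernel.partialTraj_self, Measure.id_comp,
    lintegral_map hψ (by fun_prop)]
  change ∫⁻ p, φ p ∂_ = _
  rw [lintegral_prod _ hφ.aemeasurable, lintegral_dirac']
  exact hφ.lintegral_prod_right'

/-- Markov property of the path at time `n`. -/
theorem lintegral_pathLaw_succ (Q : Kernel S S) (x₀ : S) (n : ℕ)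
    (F : ((i : Finset.Iic n) → S × ℝ) → ENNReal) (hF : Measurable F)
    (φ : S × (S × ℝ) → ENNReal) (hφ : Measurable φ) :
    ∫⁻ ω, F (Preorder.frestrictLe n ω) * φ ((ω n).1, ω (n + 1)) ∂(pathLaw Q x₀)
      = ∫⁻ ω, F (Preorder.frestrictLe n ω) *
        ∫⁻ y, ∫⁻ e, φ ((ω n).1, (y, e)) ∂(expMeasure 1) ∂(jumpKernel Q (ω n).1)
          ∂(pathLaw Q x₀) := by
  let last : ((i : Finset.Iic n) → S × ℝ) → S × ℝ := fun h => h ⟨n, Finset.mem_Iic.2 le_rfl⟩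
  have hlast : Measurable last := measurable_pi_apply _
  let κ : (n : ℕ) → Kernel ((i : Finset.Iic n) → S × ℝ) (S × ℝ) := fun n =>
    (stepKernel Q).comap
      (fun h : (i : Finset.Iic n) → S × ℝ => h ⟨n, Finset.mem_Iic.2 le_rfl⟩)
      (measurable_pi_apply _)
  have hP : pathLaw Q x₀ = Kernel.trajMeasure (X := fun _ => S × ℝ)
      ((Measure.dirac x₀).prod (expMeasure 1)) κ := rfl
  have key := Kernel.map_frestrictLe_trajMeasure_compProd_eq_map_trajMeasure
    (X := fun _ => S × ℝ) (μ₀ := (Measure.dirac x₀).prod (expMeasure 1)) (κ := κ) (a := n)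
  rw [← hP] at key
  let Φ : ((i : Finset.Iic n) → S × ℝ) × (S × ℝ) → ENNReal :=
    fun p => F p.1 * φ ((last p.1).1, p.2)
  have hΦ : Measurable Φ := by
    refine (hF.comp measurable_fst).mul (hφ.comp ?_)
    exact ((measurable_fst.comp (hlast.comp measurable_fst))).prodMk measurable_snd
  have h1 : ∫⁻ ω, F (Preorder.frestrictLe n ω) * φ ((ω n).1, ω (n + 1)) ∂(pathLaw Q x₀)
      = ∫⁻ p, Φ p ∂((pathLaw Q x₀).map (fun x ↦ (Preorder.frestrictLe n x, x (n + 1)))) := by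
    rw [lintegral_map hΦ (by fun_prop)]
    rfl
  rw [h1, ← key]
  have hprob : IsProbabilityMeasure (pathLaw Q x₀) := by rw [hP]; infer_instance
  rw [Measure.lintegral_compProd hΦ, lintegral_map hΦ.lintegral_kernel_prod_right' (by fun_prop)]
  refine lintegral_congr fun ω => ?_
  change ∫⁻ b, F (Preorder.frestrictLe n ω) * φ ((ω n).1, b) ∂(stepKernel Q (ω n)) = _
  have hφ' : Measurable fun b => φ ((ω n).1, b) := hφ.comp measurable_prodMk_left
  rw [lintegral_const_mul _ hφ']
  congr 1
  rw [stepKernel, Kernel.prod_apply, lintegral_prod _ hφ'.aemeasurable]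
  rfl

instance (Q : Kernel S S) (x₀ : S) : IsProbabilityMeasure (pathLaw Q x₀) := by
  unfold pathLaw; infer_instance

open Classical in
/-- The indicator that the step from `x` to `y` is not a return to `x₀`. -/
noncomputable def noReturn (x₀ x y : S) : ENNReal := if y = x₀ ∧ x ≠ x₀ then 0 else 1

/-- The indicator that the first `n` jumps contain no return to `x₀`. -/
noncomputable def alive (x₀ : S) (n : ℕ) (ω : ℕ → S × ℝ) : ENNReal :=
  ∏ j ∈ Finset.range n, noReturn x₀ (ω j).1 (ω (j + 1)).1

theorem alive_zero (x₀ : S) (ω : ℕ → S × ℝ) : alive x₀ 0 ω = 1 := Finset.prod_range_zero _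

theorem alive_succ (x₀ : S) (n : ℕ) (ω : ℕ → S × ℝ) :
    alive x₀ (n + 1) ω = alive x₀ n ω * noReturn x₀ (ω n).1 (ω (n + 1)).1 :=
  Finset.prod_range_succ _ _

theorem noReturn_le_one (x₀ x y : S) : noReturn x₀ x y ≤ 1 := by
  unfold noReturn; split_ifs <;> simp

theorem alive_eq_zero_or_one (x₀ : S) (n : ℕ) (ω : ℕ → S × ℝ) :
    alive x₀ n ω = 0 ∨ alive x₀ n ω = 1 := by
  induction n with
  | zero => exact Or.inr (alive_zero _ _)
  | succ n ih =>
    rw [alive_succ]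
    unfold noReturn
    split_ifs <;> simp [ih]

theorem alive_antitone (x₀ : S) (ω : ℕ → S × ℝ) : Antitone fun n => alive x₀ n ω :=
  antitone_nat_of_succ_le fun n => by
    rw [alive_succ]; exact mul_le_of_le_one_right' (noReturn_le_one _ _ _)

theorem measurable_noReturn {x₀ : S} (hx₀ : MeasurableSet {x₀}) :
    Measurable fun p : S × S => noReturn x₀ p.1 p.2 := by
  unfold noReturn
  refine Measurable.ite ?_ measurable_const measurable_const
  exact (measurable_snd hx₀).inter (measurable_fst hx₀.compl)

theorem measurable_alive {x₀ : S} (hx₀ : MeasurableSet {x₀}) (n : ℕ) :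
    Measurable (alive x₀ n) := by
  unfold alive
  refine Finset.measurable_fun_prod _ fun j _ => ?_
  exact (measurable_noReturn hx₀).comp
    ((measurable_fst.comp (measurable_pi_apply _)).prodMk
      (measurable_fst.comp (measurable_pi_apply _)))

/-- Survival up to time `n` depends on the past only; this is the form in which
`lintegral_pathLaw_succ` accepts it. -/
theorem exists_alive_eq_frestrictLe {x₀ : S} (hx₀ : MeasurableSet {x₀}) (n : ℕ) :
    ∃ F : ((i : Finset.Iic n) → S × ℝ) → ENNReal, Measurable F ∧
      ∀ ω, alive x₀ n ω = F (Preorder.frestrictLe n ω) := by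
  refine ⟨fun h => ∏ j : Fin n, noReturn x₀ (h ⟨j, Finset.mem_Iic.2 j.2.le⟩).1
    (h ⟨j + 1, Finset.mem_Iic.2 j.2⟩).1, ?_, fun ω => ?_⟩
  · refine Finset.measurable_fun_prod _ fun j _ => ?_
    exact (measurable_noReturn hx₀).comp
      ((measurable_fst.comp (measurable_pi_apply _)).prodMk
        (measurable_fst.comp (measurable_pi_apply _)))
  · exact (Fin.prod_univ_eq_prod_range
      (fun j => noReturn x₀ (ω j).1 (ω (j + 1)).1) n).symm

theorem lintegral_alive_mul_step (Q : Kernel S S) {x₀ : S} (hx₀ : MeasurableSet {x₀}) (n : ℕ)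
    (φ : S × S → ENNReal) (hφ : Measurable φ) :
    ∫⁻ ω, alive x₀ n ω * φ ((ω n).1, (ω (n + 1)).1) ∂(pathLaw Q x₀)
      = ∫⁻ ω, alive x₀ n ω * ∫⁻ y, φ ((ω n).1, y) ∂(jumpKernel Q (ω n).1) ∂(pathLaw Q x₀) := by
  obtain ⟨F, hF, hFe⟩ := exists_alive_eq_frestrictLe hx₀ n
  simp only [hFe]
  have := lintegral_pathLaw_succ Q x₀ n F hF (fun p => φ (p.1, p.2.1)) (by fun_prop)
  simpa using this

theorem lintegral_alive_succ_mul (Q : Kernel S S) {x₀ : S} (hx₀ : MeasurableSet {x₀}) (n : ℕ)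
    (h : S → ENNReal) (hh : Measurable h) :
    ∫⁻ ω, alive x₀ (n + 1) ω * h (ω (n + 1)).1 ∂(pathLaw Q x₀)
      = ∫⁻ ω, alive x₀ n ω * ∫⁻ y, noReturn x₀ (ω n).1 y * h y ∂(jumpKernel Q (ω n).1)
        ∂(pathLaw Q x₀) := by
  rw [← lintegral_alive_mul_step Q hx₀ n (fun p => noReturn x₀ p.1 p.2 * h p.2)
    ((measurable_noReturn hx₀).mul (hh.comp measurable_snd))]
  simp only [alive_succ, mul_assoc]

/-- The variable `Eₙ` has mean `1` and is independent of the states up to time `n`. For `n = 0` it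
comes from the initial law, later from the step that leads into the `n`-th state. -/
theorem lintegral_alive_mul_holding (Q : Kernel S S) {x₀ : S} (hx₀ : MeasurableSet {x₀}) (n : ℕ)
    (h : S → ENNReal) (hh : Measurable h) :
    ∫⁻ ω, alive x₀ n ω * (ENNReal.ofReal (ω n).2 * h (ω n).1) ∂(pathLaw Q x₀)
      = ∫⁻ ω, alive x₀ n ω * h (ω n).1 ∂(pathLaw Q x₀) := by
  cases n with
  | zero =>
    simp only [alive_zero, one_mul]
    rw [lintegral_pathLaw_zero Q x₀ (fun p => ENNReal.ofReal p.2 * h p.1) (by fun_prop),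
      lintegral_pathLaw_zero Q x₀ (fun p => h p.1) (by fun_prop)]
    dsimp only
    rw [lintegral_mul_const _ (by fun_prop), lintegral_ofReal_expMeasure_one]
    simp
  | succ n =>
    rw [lintegral_alive_succ_mul Q hx₀ n h hh]
    obtain ⟨F, hF, hFe⟩ := exists_alive_eq_frestrictLe hx₀ n
    simp only [alive_succ, hFe, mul_assoc]
    have hm := measurable_noReturn hx₀
    rw [lintegral_pathLaw_succ Q x₀ n F hF
      (fun p => noReturn x₀ p.1 p.2.1 * (ENNReal.ofReal p.2.2 * h p.2.1))
      ((hm.comp (measurable_fst.prodMk (measurable_fst.comp measurable_snd))).mul (by fun_prop))]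
    refine lintegral_congr fun ω => ?_
    congr 1
    refine lintegral_congr fun y => ?_
    dsimp only
    rw [lintegral_const_mul _ (by fun_prop), lintegral_mul_const _ (by fun_prop),
      lintegral_ofReal_expMeasure_one, one_mul]

/-- Links the stepwise description to the one in `returnTime`. If the path is in `x₀` after having
been elsewhere, then tracing it back from there one meets a step into `x₀` from another state. -/
theorem alive_ne_zero_iff (x₀ : S) (n : ℕ) (ω : ℕ → S × ℝ) :
    alive x₀ n ω ≠ 0 ↔ ∀ k ≤ n, ¬ ((ω k).1 = x₀ ∧ ∃ m < k, (ω m).1 ≠ x₀) := by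
  simp only [alive, Finset.prod_ne_zero_iff, Finset.mem_range, noReturn]
  constructor
  · intro h k
    induction k with
    | zero => simp
    | succ k ih =>
      rintro hk ⟨h1, m, hm, h2⟩
      have h3 : (ω k).1 = x₀ := by
        by_contra h3
        exact h k (by omega) (if_pos ⟨h1, h3⟩)
      rcases Nat.lt_succ_iff_lt_or_eq.1 hm with hm | rfl
      · exact ih (by omega) ⟨h3, m, hm, h2⟩
      · exact h2 h3
  · intro h j hj
    rw [if_neg]
    · exact one_ne_zero
    · exact fun h' => h (j + 1) (by omega) ⟨h'.1, j, by omega, h'.2⟩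

/-- The surviving indices are exactly those before the first return. The hypothesis cannot be
dropped: on a path that never returns the left side is `⊤`, while the sum of the holding times may
be finite. -/
theorem returnTime_le_tsum_alive (Q : Kernel S S) (x₀ : S) (ω : ℕ → S × ℝ)
    (h : ∃ n, alive x₀ n ω = 0) :
    returnTime Q x₀ ω
      ≤ ∑' n, alive x₀ n ω * (ENNReal.ofReal (ω n).2 / Q (ω n).1 Set.univ) := by
  classical
  have h' : ∃ n, (ω n).1 = x₀ ∧ ∃ m < n, (ω m).1 ≠ x₀ := by
    obtain ⟨n, hn⟩ := h
    by_contra hcon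
    push Not at hcon
    refine (alive_ne_zero_iff x₀ n ω).2 (fun k _ hk => ?_) hn
    obtain ⟨h1, m, hm, h2⟩ := hk
    exact h2 (hcon k h1 m hm)
  have hspec := Nat.find_spec h'
  refine (iInf₂_le (Nat.find h') hspec).trans ?_
  refine le_trans (Finset.sum_le_sum fun i hi => ?_) (ENNReal.sum_le_tsum (Finset.range (Nat.find h')))
  rw [(alive_eq_zero_or_one x₀ i ω).resolve_left, one_mul]
  rw [← ne_eq, alive_ne_zero_iff]
  intro k hk
  exact Nat.find_min h' (lt_of_le_of_lt hk (Finset.mem_range.1 hi))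

theorem tsum_alive_le_returnTime (Q : Kernel S S) (x₀ : S) (ω : ℕ → S × ℝ) :
    ∑' n, alive x₀ n ω * (ENNReal.ofReal (ω n).2 / Q (ω n).1 Set.univ) ≤ returnTime Q x₀ ω := by
  refine le_iInf₂ fun n hn => ?_
  have hz : ∀ i, n ≤ i → alive x₀ i ω = 0 := by
    intro i hi
    by_contra hne
    exact (alive_ne_zero_iff x₀ i ω).1 hne n hi hn
  rw [tsum_eq_sum (s := Finset.range n)]
  · refine Finset.sum_le_sum fun i _ => ?_
    rcases alive_eq_zero_or_one x₀ i ω with h | h <;> simp [h]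
  · intro i hi
    rw [hz i (by simpa using hi), zero_mul]

theorem exists_alive_eq_zero_of_returnTime_lt_top (Q : Kernel S S) (x₀ : S) (ω : ℕ → S × ℝ)
    (h : returnTime Q x₀ ω < ⊤) : ∃ n, alive x₀ n ω = 0 := by
  by_contra hcon
  push Not at hcon
  refine h.ne ?_
  simp only [returnTime, iInf_eq_top]
  intro n hn
  exact absurd hn ((alive_ne_zero_iff x₀ n ω).1 (hcon n) n le_rfl)

/-- Turns the expected time before the return into a sum over the jump chain alone, each visited
state contributing its mean holding time. -/
theorem tsum_lintegral_alive_div (Q : Kernel S S) {x₀ : S} (hx₀ : MeasurableSet {x₀}) :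
    ∫⁻ ω, ∑' n, alive x₀ n ω * (ENNReal.ofReal (ω n).2 / Q (ω n).1 Set.univ) ∂(pathLaw Q x₀)
      = ∑' n, ∫⁻ ω, alive x₀ n ω * (Q (ω n).1 Set.univ)⁻¹ ∂(pathLaw Q x₀) := by
  have hQ : Measurable fun x => Q x Set.univ := Q.measurable_coe MeasurableSet.univ
  rw [lintegral_tsum]
  · refine tsum_congr fun n => ?_
    simp only [div_eq_mul_inv]
    exact lintegral_alive_mul_holding Q hx₀ n (fun x => (Q x Set.univ)⁻¹) hQ.inv
  · intro n
    refine ((measurable_alive hx₀ n).mul (Measurable.div ?_ ?_)).aemeasurable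
    · exact ENNReal.measurable_ofReal.comp (measurable_snd.comp (measurable_pi_apply _))
    · exact hQ.comp (measurable_fst.comp (measurable_pi_apply _))

/-- The Foster criterion for the jump chain: with a uniformly positive decrease of `G` in every
state, where returns to `x₀` do not count, `x₀` is positive recurrent. -/
theorem positiveRecurrent_of_jump_drift (Q : Kernel S S) {x₀ : S} (hx₀ : MeasurableSet {x₀})
    (G : S → ENNReal) (hG : Measurable G) (hG₀ : G x₀ ≠ ⊤) (ε c : ENNReal) (hε : ε ≠ 0)
    (hc : c ≠ 0) (hQ : ∀ x, c ≤ Q x Set.univ)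
    (hdrift : ∀ x, ∫⁻ y, noReturn x₀ x y * G y ∂(jumpKernel Q x) + ε ≤ G x) :
    PositiveRecurrent Q x₀ := by
  set P := pathLaw Q x₀ with hP
  have hmeas : ∀ n, Measurable fun ω : ℕ → S × ℝ => alive x₀ n ω * G (ω n).1 := fun n =>
    (measurable_alive hx₀ n).mul (hG.comp (measurable_fst.comp (measurable_pi_apply _)))
  have hstep : ∀ n, ∫⁻ ω, alive x₀ (n + 1) ω * G (ω (n + 1)).1 ∂P + ε * ∫⁻ ω, alive x₀ n ω ∂P
      ≤ ∫⁻ ω, alive x₀ n ω * G (ω n).1 ∂P := by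
    intro n
    rw [hP, lintegral_alive_succ_mul Q hx₀ n G hG, ← lintegral_const_mul _ (measurable_alive hx₀ n),
      ← lintegral_add_right _ ((measurable_alive hx₀ n).const_mul _)]
    refine lintegral_mono fun ω => ?_
    change alive x₀ n ω * _ + ε * alive x₀ n ω ≤ _
    rw [mul_comm ε, ← mul_add]
    gcongr
    exact hdrift _
  have hsum : ∀ n, ∫⁻ ω, alive x₀ n ω * G (ω n).1 ∂P
      + ε * ∑ i ∈ Finset.range n, ∫⁻ ω, alive x₀ i ω ∂P ≤ G x₀ := by
    intro n
    induction n with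
    | zero =>
      simp only [alive_zero, one_mul, Finset.range_zero, Finset.sum_empty, mul_zero, add_zero]
      rw [hP, lintegral_pathLaw_zero Q x₀ (fun p => G p.1) (by fun_prop)]
      simp
    | succ n ih =>
      refine le_trans ?_ ih
      rw [Finset.sum_range_succ, mul_add, add_comm (ε * _), ← add_assoc]
      gcongr
      exact hstep n
  -- The sum is the expected number of jumps before the return; each costs `ε` out of the initial
  -- stock `G x₀`.
  have hfin : ∑' n, ∫⁻ ω, alive x₀ n ω ∂P < ⊤ := by
    have h1 : ε * ∑' n, ∫⁻ ω, alive x₀ n ω ∂P ≤ G x₀ := by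
      rw [← ENNReal.tsum_mul_left]
      refine ENNReal.tsum_le_of_sum_range_le fun n => ?_
      rw [← Finset.mul_sum]
      exact le_add_self.trans (hsum n)
    by_contra hcon
    rw [not_lt, top_le_iff] at hcon
    rw [hcon, ENNReal.mul_top hε, top_le_iff] at h1
    exact hG₀ h1
  have hae : ∀ᵐ ω ∂P, ∃ n, alive x₀ n ω = 0 := by
    rw [← lintegral_tsum fun n => (measurable_alive hx₀ n).aemeasurable] at hfin
    filter_upwards [ae_lt_top (Measurable.tsum fun n => measurable_alive hx₀ n) hfin.ne] with ω hω
    by_contra hcon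
    push Not at hcon
    have : ∀ n, alive x₀ n ω = 1 := fun n => (alive_eq_zero_or_one x₀ n ω).resolve_left (hcon n)
    simp only [this] at hω
    exact hω.ne (ENNReal.tsum_const_eq_top_of_ne_zero one_ne_zero)
  unfold PositiveRecurrent
  calc ∫⁻ ω, returnTime Q x₀ ω ∂P
      ≤ ∫⁻ ω, ∑' n, alive x₀ n ω * (ENNReal.ofReal (ω n).2 / Q (ω n).1 Set.univ) ∂P :=
        lintegral_mono_ae (hae.mono fun ω hω => returnTime_le_tsum_alive Q x₀ ω hω)
    _ = ∑' n, ∫⁻ ω, alive x₀ n ω * (Q (ω n).1 Set.univ)⁻¹ ∂P := tsum_lintegral_alive_div Q hx₀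
    _ ≤ ∑' n, (∫⁻ ω, alive x₀ n ω ∂P) * c⁻¹ := by
        refine ENNReal.tsum_le_tsum fun n => ?_
        rw [← lintegral_mul_const _ (measurable_alive hx₀ n)]
        exact lintegral_mono fun ω => mul_le_mul_right (ENNReal.inv_le_inv.2 (hQ _)) _
    _ = (∑' n, ∫⁻ ω, alive x₀ n ω ∂P) * c⁻¹ := ENNReal.tsum_mul_right
    _ < ⊤ := ENNReal.mul_lt_top hfin (ENNReal.inv_lt_top.2 (pos_iff_ne_zero.2 hc))

end JumpProcess

/-! ### Drift conditions in terms of the jump rates. -/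

section Lyapunov

variable {S : Type} [MeasurableSpace S]

theorem jumpKernel_apply_of_finite (Q : Kernel S S) (x : S) [IsFiniteMeasure (Q x)]
    (hQ : Q x Set.univ ≠ 0) : jumpKernel Q x = (Q x Set.univ)⁻¹ • Q x := by
  change (if Q x Set.univ = 0 ∨ Q x Set.univ = ⊤ then Measure.dirac x
      else (Q x Set.univ)⁻¹ • Q x) = _
  rw [if_neg]
  exact not_or.2 ⟨hQ, measure_ne_top _ _⟩

theorem lintegral_jumpKernel_ofReal (Q : Kernel S S) (x : S) [IsFiniteMeasure (Q x)]
    (hQ : 0 < (Q x).real Set.univ) (g : S → ℝ) (hg₀ : ∀ x, 0 ≤ g x) (hgi : Integrable g (Q x)) :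
    ∫⁻ y, ENNReal.ofReal (g y) ∂(jumpKernel Q x)
      = ENNReal.ofReal ((∫ y, g y ∂(Q x)) / (Q x).real Set.univ) := by
  have h0 : Q x Set.univ ≠ 0 := fun h => by simp [Measure.real, h] at hQ
  rw [jumpKernel_apply_of_finite Q x h0, lintegral_smul_measure,
    ← ofReal_integral_eq_lintegral_ofReal hgi (ae_of_all _ hg₀), div_eq_inv_mul,
    ENNReal.ofReal_mul (by positivity), ENNReal.ofReal_inv_of_pos hQ, Measure.real,
    ENNReal.ofReal_toReal (measure_ne_top _ _), smul_eq_mul]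

/-- The Foster criterion with a decrease of the Lyapunov function in all states but one. -/
theorem positiveRecurrent_of_uniform_drift (Q : Kernel S S) [∀ x, IsFiniteMeasure (Q x)] {x₀ : S}
    (hx₀ : MeasurableSet {x₀}) {c C : ℝ} (hc : 0 < c) (hcQ : ∀ x, c ≤ (Q x).real Set.univ)
    (hQC : ∀ x, (Q x).real Set.univ ≤ C) (g : S → ℝ) (hg : Measurable g) (hg₀ : ∀ x, 0 ≤ g x)
    (hgi : ∀ x, Integrable g (Q x)) {ε : ℝ} (hε : 0 < ε)
    (hdrift : ∀ x, x ≠ x₀ → ∫ y, (g y - g x) ∂(Q x) ≤ -ε) (hleave : Q x₀ {x₀}ᶜ ≠ 0) :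
    PositiveRecurrent Q x₀ := by
  classical
  have hpos : ∀ x, 0 < (Q x).real Set.univ := fun x => hc.trans_le (hcQ x)
  have hC : 0 < C := (hpos x₀).trans_le (hQC x₀)
  set I : ENNReal := ∫⁻ y, ENNReal.ofReal (g y) ∂(jumpKernel Q x₀) with hI
  have hIfin : I ≠ ⊤ := by
    rw [hI, lintegral_jumpKernel_ofReal Q x₀ (hpos _) g hg₀ (hgi _)]
    exact ENNReal.ofReal_ne_top
  set b : ENNReal := jumpKernel Q x₀ {x₀}ᶜ with hb
  have hb0 : b ≠ 0 := by
    have h0 : Q x₀ Set.univ ≠ 0 := fun h => by simpa [Measure.real, h] using hpos x₀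
    rw [hb, jumpKernel_apply_of_finite Q x₀ h0, Measure.smul_apply, smul_eq_mul]
    exact mul_ne_zero (ENNReal.inv_ne_zero.2 (measure_ne_top _ _)) hleave
  have hbfin : b ≠ ⊤ := measure_ne_top _ _
  -- A drift of `-ε` per unit of time is at least `-ε / C` per jump, because jumps occur at rate at
  -- most `C`.
  set η : ENNReal := ENNReal.ofReal (ε / C) with hη
  -- The value of the Lyapunov function at `x₀`. A jump from `x₀` to itself is not a return and
  -- keeps the value `A`, so the drift condition at `x₀` follows from `I + A (1 - b) + η ≤ A`, which
  -- holds with equality for this `A`.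
  set A : ENNReal := (I + η) / b with hA
  have hAb : A * b = I + η := ENNReal.div_mul_cancel hb0 hbfin
  let G : S → ENNReal := fun x => if x = x₀ then A else ENNReal.ofReal (g x)
  have hGm : Measurable G :=
    Measurable.ite hx₀ measurable_const (ENNReal.measurable_ofReal.comp hg)
  refine positiveRecurrent_of_jump_drift Q hx₀ G hGm ?_ η (ENNReal.ofReal c) ?_ ?_ ?_ ?_
  · simp only [G, if_true, hA]
    exact ENNReal.div_ne_top (ENNReal.add_ne_top.2 ⟨hIfin, ENNReal.ofReal_ne_top⟩) hb0
  · exact (ENNReal.ofReal_pos.2 (by positivity)).ne'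
  · exact (ENNReal.ofReal_pos.2 hc).ne'
  · intro x
    rw [← ENNReal.ofReal_toReal (measure_ne_top (Q x) Set.univ)]
    exact ENNReal.ofReal_le_ofReal (hcQ x)
  · intro x
    by_cases hx : x = x₀
    · subst hx
      have h1 : ∀ y, noReturn x x y * G y
          ≤ ENNReal.ofReal (g y) + ({x} : Set S).indicator (fun _ => A) y := by
        intro y
        by_cases hy : y = x <;> simp [noReturn, G, hy]
      calc ∫⁻ y, noReturn x x y * G y ∂(jumpKernel Q x) + η
          ≤ (I + A * jumpKernel Q x {x}) + η := by
            gcongr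
            refine (lintegral_mono h1).trans ?_
            rw [lintegral_add_left (f := fun y => ENNReal.ofReal (g y)) (ENNReal.measurable_ofReal.comp hg),
              lintegral_indicator_const hx₀]
        _ = A * (jumpKernel Q x {x} + b) := by rw [mul_add, hAb]; ring
        _ = G x := by
            rw [hb, measure_add_measure_compl hx₀, measure_univ, mul_one]
            simp [G]
    · have h1 : ∀ y, noReturn x₀ x y * G y ≤ ENNReal.ofReal (g y) := by
        intro y
        by_cases hy : y = x₀ <;> simp [noReturn, G, hx, hy]
      have h2 : ∫ y, g y ∂(Q x) ≤ (Q x).real Set.univ * g x - ε := by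
        have := hdrift x hx
        rw [integral_sub (hgi x) (integrable_const _), integral_const, smul_eq_mul] at this
        linarith
      have hfirst : 0 ≤ ∫ y, g y ∂(Q x) := integral_nonneg hg₀
      have h3 : (∫ y, g y ∂(Q x)) / (Q x).real Set.univ + ε / C ≤ g x := by
        have h4 : ε / C ≤ ε / (Q x).real Set.univ :=
          div_le_div_of_nonneg_left hε.le (hpos x) (hQC x)
        have h5 : (∫ y, g y ∂(Q x)) / (Q x).real Set.univ + ε / (Q x).real Set.univ ≤ g x := by
          rw [← add_div, div_le_iff₀ (hpos x)]
          linarith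
        linarith
      calc ∫⁻ y, noReturn x₀ x y * G y ∂(jumpKernel Q x) + η
          ≤ ∫⁻ y, ENNReal.ofReal (g y) ∂(jumpKernel Q x) + η := by
            gcongr; exact h1 _
        _ = ENNReal.ofReal ((∫ y, g y ∂(Q x)) / (Q x).real Set.univ + ε / C) := by
            rw [lintegral_jumpKernel_ofReal Q x (hpos _) g hg₀ (hgi _), hη,
              ENNReal.ofReal_add (div_nonneg hfirst (hpos x).le) (by positivity)]
        _ ≤ G x := by
            simp only [G, if_neg hx]
            exact ENNReal.ofReal_le_ofReal h3

/-- The Foster criterion: a decrease of the Lyapunov function `g` where `d` is large, together with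
a transition that lowers `d` at a rate of at least `δ` in every state but one. -/
theorem positiveRecurrent_of_drift (Q : Kernel S S) [∀ x, IsFiniteMeasure (Q x)] {x₀ : S}
    (hx₀ : MeasurableSet {x₀}) {c C : ℝ} (hc : 0 < c) (hcQ : ∀ x, c ≤ (Q x).real Set.univ)
    (hQC : ∀ x, (Q x).real Set.univ ≤ C) (g : S → ℝ) (hg : Measurable g) (hg₀ : ∀ x, 0 ≤ g x)
    (hgi : ∀ x, Integrable g (Q x)) (d : S → ℕ) (hd : Measurable d) {D : ℕ} {ε b δ : ℝ}
    (hε : 0 < ε) (hδ : 0 < δ) (hdrift : ∀ x, D < d x → ∫ y, (g y - g x) ∂(Q x) ≤ -ε)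
    (hb : ∀ x, ∫ y, (g y - g x) ∂(Q x) ≤ b)
    (hdown : ∀ x, x ≠ x₀ → δ ≤ (Q x).real {y | d y < d x}) (hleave : Q x₀ {x₀}ᶜ ≠ 0) :
    PositiveRecurrent Q x₀ := by
  have hC : 0 < C := (hc.trans_le (hcQ x₀)).trans_le (hQC x₀)
  -- For `φ = 1 - r ^ d`, jumps that do not lower `d` raise `φ` by at most `r ^ d x`, at total rate
  -- at most `C`; jumps that lower `d` change it by at most `r ^ d x - r ^ (d x - 1)`, at rate at
  -- least `δ`. With `C r ≤ δ / 2` the second effect wins, and `φ` has negative drift in every state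
  -- but `x₀`.
  obtain ⟨r, hr0, hr1, hrC⟩ : ∃ r : ℝ, 0 < r ∧ r < 1 ∧ C * r ≤ δ / 2 := by
    refine ⟨min (1 / 2) (δ / (2 * C)), by positivity, ?_, ?_⟩
    · exact (min_le_left _ _).trans_lt (by norm_num)
    · calc C * min (1 / 2) (δ / (2 * C)) ≤ C * (δ / (2 * C)) := by gcongr; exact min_le_right _ _
        _ = δ / 2 := by field_simp
  -- Chosen so that for `d x ≤ D` the drift of `A φ` is at most `-(|b| + 1)`, which outweighs the
  -- bound `b` for the drift of `g`.
  set A : ℝ := (|b| + 1) * 2 / (δ * r ^ D) with hA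
  have hA0 : 0 ≤ A := by positivity
  let φ : S → ℝ := fun x => 1 - r ^ d x
  have hφ0 : ∀ x, 0 ≤ φ x := fun x => sub_nonneg.2 (pow_le_one₀ hr0.le hr1.le)
  have hφ1 : ∀ x, φ x ≤ 1 := fun x => sub_le_self _ (by positivity)
  have hφm : Measurable φ := by
    have : Measurable fun n : ℕ => 1 - r ^ n := Measurable.of_discrete
    exact this.comp hd
  have hφi : ∀ x, Integrable φ (Q x) := fun x => by
    refine Integrable.of_bound hφm.aestronglyMeasurable 1 (ae_of_all _ fun y => ?_)
    rw [Real.norm_eq_abs, abs_of_nonneg (hφ0 y)]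
    exact hφ1 y
  have hφd : ∀ x, x ≠ x₀ → ∫ y, (φ y - φ x) ∂(Q x) ≤ -(r ^ d x * (δ / 2)) := by
    intro x hx
    have hset : MeasurableSet {y | d y < d x} := hd (measurableSet_Iio)
    obtain ⟨e, he⟩ : ∃ e, d x = e + 1 := by
      refine Nat.exists_eq_succ_of_ne_zero fun h => ?_
      have := hdown x hx
      simp only [h, not_lt_zero, Set.ofPred_false, measureReal_empty] at this
      linarith
    have hpt : ∀ y, φ y - φ x ≤ r ^ d x - {y | d y < d x}.indicator (fun _ => r ^ e) y := by
      intro y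
      by_cases hy : d y < d x
      · rw [Set.indicator_of_mem (show y ∈ {y | d y < d x} from hy)]
        have : r ^ e ≤ r ^ d y := pow_le_pow_of_le_one hr0.le hr1.le (by omega)
        simp only [φ]
        linarith
      · rw [Set.indicator_of_notMem (show y ∉ {y | d y < d x} from hy)]
        have : 0 ≤ r ^ d y := by positivity
        simp only [φ]
        linarith
    have hi : Integrable ({y | d y < d x}.indicator fun _ => r ^ e) (Q x) :=
      (integrable_const _).indicator hset
    calc ∫ y, (φ y - φ x) ∂(Q x)
        ≤ ∫ y, (r ^ d x - {y | d y < d x}.indicator (fun _ => r ^ e) y) ∂(Q x) :=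
          integral_mono ((hφi x).sub (integrable_const _)) ((integrable_const _).sub hi) hpt
      _ = (Q x).real Set.univ * r ^ d x - (Q x).real {y | d y < d x} * r ^ e := by
          rw [integral_sub (integrable_const _) hi, integral_const, integral_indicator_const _ hset,
            smul_eq_mul, smul_eq_mul]
      _ ≤ C * r ^ d x - δ * r ^ e := by
          have := hdown x hx
          have := hQC x
          gcongr
      _ ≤ -(r ^ d x * (δ / 2)) := by
          have h1 : r ^ d x = r ^ e * r := by rw [he, pow_succ]
          have h2 : 0 < r ^ e := by positivity
          have h3 : C * r ^ d x ≤ r ^ e * (δ / 2) := by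
            rw [h1]; nlinarith
          have h4 : r ^ d x * (δ / 2) ≤ r ^ e * (δ / 2) := by
            rw [h1]; gcongr; nlinarith
          nlinarith
  refine positiveRecurrent_of_uniform_drift Q hx₀ hc hcQ hQC (fun x => g x + A * φ x)
    (hg.add (hφm.const_mul A)) (fun x => add_nonneg (hg₀ x) (mul_nonneg hA0 (hφ0 x)))
    (fun x => (hgi x).add ((hφi x).const_mul A)) (ε := min ε 1) (by positivity) ?_ hleave
  intro x hx
  have hsplit : ∫ y, (g y + A * φ y - (g x + A * φ x)) ∂(Q x)
      = ∫ y, (g y - g x) ∂(Q x) + A * ∫ y, (φ y - φ x) ∂(Q x) := by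
    have i1 : Integrable (fun y => g y - g x) (Q x) := (hgi x).sub (integrable_const _)
    have i2 : Integrable (fun y => A * (φ y - φ x)) (Q x) :=
      ((hφi x).sub (integrable_const _)).const_mul A
    rw [← integral_const_mul, ← integral_add i1 i2]
    refine integral_congr_ae (ae_of_all _ fun y => ?_)
    ring
  rw [hsplit]
  have h1 := hφd x hx
  by_cases hD : D < d x
  · have h2 := hdrift x hD
    have h3 : ∫ y, (φ y - φ x) ∂(Q x) ≤ 0 := h1.trans (by simp; positivity)
    have := min_le_left ε 1
    nlinarith [mul_nonneg hA0 (neg_nonneg.2 h3)]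
  · have h2 := hb x
    have h3 : r ^ D ≤ r ^ d x := pow_le_pow_of_le_one hr0.le hr1.le (not_lt.1 hD)
    have h4 : A * (r ^ D * (δ / 2)) = |b| + 1 := by
      rw [hA]; field_simp
    have h5 : A * (r ^ D * (δ / 2)) ≤ A * (r ^ d x * (δ / 2)) := by gcongr
    have h6 : A * ∫ y, (φ y - φ x) ∂(Q x) ≤ A * -(r ^ d x * (δ / 2)) := by gcongr
    have := min_le_right ε 1
    have := le_abs_self b
    linarith

/-- The Foster criterion for the quadratic Lyapunov function `½ ∑ k, a k ^ 2`. -/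
theorem positiveRecurrent_of_quadratic_drift {ι : Type*} (Q : Kernel S S)
    [∀ x, IsFiniteMeasure (Q x)] {x₀ : S} (hx₀ : MeasurableSet {x₀}) {c C : ℝ} (hc : 0 < c)
    (hcQ : ∀ x, c ≤ (Q x).real Set.univ) (hQC : ∀ x, (Q x).real Set.univ ≤ C) (T : Finset ι)
    (a : ι → S → ℝ) (ha : ∀ k ∈ T, Measurable (a k)) {B : ℝ}
    (hB : ∀ k ∈ T, ∀ x, ∀ᵐ y ∂(Q x), |a k y - a k x| ≤ B) (N : S → ℝ) (hN : ∀ x, 0 ≤ N x)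
    (d : S → ℕ) (hd : Measurable d) {c₀ c₁ ε δ : ℝ} (hdN : ∀ x, d x ≤ c₁ * (N x + 1))
    (hε : 0 < ε) (hδ : 0 < δ)
    (hdrift : ∀ x, ∑ k ∈ T, a k x * ∫ y, (a k y - a k x) ∂(Q x) ≤ c₀ - ε * N x)
    (hdown : ∀ x, x ≠ x₀ → δ ≤ (Q x).real {y | d y < d x}) (hleave : Q x₀ {x₀}ᶜ ≠ 0) :
    PositiveRecurrent Q x₀ := by
  have hC : 0 < C := (hc.trans_le (hcQ x₀)).trans_le (hQC x₀)
  have hai : ∀ k ∈ T, ∀ x, Integrable (a k) (Q x) := fun k hk x => by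
    refine Integrable.of_bound (ha k hk).aestronglyMeasurable (|a k x| + B) ?_
    filter_upwards [hB k hk x] with y hy
    rw [Real.norm_eq_abs]
    have := abs_sub_abs_le_abs_sub (a k y) (a k x)
    linarith
  have hai2 : ∀ k ∈ T, ∀ x, Integrable (fun y => a k y ^ 2) (Q x) := fun k hk x => by
    refine Integrable.of_bound ((ha k hk).pow_const 2).aestronglyMeasurable ((|a k x| + B) ^ 2) ?_
    filter_upwards [hB k hk x] with y hy
    rw [Real.norm_eq_abs, abs_pow]
    have := abs_sub_abs_le_abs_sub (a k y) (a k x)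
    gcongr
    linarith
  set E : ℝ := ∑ k ∈ T, B ^ 2 / 2 * C with hE
  have hgi : ∀ x, Integrable (fun y => ∑ k ∈ T, a k y ^ 2 / 2) (Q x) := fun x =>
    integrable_finsetSum _ fun k hk => (hai2 k hk x).div_const 2
  have hgd : ∀ x, ∫ y, (∑ k ∈ T, a k y ^ 2 / 2 - ∑ k ∈ T, a k x ^ 2 / 2) ∂(Q x)
      ≤ c₀ + E - ε * N x := by
    intro x
    have h1 : ∫ y, (∑ k ∈ T, a k y ^ 2 / 2 - ∑ k ∈ T, a k x ^ 2 / 2) ∂(Q x)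
        = ∑ k ∈ T, ∫ y, (a k y ^ 2 / 2 - a k x ^ 2 / 2) ∂(Q x) := by
      simp only [← Finset.sum_sub_distrib]
      exact integral_finsetSum _ fun k hk =>
        ((hai2 k hk x).div_const 2).sub (integrable_const _)
    have h2 : ∀ k ∈ T, ∫ y, (a k y ^ 2 / 2 - a k x ^ 2 / 2) ∂(Q x)
        ≤ a k x * ∫ y, (a k y - a k x) ∂(Q x) + B ^ 2 / 2 * C := by
      intro k hk
      have hint : Integrable (fun y => a k x * (a k y - a k x)) (Q x) :=
        ((hai k hk x).sub (integrable_const _)).const_mul _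
      -- From `a'^2 / 2 - a^2 / 2 = a (a' - a) + (a' - a)^2 / 2`: bounded jumps make the
      -- second-order term bounded.
      calc ∫ y, (a k y ^ 2 / 2 - a k x ^ 2 / 2) ∂(Q x)
          ≤ ∫ y, (a k x * (a k y - a k x) + B ^ 2 / 2) ∂(Q x) := by
            refine integral_mono_ae (((hai2 k hk x).div_const 2).sub (integrable_const _))
              (hint.add (integrable_const _)) ?_
            filter_upwards [hB k hk x] with y hy
            have := sq_le_sq' (abs_le.1 hy).1 (abs_le.1 hy).2
            nlinarith
        _ = a k x * ∫ y, (a k y - a k x) ∂(Q x) + (Q x).real Set.univ * (B ^ 2 / 2) := by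
            rw [integral_add hint (integrable_const _), integral_const_mul, integral_const,
              smul_eq_mul]
        _ ≤ a k x * ∫ y, (a k y - a k x) ∂(Q x) + B ^ 2 / 2 * C := by
            rw [mul_comm (B ^ 2 / 2)]
            have := hQC x
            gcongr
    rw [h1]
    refine (Finset.sum_le_sum h2).trans ?_
    rw [Finset.sum_add_distrib, ← hE]
    linarith [hdrift x]
  -- Beyond this level of `d`, the bound `d ≤ c₁ (N + 1)` makes `ε N` exceed `|c₀ + E| + 1`, so the
  -- drift is at most `-1`.
  obtain ⟨D, hD⟩ := exists_nat_ge (|c₁| * ((|c₀ + E| + 1) / ε + 1))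
  refine positiveRecurrent_of_drift Q hx₀ hc hcQ hQC (fun x => ∑ k ∈ T, a k x ^ 2 / 2)
    (Finset.measurable_fun_sum _ fun k hk => ((ha k hk).pow_const 2).div_const 2)
    (fun x => Finset.sum_nonneg fun k _ => by positivity) hgi d hd (D := D) (b := c₀ + E)
    one_pos hδ ?_ ?_ hdown hleave
  · intro x hx
    refine (hgd x).trans ?_
    have h1 : (D : ℝ) < d x := by exact_mod_cast hx
    have h2 : |c₁| * ((|c₀ + E| + 1) / ε + 1) < |c₁| * (N x + 1) := by
      refine (hD.trans_lt h1).trans_le ((hdN x).trans ?_)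
      have := hN x
      gcongr
      exact le_abs_self c₁
    have h3 : (|c₀ + E| + 1) / ε < N x := by
      have := lt_of_mul_lt_mul_left h2 (abs_nonneg _)
      linarith
    rw [div_lt_iff₀ hε] at h3
    have := le_abs_self (c₀ + E)
    linarith
  · intro x
    refine (hgd x).trans ?_
    have := mul_nonneg hε.le (hN x)
    linarith

end Lyapunov

/-! ### The workload argument: stability forces load below one. -/

theorem JobList.measurable_arrive_left (x : JobList) : Measurable (arrive x) :=
  (measurable_arrive x.1).comp (measurable_prodMk_left (x := x.2))

theorem JobList.eq_empty_of_fst_eq_zero {x : JobList} (h : x.1 = 0) : x = empty := by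
  obtain ⟨N, v⟩ := x
  obtain rfl : N = 0 := h
  exact congrArg (Sigma.mk 0) (Subsingleton.elim _ _)

theorem JobList.measurable_fst : Measurable fun x : JobList => x.1 :=
  measurable_of_mk fun _ => measurable_const

theorem JobList.measurableSet_empty : MeasurableSet {empty} := by
  have : ({empty} : Set JobList) = (fun x : JobList => x.1) ⁻¹' {0} := by
    ext x
    exact ⟨fun h => by rw [h]; rfl, fun h => eq_empty_of_fst_eq_zero h⟩
  rw [this]
  exact JobList.measurable_fst (measurableSet_singleton 0)

theorem MarkovPolicy.rates_apply (π : MarkovPolicy) (lam : ℝ) (μ : Measure Requirement)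
    [SFinite μ] (x : JobList) : π.rates lam μ x = ENNReal.ofReal lam • μ.map (arrive x)
      + ∑ i ∈ π.serve x, Measure.dirac (remove x i) := rfl

theorem MarkovPolicy.lintegral_rates (π : MarkovPolicy) (lam : ℝ) (μ : Measure Requirement)
    [SFinite μ] (x : JobList) (F : JobList → ENNReal) (hF : Measurable F) :
    ∫⁻ y, F y ∂(π.rates lam μ x)
      = ENNReal.ofReal lam * ∫⁻ v, F (arrive x v) ∂μ + ∑ i ∈ π.serve x, F (remove x i) := by
  rw [rates_apply, lintegral_add_measure, lintegral_smul_measure, lintegral_finsetSum_measure,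
    lintegral_map hF (measurable_arrive_left x), smul_eq_mul]
  simp only [lintegral_dirac' _ hF]

theorem MarkovPolicy.rates_univ (π : MarkovPolicy) (lam : ℝ) (μ : Measure Requirement)
    [IsProbabilityMeasure μ] (x : JobList) :
    π.rates lam μ x Set.univ = ENNReal.ofReal lam + (π.serve x).card := by
  have := π.lintegral_rates lam μ x (fun _ => 1) measurable_const
  simpa using this

instance (π : MarkovPolicy) (lam : ℝ) (μ : Measure Requirement) [IsProbabilityMeasure μ]
    (x : JobList) : IsFiniteMeasure (π.rates lam μ x) :=
  ⟨by rw [π.rates_univ]; exact ENNReal.add_lt_top.2 ⟨ENNReal.ofReal_lt_top, ENNReal.natCast_lt_top _⟩⟩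

/-- The total requirement of the jobs present. -/
noncomputable def workload (x : JobList) : ENNReal := ∑ i, ENNReal.ofReal (x.2 i : ℝ)

theorem measurable_workload : Measurable workload :=
  measurable_of_mk fun N => by
    change Measurable fun v : Fin N → Requirement => ∑ i, ENNReal.ofReal (v i : ℝ)
    fun_prop

theorem workload_ne_top (x : JobList) : workload x ≠ ⊤ :=
  ENNReal.sum_ne_top.2 fun _ _ => ENNReal.ofReal_ne_top

theorem workload_empty : workload empty = 0 := Finset.sum_empty

theorem workload_arrive (x : JobList) (v : Requirement) :
    workload (arrive x v) = workload x + ENNReal.ofReal v := by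
  change ∑ i : Fin (x.1 + 1), ENNReal.ofReal ((Fin.snoc x.2 v : Fin (x.1 + 1) → Requirement) i : ℝ) = _
  rw [Fin.sum_univ_castSucc]
  simp [workload]

theorem workload_remove (x : JobList) (i : Fin x.1) :
    workload x = workload (remove x i) + ENNReal.ofReal (x.2 i) := by
  obtain ⟨N, v⟩ := x
  cases N with
  | zero => exact i.elim0
  | succ N =>
    change ∑ j, ENNReal.ofReal (v j : ℝ) = _
    rw [Fin.sum_univ_succAbove _ i, add_comm]
    rfl

/-- Subtraction in `ENNReal` is truncated, so departures contribute nothing: this is the rate of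
upward changes alone, the same in every state. -/
theorem MarkovPolicy.lintegral_rates_workload_sub (π : MarkovPolicy) (lam : ℝ)
    (μ : Measure Requirement) [IsProbabilityMeasure μ] (x : JobList) :
    ∫⁻ y, (workload y - workload x) ∂(π.rates lam μ x)
      = ENNReal.ofReal lam * ∫⁻ v, ENNReal.ofReal (v : ℝ) ∂μ := by
  rw [π.lintegral_rates lam μ x _ (measurable_workload.sub_const _)]
  have h1 : ∀ v, workload (arrive x v) - workload x = ENNReal.ofReal (v : ℝ) := fun v => by
    rw [workload_arrive, ENNReal.add_sub_cancel_left (workload_ne_top x)]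
  have h2 : ∀ i, workload (remove x i) - workload x = 0 := fun i => by
    rw [workload_remove x i]; exact tsub_eq_zero_of_le le_self_add
  simp [h1, h2]

/-- The jobs in service remove work at rate at most `1` by the capacity constraint, so with load at
least `1` the drift of the workload is nonnegative. It is stated without subtraction to stay in
`ENNReal`. -/
theorem MarkovPolicy.workload_mul_rates_le (π : MarkovPolicy) (lam : ℝ)
    (μ : Measure Requirement) [IsProbabilityMeasure μ]
    (h : 1 ≤ ENNReal.ofReal lam * ∫⁻ v, ENNReal.ofReal (v : ℝ) ∂μ) (x : JobList) :
    workload x * π.rates lam μ x Set.univ ≤ ∫⁻ y, workload y ∂(π.rates lam μ x) := by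
  rw [π.rates_univ, π.lintegral_rates lam μ x _ measurable_workload]
  simp only [workload_arrive]
  rw [lintegral_add_left measurable_const, lintegral_const, measure_univ, mul_one]
  have h1 : workload x * (π.serve x).card
      = ∑ i ∈ π.serve x, workload (remove x i) + ∑ i ∈ π.serve x, ENNReal.ofReal (x.2 i) := by
    rw [← Finset.sum_add_distrib]
    simp only [← workload_remove]
    rw [Finset.sum_const, nsmul_eq_mul, mul_comm]
  have h2 : ∑ i ∈ π.serve x, ENNReal.ofReal (x.2 i) ≤ 1 := by
    rw [← ENNReal.ofReal_sum_of_nonneg fun i _ => (x.2 i).2.1.le]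
    simpa using ENNReal.ofReal_le_ofReal (π.capacity x)
  calc workload x * (ENNReal.ofReal lam + (π.serve x).card)
      = ENNReal.ofReal lam * workload x + (∑ i ∈ π.serve x, workload (remove x i)
          + ∑ i ∈ π.serve x, ENNReal.ofReal (x.2 i)) := by rw [mul_add, h1, mul_comm]
    _ ≤ ENNReal.ofReal lam * workload x + (∑ i ∈ π.serve x, workload (remove x i)
          + ENNReal.ofReal lam * ∫⁻ v, ENNReal.ofReal (v : ℝ) ∂μ) := by
        gcongr; exact h2.trans h
    _ = _ := by ring

/-- A system that is stable under some Markovian policy has load less than `1`. -/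
theorem MarkovPolicy.Stable.load_lt_one {π : MarkovPolicy} {lam : ℝ} {μ : Measure Requirement}
    [IsProbabilityMeasure μ] (hstable : π.Stable lam μ) (hlam : 0 < lam) :
    ENNReal.ofReal lam * ∫⁻ v, ENNReal.ofReal (v : ℝ) ∂μ < 1 := by
  by_contra hcon
  rw [not_lt] at hcon
  set m : ENNReal := ENNReal.ofReal lam * ∫⁻ v, ENNReal.ofReal (v : ℝ) ∂μ with hm
  have hmtop : m ≠ ⊤ := by
    refine ENNReal.mul_ne_top ENNReal.ofReal_ne_top (ne_top_of_le_ne_top ENNReal.one_ne_top ?_)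
    calc ∫⁻ v, ENNReal.ofReal (v : ℝ) ∂μ ≤ ∫⁻ _, 1 ∂μ :=
          lintegral_mono fun v => by simpa using ENNReal.ofReal_le_ofReal v.2.2
      _ = 1 := by simp
  set Q := π.rates lam μ with hQ
  set P := pathLaw Q empty with hP
  have hx₀ := JobList.measurableSet_empty
  have hQ0 : ∀ x, Q x Set.univ ≠ 0 := fun x => by
    rw [hQ, π.rates_univ]
    exact (add_pos_of_pos_of_nonneg (ENNReal.ofReal_pos.2 hlam) zero_le).ne'
  have hjump : ∀ x, jumpKernel Q x = (Q x Set.univ)⁻¹ • Q x := fun x =>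
    jumpKernel_apply_of_finite Q x (hQ0 x)
  have hfin : ∫⁻ ω, returnTime Q empty ω ∂P < ⊤ := hstable
  have hsum : ∑' n, ∫⁻ ω, alive empty n ω * (Q (ω n).1 Set.univ)⁻¹ ∂P < ⊤ := by
    rw [hP, ← tsum_lintegral_alive_div Q hx₀]
    exact (lintegral_mono fun ω => tsum_alive_le_returnTime Q empty ω).trans_lt hfin
  have hret : ∀ᵐ ω ∂P, ∃ n, alive empty n ω = 0 := by
    have hQm : Measurable fun x => Q x Set.univ := Q.measurable_coe MeasurableSet.univ
    have hmeas : Measurable (returnTime Q empty) := by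
      unfold returnTime
      refine Measurable.iInf fun n => ?_
      have hs : MeasurableSet {ω : ℕ → JobList × ℝ | (ω n).1 = empty ∧ ∃ m < n, (ω m).1 ≠ empty} := by
        have hc : ∀ k, MeasurableSet {ω : ℕ → JobList × ℝ | (ω k).1 = empty} := fun k =>
          (_root_.measurable_fst.comp (measurable_pi_apply k)) hx₀
        have : {ω : ℕ → JobList × ℝ | (ω n).1 = empty ∧ ∃ m < n, (ω m).1 ≠ empty}
            = {ω | (ω n).1 = empty} ∩ ⋃ m ∈ Finset.range n, {ω | (ω m).1 = empty}ᶜ := by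
          ext ω; simp
        rw [this]
        exact (hc n).inter (Finset.measurableSet_biUnion _ fun m _ => (hc m).compl)
      have hval : Measurable fun ω : ℕ → JobList × ℝ =>
          ∑ i ∈ Finset.range n, ENNReal.ofReal (ω i).2 / Q (ω i).1 Set.univ := by
        refine Finset.measurable_fun_sum _ fun i _ => Measurable.div ?_ ?_
        · exact ENNReal.measurable_ofReal.comp (measurable_snd.comp (measurable_pi_apply _))
        · exact hQm.comp (_root_.measurable_fst.comp (measurable_pi_apply _))
      classical
      simp only [iInf_eq_if]
      exact Measurable.ite hs hval measurable_const
    filter_upwards [ae_lt_top hmeas hfin.ne] with ω hω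
    exact exists_alive_eq_zero_of_returnTime_lt_top Q empty ω hω
  have hWm : ∀ n, Measurable fun ω : ℕ → JobList × ℝ => workload (ω n).1 := fun n =>
    measurable_workload.comp (_root_.measurable_fst.comp (measurable_pi_apply _))
  -- Expected workload on the paths that have not returned. Dropping returned paths loses nothing at
  -- the moment of return, where the workload is `0`; hence `a` is nondecreasing, with `a 1 > 0`.
  -- The contradiction will be that `a` tends to `0`.
  set a : ℕ → ENNReal := fun n => ∫⁻ ω, alive empty n ω * workload (ω n).1 ∂P with ha
  have hnr : ∀ x y, noReturn empty x y * workload y = workload y := fun x y => by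
    unfold noReturn
    split_ifs with h
    · simp [h.1, workload_empty]
    · exact one_mul _
  have hasucc : ∀ n, a (n + 1)
      = ∫⁻ ω, alive empty n ω * ((Q (ω n).1 Set.univ)⁻¹ * ∫⁻ y, workload y ∂(Q (ω n).1)) ∂P := by
    intro n
    simp only [ha]
    rw [hP, lintegral_alive_succ_mul Q hx₀ n workload measurable_workload]
    simp only [hnr, hjump, lintegral_smul_measure, smul_eq_mul]
  have hamono : Monotone a := monotone_nat_of_le_succ fun n => by
    rw [hasucc]
    refine lintegral_mono fun ω => ?_
    dsimp only
    gcongr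
    rw [mul_comm, ← div_eq_mul_inv,
      ENNReal.le_div_iff_mul_le (Or.inl (hQ0 _)) (Or.inl (measure_ne_top _ _))]
    exact π.workload_mul_rates_le lam μ hcon _
  have ha1 : a 1 ≠ 0 := by
    rw [hasucc 0]
    simp only [alive_zero, one_mul]
    have hF : Measurable fun x => (Q x Set.univ)⁻¹ * ∫⁻ y, workload y ∂(Q x) :=
      (Q.measurable_coe MeasurableSet.univ).inv.mul measurable_workload.lintegral_kernel
    rw [hP, lintegral_pathLaw_zero Q empty (fun p => (Q p.1 Set.univ)⁻¹ * ∫⁻ y, workload y ∂(Q p.1))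
      (hF.comp _root_.measurable_fst)]
    simp only [lintegral_const, measure_univ, mul_one]
    refine mul_ne_zero (ENNReal.inv_ne_zero.2 (measure_ne_top _ _)) ?_
    have := π.lintegral_rates_workload_sub lam μ empty
    simp only [workload_empty, tsub_zero] at this
    rw [hQ, this]
    exact (zero_lt_one.trans_le hcon).ne'
  -- The upward changes of the workload before the return dominate all the integrands of `a`. Their
  -- expected sum is `m` times the expected time spent before the return, hence finite.
  set D : ℕ → (ℕ → JobList × ℝ) → ENNReal := fun n ω =>
    alive empty n ω * (workload (ω (n + 1)).1 - workload (ω n).1) with hD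
  have hDm : ∀ n, Measurable (D n) := fun n =>
    (measurable_alive hx₀ n).mul ((hWm (n + 1)).sub (hWm n))
  have hDint : ∀ n, ∫⁻ ω, D n ω ∂P = m * ∫⁻ ω, alive empty n ω * (Q (ω n).1 Set.univ)⁻¹ ∂P := by
    intro n
    simp only [hD]
    rw [hP, lintegral_alive_mul_step Q hx₀ n (fun p => workload p.2 - workload p.1)
      ((measurable_workload.comp measurable_snd).sub (measurable_workload.comp _root_.measurable_fst)),
      ← lintegral_const_mul' _ _ hmtop]
    refine lintegral_congr fun ω => ?_
    rw [hjump, lintegral_smul_measure, hQ, π.lintegral_rates_workload_sub lam μ, smul_eq_mul]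
    ring
  have hbound : ∀ n ω, alive empty n ω * workload (ω n).1
      ≤ workload (ω 0).1 + ∑ i ∈ Finset.range n, D i ω := by
    intro n ω
    induction n with
    | zero => simp [alive_zero]
    | succ n ih =>
      rw [Finset.sum_range_succ, ← add_assoc]
      calc alive empty (n + 1) ω * workload (ω (n + 1)).1
          ≤ alive empty n ω * (workload (ω n).1 + (workload (ω (n + 1)).1 - workload (ω n).1)) := by
            gcongr
            · exact alive_antitone empty ω n.le_succ
            · exact le_add_tsub
        _ = alive empty n ω * workload (ω n).1 + D n ω := by rw [mul_add]
        _ ≤ _ := by gcongr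
  have hlim : Filter.Tendsto a Filter.atTop (nhds (∫⁻ _, 0 ∂P)) := by
    refine tendsto_lintegral_of_dominated_convergence
      (fun ω => workload (ω 0).1 + ∑' i, D i ω)
      (fun n => (measurable_alive hx₀ n).mul (hWm n)) ?_ ?_ ?_
    · intro n
      refine ae_of_all _ fun ω => (hbound n ω).trans ?_
      dsimp only
      gcongr
      exact ENNReal.sum_le_tsum _
    · rw [lintegral_add_left (hWm 0), lintegral_tsum fun n => (hDm n).aemeasurable]
      refine ENNReal.add_ne_top.2 ⟨?_, ?_⟩
      · rw [hP, lintegral_pathLaw_zero Q empty (fun p => workload p.1)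
          (measurable_workload.comp _root_.measurable_fst)]
        simp [workload_empty]
      · simp only [hDint]
        rw [ENNReal.tsum_mul_left]
        exact ENNReal.mul_ne_top hmtop hsum.ne
    · filter_upwards [hret] with ω ⟨n, hn⟩
      refine tendsto_const_nhds.congr' ?_
      filter_upwards [Filter.eventually_ge_atTop n] with k hk
      have : alive empty k ω = 0 := le_zero_iff.1 (hn ▸ alive_antitone empty ω hk)
      rw [this, zero_mul]
  rw [lintegral_zero] at hlim
  have := hamono.ge_of_tendsto hlim 1
  exact ha1 (le_zero_iff.1 this)

/-! ### The two-bucket options -/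

open Classical in
/-- The option of the 2-bucket efficient set whose larger type is `k`. -/
noncomputable def twoBucketOption (L k : ℕ) : ℕ →₀ ℕ :=
  if ∃ j : ℕ, k = 2 ^ j then Finsupp.single k (2 ^ (L - Nat.clog 2 k))
  else Finsupp.single k (2 ^ (L - Nat.clog 2 k))
    + Finsupp.single (2 ^ Nat.clog 2 k - k) (2 ^ (L - Nat.clog 2 k))

theorem twoBucketOption_mem {L k : ℕ} (hk : k ∈ Finset.Icc 1 (2 ^ L)) :
    twoBucketOption L k ∈ twoBucketSet L := by
  unfold twoBucketOption
  split_ifs with h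
  · obtain ⟨j, rfl⟩ := h
    refine Or.inl ⟨j, ?_, ?_⟩
    · exact (Nat.pow_le_pow_iff_right one_lt_two).1 (Finset.mem_Icc.1 hk).2
    · rw [Nat.clog_pow 2 j one_lt_two]
  · exact Or.inr ⟨k, hk, h, rfl⟩

theorem one_le_twoBucketOption_self (L k : ℕ) : 1 ≤ twoBucketOption L k k := by
  unfold twoBucketOption
  split_ifs with h
  · rw [Finsupp.single_eq_same]; exact Nat.one_le_two_pow
  · rw [Finsupp.add_apply, Finsupp.single_eq_same]
    exact le_add_right Nat.one_le_two_pow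

theorem twoBucketOption_sum {L k : ℕ} (hk : k ∈ Finset.Icc 1 (2 ^ L)) :
    (twoBucketOption L k).sum (fun k m => k * m) = 2 ^ L := by
  obtain ⟨hk1, hk2⟩ := Finset.mem_Icc.1 hk
  have hl : Nat.clog 2 k ≤ L := Nat.clog_le_of_le_pow hk2
  unfold twoBucketOption
  split_ifs with h
  · obtain ⟨j, rfl⟩ := h
    rw [Nat.clog_pow 2 j one_lt_two] at hl ⊢
    rw [Finsupp.sum_single_index (by simp), ← pow_add, Nat.add_sub_cancel' hl]
  · rw [Finsupp.sum_add_index' (by simp) (by simp [mul_add]),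
      Finsupp.sum_single_index (by simp), Finsupp.sum_single_index (by simp), ← add_mul,
      Nat.add_sub_cancel' (Nat.le_pow_clog one_lt_two k), ← pow_add, Nat.add_sub_cancel' hl]

theorem twoBucketOption_apply_eq_zero {L i k : ℕ} (hi : i ∈ Finset.Icc 1 (2 ^ L))
    (hk : k ∉ Finset.Icc 1 (2 ^ L)) : twoBucketOption L i k = 0 := by
  by_contra h
  exact hk ((twoBucketSet_subset L (twoBucketOption_mem hi)).1 (Finsupp.mem_support_iff.2 h))

theorem sum_mul_twoBucketOption {L i : ℕ} (hi : i ∈ Finset.Icc 1 (2 ^ L)) :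
    ∑ k ∈ (Finset.Icc 1 (2 ^ L) : Finset ℕ), (k : ℝ) * twoBucketOption L i k = 2 ^ L := by
  have h := twoBucketOption_sum hi
  rw [Finsupp.sum_of_support_subset _ (twoBucketSet_subset L (twoBucketOption_mem hi)).1 _
    (by simp)] at h
  exact_mod_cast h

/-- Doubling the number of types halves the size of a type-`k` slot, so twice as many fit. -/
theorem twoBucketOption_succ {L k : ℕ} (hk : k ≤ 2 ^ L) (j : ℕ) :
    twoBucketOption (L + 1) k j = 2 * twoBucketOption L k j := by
  have hl : Nat.clog 2 k ≤ L := Nat.clog_le_of_le_pow hk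
  have h2 : 2 ^ (L + 1 - Nat.clog 2 k) = 2 * 2 ^ (L - Nat.clog 2 k) := by
    rw [Nat.succ_sub hl, pow_succ, mul_comm]
  have hs : ∀ a b : ℕ, Finsupp.single a (2 * b) j = 2 * Finsupp.single a b j := fun a b => by
    rw [Finsupp.single_apply, Finsupp.single_apply]; split_ifs <;> simp
  unfold twoBucketOption
  split_ifs with h
  · rw [h2, hs]
  · rw [h2, Finsupp.add_apply, Finsupp.add_apply, hs, hs, mul_add]

/-- A type in the upper half has `⌈log₂ i⌉ = L + 1`, so its option consists of one job of type `i`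
and one of the complementary type. The only power of two in this range is `2 ^ (L + 1)`, whose
complement is the nonexistent type `0`, excluded by `1 ≤ k`. -/
theorem twoBucketOption_top {L i : ℕ} (h1 : 2 ^ L < i) (h2 : i ≤ 2 ^ (L + 1)) {k : ℕ}
    (hk : 1 ≤ k) : twoBucketOption (L + 1) i k
      = (if i = k then 1 else 0) + if 2 ^ (L + 1) - i = k then 1 else 0 := by
  have hc : Nat.clog 2 i = L + 1 :=
    le_antisymm (Nat.clog_le_of_le_pow h2) ((Nat.lt_clog_iff_pow_lt one_lt_two).2 h1)
  unfold twoBucketOption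
  rw [hc]
  split_ifs with h h3 h4 h5 h6 h7 <;> simp_all
  · obtain ⟨j, rfl⟩ := h
    rw [Nat.clog_pow 2 j one_lt_two] at hc
    subst hc
    omega
  · obtain ⟨j, rfl⟩ := h
    rw [Nat.clog_pow 2 j one_lt_two] at hc
    subst hc
    omega

/-- A decreasing vector of loads is an exact combination of the two-bucket options. -/
theorem exists_twoBucket_decomposition (L : ℕ) (p : ℕ → ℝ)
    (hp : ∀ k ∈ Finset.Icc 1 (2 ^ L), 0 ≤ p k)
    (hanti : ∀ i j, 1 ≤ i → i ≤ j → j < 2 ^ L → p j ≤ p i) :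
    ∃ α : ℕ → ℝ, (∀ i ∈ Finset.Icc 1 (2 ^ L), 0 ≤ α i) ∧
      ∀ k ∈ Finset.Icc 1 (2 ^ L),
        ∑ i ∈ Finset.Icc 1 (2 ^ L), α i * twoBucketOption L i k = p k := by
  induction L generalizing p with
  | zero =>
    refine ⟨p, hp, fun k hk => ?_⟩
    have h1 : twoBucketOption 0 1 1 = 1 := by
      unfold twoBucketOption
      rw [if_pos ⟨0, rfl⟩]; simp
    obtain rfl : k = 1 := by simpa using hk
    simp [h1]
  | succ L ih =>
    set K := 2 ^ L with hK
    have hKpos : 1 ≤ K := Nat.one_le_two_pow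
    have hK2 : 2 ^ (L + 1) = 2 * K := by rw [pow_succ, mul_comm]
    simp only [hK2] at hp hanti ⊢
    -- Each type `i > K` is served by its own option with weight `p i`, which serves type `2 K - i`
    -- equally often. What is left for the types up to `K` is nonnegative, and it is decreasing
    -- below `K` because `p j` decreases while `p (2 K - j)` increases. At `K` nothing is
    -- subtracted, so monotonicity may fail at the top type; this is why `hanti` does not include
    -- it.
    obtain ⟨β, hβ, hsum⟩ := ih (fun j => if j < K then p j - p (2 * K - j) else p j) (by
        intro k hk
        obtain ⟨h1, h2⟩ := Finset.mem_Icc.1 hk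
        split_ifs with h
        · exact sub_nonneg.2 (hanti _ _ h1 (by omega) (by omega))
        · exact hp k (Finset.mem_Icc.2 ⟨h1, by omega⟩)) (by
        intro i j hi hij hj
        rw [if_pos hj, if_pos (by omega)]
        exact sub_le_sub (hanti _ _ hi hij (by omega))
          (hanti _ _ (by omega) (by omega) (by omega)))
    -- The weights are halved because the options of the smaller types are doubled at level `L + 1`.
    refine ⟨fun i => if i ≤ K then β i / 2 else p i, fun i hi => ?_, fun k hk => ?_⟩
    · obtain ⟨h1, h2⟩ := Finset.mem_Icc.1 hi
      dsimp only
      split_ifs with h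
      · exact div_nonneg (hβ i (Finset.mem_Icc.2 ⟨h1, h⟩)) two_pos.le
      · exact hp i hi
    · obtain ⟨hk1, hk2⟩ := Finset.mem_Icc.1 hk
      have hsplit : Finset.Icc 1 (2 * K) = Finset.Icc 1 K ∪ Finset.Ioc K (2 * K) := by
        ext; simp only [Finset.mem_union, Finset.mem_Icc, Finset.mem_Ioc]; omega
      have hdisj : Disjoint (Finset.Icc 1 K) (Finset.Ioc K (2 * K)) := by
        refine Finset.disjoint_left.2 fun i hi hi' => ?_
        simp only [Finset.mem_Icc, Finset.mem_Ioc] at hi hi'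
        omega
      rw [hsplit, Finset.sum_union hdisj]
      have hA : ∑ i ∈ Finset.Icc 1 K, (if i ≤ K then β i / 2 else p i)
            * (twoBucketOption (L + 1) i k : ℝ)
          = ∑ i ∈ Finset.Icc 1 K, β i * twoBucketOption L i k := by
        refine Finset.sum_congr rfl fun i hi => ?_
        have hi' := (Finset.mem_Icc.1 hi).2
        rw [if_pos hi', twoBucketOption_succ hi']
        push_cast
        ring
      have hB : ∑ i ∈ Finset.Ioc K (2 * K), (if i ≤ K then β i / 2 else p i)
            * (twoBucketOption (L + 1) i k : ℝ)
          = (if K < k then p k else 0) + if k < K then p (2 * K - k) else 0 := by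
        have : ∀ i ∈ Finset.Ioc K (2 * K), (if i ≤ K then β i / 2 else p i)
            * (twoBucketOption (L + 1) i k : ℝ)
            = (if i = k then p k else 0) + if i = 2 * K - k then p (2 * K - k) else 0 := by
          intro i hi
          obtain ⟨h1, h2⟩ := Finset.mem_Ioc.1 hi
          rw [if_neg (by omega), twoBucketOption_top h1 (by omega) hk1, hK2]
          have hiff : 2 * K - i = k ↔ i = 2 * K - k := by omega
          simp only [hiff]
          push_cast
          rw [mul_add, mul_ite, mul_ite, mul_one, mul_zero]
          congr 1
          · split_ifs with h
            · rw [h]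
            · rfl
          · split_ifs with h
            · rw [h]
            · rfl
        rw [Finset.sum_congr rfl this, Finset.sum_add_distrib, Finset.sum_ite_eq',
          Finset.sum_ite_eq']
        congr 1
        · refine if_congr ?_ rfl rfl
          simp only [Finset.mem_Ioc]; omega
        · refine if_congr ?_ rfl rfl
          simp only [Finset.mem_Ioc]; omega
      rw [hA, hB]
      by_cases hkK : k ≤ K
      · rw [hsum k (Finset.mem_Icc.2 ⟨hk1, hkK⟩), if_neg (not_lt.2 hkK)]
        split_ifs <;> ring
      · rw [Finset.sum_eq_zero fun i hi => by
            rw [twoBucketOption_apply_eq_zero hi (by simp only [Finset.mem_Icc]; omega)]; simp,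
          if_pos (by omega), if_neg (by omega)]
        ring

/-- Fractions of time under which the two-bucket options serve all types faster than they
arrive. -/
theorem exists_twoBucket_fractions (L : ℕ) (p : ℕ → ℝ)
    (hp : ∀ k ∈ Finset.Icc 1 (2 ^ L), 0 ≤ p k)
    (hanti : ∀ i j, 1 ≤ i → i ≤ j → j < 2 ^ L → p j ≤ p i)
    (hload : ∑ k ∈ Finset.Icc 1 (2 ^ L), k * p k < 2 ^ L) :
    ∃ α : ℕ → ℝ, (∀ i ∈ Finset.Icc 1 (2 ^ L), 0 < α i) ∧
      ∑ i ∈ Finset.Icc 1 (2 ^ L), α i ≤ 1 ∧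
      ∀ k ∈ Finset.Icc 1 (2 ^ L),
        p k < ∑ i ∈ Finset.Icc 1 (2 ^ L), α i * twoBucketOption L i k := by
  obtain ⟨β, hβ, hsum⟩ := exists_twoBucket_decomposition L p hp hanti
  set T := Finset.Icc 1 (2 ^ L) with hT
  have hKpos : (0 : ℝ) < 2 ^ L := by positivity
  -- Every option fills the capacity `2 ^ L`, so weighting by size converts the sum of the
  -- coefficients into the load.
  have hβsum : (∑ i ∈ T, β i) * 2 ^ L < 1 * 2 ^ L := by
    rw [one_mul]
    refine lt_of_eq_of_lt ?_ hload
    calc (∑ i ∈ T, β i) * 2 ^ L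
        = ∑ i ∈ T, ∑ k ∈ T, (k : ℝ) * (β i * twoBucketOption L i k) := by
          rw [Finset.sum_mul]
          refine Finset.sum_congr rfl fun i hi => ?_
          rw [← sum_mul_twoBucketOption hi, Finset.mul_sum]
          exact Finset.sum_congr rfl fun k _ => by ring
      _ = ∑ k ∈ T, k * p k := by
          rw [Finset.sum_comm]
          refine Finset.sum_congr rfl fun k hk => ?_
          rw [← Finset.mul_sum, hsum k hk]
  have hβ1 : ∑ i ∈ T, β i < 1 := lt_of_mul_lt_mul_right hβsum hKpos.le
  -- The unused fraction of time, shared equally by the `2 ^ L` options. Every type gains strictly,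
  -- since option `k` contains a slot of type `k`.
  set η : ℝ := (1 - ∑ i ∈ T, β i) / 2 ^ L with hη
  have hη0 : 0 < η := div_pos (sub_pos.2 hβ1) hKpos
  refine ⟨fun i => β i + η, fun i hi => add_pos_of_nonneg_of_pos (hβ i hi) hη0, ?_, fun k hk => ?_⟩
  · rw [Finset.sum_add_distrib, Finset.sum_const, hT, Nat.card_Icc, nsmul_eq_mul]
    simp only [Nat.add_sub_cancel, Nat.cast_pow, Nat.cast_ofNat]
    rw [hη, mul_div_cancel₀ _ hKpos.ne']
    linarith
  · simp only [add_mul]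
    rw [Finset.sum_add_distrib, hsum k hk]
    refine lt_add_of_pos_right _ (Finset.sum_pos' (fun i _ => by positivity) ⟨k, hk, ?_⟩)
    have : (1 : ℝ) ≤ twoBucketOption L k k := by exact_mod_cast one_le_twoBucketOption_self L k
    positivity

/-! ### The law of the job types -/

theorem jobType_mem_Icc {K : ℕ} (hK : 0 < K) (v : Requirement) :
    jobType K v ∈ Finset.Icc 1 K := by
  have hK' : (0 : ℝ) < K := by exact_mod_cast hK
  refine Finset.mem_Icc.2 ⟨Nat.one_le_ceil_iff.2 (mul_pos hK' v.2.1), Nat.ceil_le.2 ?_⟩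
  exact mul_le_of_le_one_right hK'.le v.2.2

theorem measurable_jobType (K : ℕ) : Measurable (jobType K) :=
  Nat.measurable_ceil.comp (measurable_subtype_coe.const_mul _)

/-- The probability that a job has type `k`. -/
noncomputable def typeProb (K : ℕ) (μ : Measure Requirement) (k : ℕ) : ℝ :=
  μ.real {v | jobType K v = k}

theorem measurableSet_jobType_eq (K k : ℕ) : MeasurableSet {v | jobType K v = k} :=
  measurable_jobType K (measurableSet_singleton k)

theorem integral_jobType {K : ℕ} (hK : 0 < K) (μ : Measure Requirement) [IsFiniteMeasure μ]
    (F : ℕ → ℝ) :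
    ∫ v, F (jobType K v) ∂μ = ∑ k ∈ Finset.Icc 1 K, typeProb K μ k * F k := by
  have h : ∀ v, F (jobType K v)
      = ∑ k ∈ Finset.Icc 1 K, {v | jobType K v = k}.indicator (fun _ => F k) v := by
    intro v
    rw [Finset.sum_eq_single_of_mem (jobType K v) (jobType_mem_Icc hK v)]
    · rw [Set.indicator_of_mem]; rfl
    · intro k _ hk
      exact Set.indicator_of_notMem (fun h => hk h.symm) _
  simp only [h]
  rw [integral_finsetSum]
  · refine Finset.sum_congr rfl fun k _ => ?_
    rw [integral_indicator_const _ (measurableSet_jobType_eq K k)]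
    rfl
  · exact fun k _ => (integrable_const _).indicator (measurableSet_jobType_eq K k)

theorem setOf_jobType_eq {K k : ℕ} (hK : 0 < K) (hk : k ∈ Finset.Icc 1 K) :
    Set.image Subtype.val {v : Requirement | jobType K v = k}
      = Set.Ioc (((k - 1 : ℕ) : ℝ) / K) (k / K) := by
  have hK' : (0 : ℝ) < K := by exact_mod_cast hK
  obtain ⟨hk1, hk2⟩ := Finset.mem_Icc.1 hk
  have hiff : ∀ v : ℝ, ⌈(K : ℝ) * v⌉₊ = k ↔ ((k - 1 : ℕ) : ℝ) / K < v ∧ v ≤ k / K := fun v => by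
    rw [Nat.ceil_eq_iff (by omega), div_lt_iff₀ hK', le_div_iff₀ hK', mul_comm v]
  ext v
  simp only [Set.mem_image, Set.mem_ofPred_eq, jobType, Set.mem_Ioc, ← hiff]
  constructor
  · rintro ⟨w, hw, rfl⟩; exact hw
  · intro hv
    have h := (hiff v).1 hv
    refine ⟨⟨v, lt_of_le_of_lt (by positivity) h.1, h.2.trans ?_⟩, hv, rfl⟩
    rw [div_le_one hK']
    exact_mod_cast hk2

theorem volume_jobType_eq {K k : ℕ} (hK : 0 < K) (hk : k ∈ Finset.Icc 1 K) :
    (volume : Measure ℝ).comap (Subtype.val : Requirement → ℝ) {v | jobType K v = k}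
      = ENNReal.ofReal (1 / K) := by
  rw [(MeasurableEmbedding.subtype_coe measurableSet_Ioc).comap_apply, setOf_jobType_eq hK hk,
    Real.volume_Ioc]
  congr 1
  rw [← sub_div, Nat.cast_sub (Finset.mem_Icc.1 hk).1]
  simp

/-- Types `i < j` are intervals of equal length on either side of the point `i / K`, whose density
value bounds the density from above on type `j` and from below on type `i`. -/
theorem typeProb_antitone {f : Requirement → ℝ} (hf : Antitone f) {μ : Measure Requirement}
    [IsFiniteMeasure μ]
    (hμ : μ = ((volume : Measure ℝ).comap (↑)).withDensity fun v => ENNReal.ofReal (f v))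
    {K i j : ℕ} (hi : 1 ≤ i) (hij : i ≤ j) (hj : j ≤ K) : typeProb K μ j ≤ typeProb K μ i := by
  rcases hij.eq_or_lt with rfl | hij
  · exact le_rfl
  have hK : 0 < K := by omega
  have hK' : (0 : ℝ) < K := by exact_mod_cast hK
  have hi' : (0 : ℝ) < i := by exact_mod_cast hi
  let t : Requirement := ⟨i / K, by positivity, by
    rw [div_le_one hK']; exact_mod_cast (by omega : i ≤ K)⟩
  refine ENNReal.toReal_mono (measure_ne_top _ _) ?_
  have hval : ∀ k, μ {v | jobType K v = k}
      = ∫⁻ v in {v | jobType K v = k}, ENNReal.ofReal (f v) ∂((volume : Measure ℝ).comap (↑)) :=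
    fun k => by rw [hμ, withDensity_apply _ (measurableSet_jobType_eq K k)]
  calc μ {v | jobType K v = j}
      ≤ ∫⁻ _ in {v | jobType K v = j}, ENNReal.ofReal (f t) ∂((volume : Measure ℝ).comap (↑)) := by
        rw [hval]
        refine setLIntegral_mono measurable_const fun v hv => ENNReal.ofReal_le_ofReal (hf ?_)
        refine Subtype.coe_le_coe.1 (show (i : ℝ) / K ≤ v from ?_)
        have hv' : i < ⌈(K : ℝ) * v⌉₊ := lt_of_lt_of_eq hij (Eq.symm hv)
        rw [div_le_iff₀ hK', mul_comm]
        exact (Nat.lt_ceil.1 hv').le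
    _ = ∫⁻ _ in {v | jobType K v = i}, ENNReal.ofReal (f t) ∂((volume : Measure ℝ).comap (↑)) := by
        rw [setLIntegral_const, setLIntegral_const,
          volume_jobType_eq hK (Finset.mem_Icc.2 ⟨by omega, by omega⟩),
          volume_jobType_eq hK (Finset.mem_Icc.2 ⟨by omega, by omega⟩)]
    _ ≤ μ {v | jobType K v = i} := by
        rw [hval]
        refine setLIntegral_mono' (measurableSet_jobType_eq K i) fun v hv =>
          ENNReal.ofReal_le_ofReal (hf ?_)
        refine Subtype.coe_le_coe.1 (show (v : ℝ) ≤ i / K from ?_)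
        have hv' : ⌈(K : ℝ) * v⌉₊ ≤ i := le_of_eq hv
        rw [le_div_iff₀ hK', mul_comm]
        exact Nat.ceil_le.1 hv'

theorem integrable_requirement (μ : Measure Requirement) [IsFiniteMeasure μ] :
    Integrable (fun v : Requirement => (v : ℝ)) μ :=
  Integrable.of_bound measurable_subtype_coe.aestronglyMeasurable 1
    (ae_of_all _ fun v => by rw [Real.norm_eq_abs, abs_of_pos v.2.1]; exact v.2.2)

/-- The price of the discretization: rounding `K v` up adds at most `1`. As the decomposition into
options is exact, nothing else is lost. -/
theorem sum_mul_typeProb_le {K : ℕ} (hK : 0 < K) (μ : Measure Requirement)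
    [IsProbabilityMeasure μ] :
    ∑ k ∈ Finset.Icc 1 K, k * typeProb K μ k ≤ K * ∫ v, (v : ℝ) ∂μ + 1 := by
  have h := integral_jobType hK μ fun k => (k : ℝ)
  simp only [mul_comm (_ : ℝ) (typeProb K μ _), ← h]
  have hi : Integrable (fun v : Requirement => (K : ℝ) * v + 1) μ :=
    ((integrable_requirement μ).const_mul _).add (integrable_const _)
  calc ∫ v, (jobType K v : ℝ) ∂μ ≤ ∫ v, ((K : ℝ) * (v : ℝ) + 1) ∂μ := by
        refine integral_mono_of_nonneg (ae_of_all _ fun v => Nat.cast_nonneg _) hi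
          (ae_of_all _ fun v => ?_)
        exact (Nat.ceil_lt_add_one (mul_nonneg (Nat.cast_nonneg _) v.2.1.le)).le
    _ = K * ∫ v, (v : ℝ) ∂μ + 1 := by
        rw [integral_add ((integrable_requirement μ).const_mul _) (integrable_const _),
          integral_const_mul]
        simp

/-! ### Counting jobs by type -/

theorem measurable_of_typeCount {β : Type*} [MeasurableSpace β] (K : ℕ) (F : (ℕ → ℕ) → β) :
    Measurable fun x : JobList => F (typeCount K x) :=
  measurable_of_mk fun N => measurable_of_jobTypes K N fun t =>
    F fun k => (Finset.univ.filter fun i => t i = k).card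

theorem typeCount_eq_sum (K : ℕ) (x : JobList) (k : ℕ) :
    typeCount K x k = ∑ i, if jobType K (x.2 i) = k then 1 else 0 :=
  Finset.card_filter _ _

theorem typeCount_arrive (K : ℕ) (x : JobList) (v : Requirement) (k : ℕ) :
    typeCount K (arrive x v) k = typeCount K x k + if jobType K v = k then 1 else 0 := by
  rw [typeCount_eq_sum, typeCount_eq_sum]
  change ∑ i : Fin (x.1 + 1), (if jobType K ((Fin.snoc x.2 v : Fin (x.1 + 1) → Requirement) i) = k
    then 1 else 0) = _
  rw [Fin.sum_univ_castSucc]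
  simp

theorem typeCount_remove (K : ℕ) (x : JobList) (i : Fin x.1) (k : ℕ) :
    typeCount K x k = typeCount K (remove x i) k + if jobType K (x.2 i) = k then 1 else 0 := by
  rw [typeCount_eq_sum, typeCount_eq_sum]
  obtain ⟨N, v⟩ := x
  cases N with
  | zero => exact i.elim0
  | succ N =>
    change ∑ j, (if jobType K (v j) = k then 1 else 0) = _
    rw [Fin.sum_univ_succAbove _ i, add_comm]
    rfl

theorem sum_typeCount {K : ℕ} (hK : 0 < K) (x : JobList) :
    ∑ k ∈ Finset.Icc 1 K, typeCount K x k = x.1 := by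
  have := Finset.card_eq_sum_card_fiberwise (s := (Finset.univ : Finset (Fin x.1)))
    (f := fun i => jobType K (x.2 i)) (t := Finset.Icc 1 K) fun i _ => jobType_mem_Icc hK _
  rw [Finset.card_univ, Fintype.card_fin] at this
  exact this.symm

theorem JobList.fst_remove (x : JobList) (i : Fin x.1) : (remove x i).1 + 1 = x.1 := by
  obtain ⟨N, v⟩ := x
  cases N with
  | zero => exact i.elim0
  | succ N => rfl

theorem exists_typeCount_pos {K : ℕ} (hK : 0 < K) {x : JobList} (hx : 0 < x.1) :
    ∃ k ∈ Finset.Icc 1 K, 0 < typeCount K x k := by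
  by_contra hcon
  push Not at hcon
  have := sum_typeCount hK x
  rw [Finset.sum_eq_zero fun k hk => Nat.le_zero.1 (hcon k hk)] at this
  omega

theorem serviceOptions_apply_le {K : ℕ} {M : ℕ →₀ ℕ} (hM : M ∈ serviceOptions K) (k : ℕ) :
    M k ≤ K := by
  by_cases hk : k ∈ M.support
  · have h2 : k * M k ≤ M.sum fun k m => k * m :=
      Finset.single_le_sum (f := fun k => k * M k) (fun _ _ => Nat.zero_le _) hk
    have h1 := (Finset.mem_Icc.1 (hM.1 hk)).1
    have := h2.trans hM.2
    nlinarith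
  · rw [Finsupp.notMem_support_iff.1 hk]; exact Nat.zero_le _

theorem exists_pos_forall_le {ι : Type*} (T : Finset ι) (f : ι → ℝ) (hf : ∀ k ∈ T, 0 < f k) :
    ∃ ε > 0, ∀ k ∈ T, ε ≤ f k := by
  rcases T.eq_empty_or_nonempty with rfl | hT
  · exact ⟨1, one_pos, by simp⟩
  · obtain ⟨k, hk, hmin⟩ := T.exists_min_image f hT
    exact ⟨f k, hf k hk, hmin⟩

/-- Serving `min m q` jobs instead of `m` costs at most `m ^ 2` in weight. -/
theorem mul_sub_min_le {m q B : ℕ} (hm : m ≤ B) :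
    (q : ℝ) * m - q * (min m q : ℕ) ≤ B ^ 2 := by
  have hm' : (m : ℝ) ≤ B := by exact_mod_cast hm
  have hm0 : (0 : ℝ) ≤ m := Nat.cast_nonneg _
  have hq0 : (0 : ℝ) ≤ q := Nat.cast_nonneg _
  rcases le_total m q with h | h
  · rw [min_eq_left h]; simp only [sub_self]; positivity
  · rw [min_eq_right h]
    have h' : (q : ℝ) ≤ m := by exact_mod_cast h
    nlinarith

/-! ### MaxWeight -/

theorem MarkovPolicy.integral_rates (π : MarkovPolicy) {lam : ℝ} (hlam : 0 ≤ lam)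
    (μ : Measure Requirement) [SFinite μ] (x : JobList) (F : JobList → ℝ) (hF : Measurable F)
    (hFi : Integrable (fun v => F (arrive x v)) μ) :
    ∫ y, F y ∂(π.rates lam μ x)
      = lam * ∫ v, F (arrive x v) ∂μ + ∑ i ∈ π.serve x, F (remove x i) := by
  have hdi : ∀ y, Integrable F (Measure.dirac y) := fun y =>
    integrable_dirac' hF.stronglyMeasurable (by simp)
  have hmi : Integrable F (μ.map (arrive x)) :=
    (integrable_map_measure hF.aestronglyMeasurable (measurable_arrive_left x).aemeasurable).2 hFi
  rw [rates_apply, integral_add_measure (hmi.smul_measure ENNReal.ofReal_ne_top)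
    (integrable_finsetSum_measure.2 fun i _ => hdi _), integral_smul_measure,
    integral_finsetSum_measure fun i _ => hdi _, integral_map (measurable_arrive_left x).aemeasurable
    hF.aestronglyMeasurable, ENNReal.toReal_ofReal hlam, smul_eq_mul]
  simp only [integral_dirac' _ _ hF.stronglyMeasurable]

theorem MarkovPolicy.ae_rates (π : MarkovPolicy) (lam : ℝ) (μ : Measure Requirement) [SFinite μ]
    (x : JobList) (p : JobList → Prop) (hp : MeasurableSet {y | p y})
    (h1 : ∀ v, p (arrive x v)) (h2 : ∀ i, p (remove x i)) : ∀ᵐ y ∂(π.rates lam μ x), p y := by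
  change π.rates lam μ x {y | p y}ᶜ = 0
  rw [← lintegral_indicator_one hp.compl,
    π.lintegral_rates lam μ x _ (measurable_one.indicator hp.compl)]
  simp [Set.indicator, h1, h2]

theorem MarkovPolicy.integral_rates_typeCount_sub (π : MarkovPolicy) {lam : ℝ} (hlam : 0 ≤ lam)
    (μ : Measure Requirement) [IsProbabilityMeasure μ] {K : ℕ} (hK : 0 < K) (x : JobList) {k : ℕ}
    (hk : k ∈ Finset.Icc 1 K) :
    ∫ y, ((typeCount K y k : ℝ) - typeCount K x k) ∂(π.rates lam μ x)
      = lam * typeProb K μ k - ((π.serve x).filter fun i => jobType K (x.2 i) = k).card := by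
  have harr : ∀ v, (typeCount K (arrive x v) k : ℝ) - typeCount K x k
      = if jobType K v = k then 1 else 0 := fun v => by
    rw [typeCount_arrive]; push_cast; ring
  have hrem : ∀ i, (typeCount K (remove x i) k : ℝ) - typeCount K x k
      = -if jobType K (x.2 i) = k then 1 else 0 := fun i => by
    rw [typeCount_remove K x i k]; push_cast; ring
  have hm : Measurable fun y => (typeCount K y k : ℝ) - typeCount K x k :=
    measurable_of_typeCount K fun q => (q k : ℝ) - typeCount K x k
  rw [π.integral_rates hlam μ x _ hm]
  · simp only [harr, hrem]
    rw [integral_jobType hK μ fun j => if j = k then (1 : ℝ) else 0]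
    simp only [mul_ite, mul_one, mul_zero, Finset.sum_ite_eq', hk, if_true, Finset.sum_neg_distrib,
      Finset.card_filter, Nat.cast_sum, Nat.cast_ite, Nat.cast_one, Nat.cast_zero]
    ring
  · simp only [harr]
    refine Integrable.of_bound (C := 1) ?_ (ae_of_all _ fun v => ?_)
    · exact (Measurable.ite (measurableSet_jobType_eq K k) measurable_const
        measurable_const).aestronglyMeasurable
    · split_ifs <;> simp

/-- The option belonging to a type that is present has positive weight, hence so does the maximizer,
which therefore serves some job. -/
theorem MarkovPolicy.IsMaxWeight.exists_serve {π : MarkovPolicy} {L : ℕ}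
    (hπ : π.IsMaxWeight (2 ^ L) (twoBucketSet L)) {x : JobList} (hx : 0 < x.1) :
    (π.serve x).Nonempty := by
  obtain ⟨M, -, hmax, hserve⟩ := hπ x
  obtain ⟨k, hk, hkpos⟩ := exists_typeCount_pos (K := 2 ^ L) (by positivity) hx
  have h1 := one_le_twoBucketOption_self L k
  have h2 : 0 < weight (2 ^ L) x (twoBucketOption L k) := by
    refine lt_of_lt_of_le (Nat.mul_pos h1 hkpos) ?_
    exact Finset.single_le_sum (f := fun j => twoBucketOption L k j * typeCount (2 ^ L) x j)
      (fun _ _ => Nat.zero_le _) (Finsupp.mem_support_iff.2 (by omega))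
  have h3 : 0 < weight (2 ^ L) x M := h2.trans_le (hmax _ (twoBucketOption_mem hk))
  obtain ⟨j, -, hj⟩ := Finset.exists_ne_zero_of_sum_ne_zero h3.ne'
  have hj' := Nat.pos_of_ne_zero hj
  have h4 : 0 < ((π.serve x).filter fun i => jobType (2 ^ L) (x.2 i) = j).card := by
    rw [hserve j]
    exact lt_min (Nat.pos_of_mul_pos_right hj') (Nat.pos_of_mul_pos_left hj')
  exact (Finset.card_pos.1 h4).mono (Finset.filter_subset _ _)

theorem MarkovPolicy.IsMaxWeight.card_serve_le {π : MarkovPolicy} {L : ℕ}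
    (hπ : π.IsMaxWeight (2 ^ L) (twoBucketSet L)) (x : JobList) :
    (π.serve x).card ≤ 2 ^ L * 2 ^ L := by
  obtain ⟨M, hM, -, hserve⟩ := hπ x
  rw [Finset.card_eq_sum_card_fiberwise (f := fun i => jobType (2 ^ L) (x.2 i))
    (t := Finset.Icc 1 (2 ^ L)) fun i _ => jobType_mem_Icc (by positivity) _]
  refine (Finset.sum_le_sum (g := fun _ => 2 ^ L) fun k _ => ?_).trans (by simp)
  rw [hserve k]
  exact (min_le_left _ _).trans (serviceOptions_apply_le (twoBucketSet_subset L hM) k)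

/-- The drift of half the sum of squared queue lengths is `∑ q k (λ p k - served k)` up to a
constant. A maximal weight is at least the `α`-average of the weights of all options, which exceeds
`∑ q k λ p k` by `ε ∑ q k`; offering slots that stay empty costs only a constant. Since some job is
always served, the number of jobs plays the role of `d`. -/
theorem MarkovPolicy.IsMaxWeight.stable {π : MarkovPolicy} {L : ℕ}
    (hπ : π.IsMaxWeight (2 ^ L) (twoBucketSet L)) {lam : ℝ} (hlam : 0 < lam)
    (μ : Measure Requirement) [IsProbabilityMeasure μ] (α : ℕ → ℝ)
    (hα : ∀ i ∈ Finset.Icc 1 (2 ^ L), 0 < α i) (hα1 : ∑ i ∈ Finset.Icc 1 (2 ^ L), α i ≤ 1)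
    (hload : ∀ k ∈ Finset.Icc 1 (2 ^ L), lam * typeProb (2 ^ L) μ k
      < ∑ i ∈ Finset.Icc 1 (2 ^ L), α i * twoBucketOption L i k) : π.Stable lam μ := by
  set K := 2 ^ L with hK
  have hKpos : 0 < K := by positivity
  set T := Finset.Icc 1 K with hT
  obtain ⟨ε, hε, hεle⟩ := exists_pos_forall_le T _ fun k hk => sub_pos.2 (hload k hk)
  have hreal : ∀ x, (π.rates lam μ x).real Set.univ = lam + (π.serve x).card := fun x => by
    rw [Measure.real, π.rates_univ, ENNReal.toReal_add ENNReal.ofReal_ne_top (by simp),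
      ENNReal.toReal_ofReal hlam.le, ENNReal.toReal_natCast]
  refine positiveRecurrent_of_quadratic_drift (π.rates lam μ) JobList.measurableSet_empty
    (c := lam) (C := lam + ((K * K : ℕ) : ℝ)) hlam ?_ ?_ T (fun k x => (typeCount K x k : ℝ)) ?_
    (B := 1) ?_ (fun x => (x.1 : ℝ)) (fun x => Nat.cast_nonneg _) (fun x => x.1)
    JobList.measurable_fst (c₀ := ∑ k ∈ T, (K : ℝ) ^ 2) (c₁ := 1) (ε := ε) (δ := 1) ?_ hε one_pos
    ?_ ?_ ?_
  · intro x
    rw [hreal]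
    exact le_add_of_nonneg_right (Nat.cast_nonneg _)
  · intro x
    rw [hreal]
    have : ((π.serve x).card : ℝ) ≤ ((K * K : ℕ) : ℝ) := Nat.cast_le.2 (hπ.card_serve_le x)
    linarith
  · exact fun k _ => measurable_of_typeCount K fun q => (q k : ℝ)
  · intro k _ x
    refine π.ae_rates lam μ x _ ?_ (fun v => ?_) (fun i => ?_)
    · have : Measurable fun y => |(typeCount K y k : ℝ) - typeCount K x k| :=
        measurable_of_typeCount K fun q => |(q k : ℝ) - typeCount K x k|
      exact this measurableSet_Iic
    · rw [typeCount_arrive]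
      push_cast
      split_ifs <;> simp
    · rw [typeCount_remove K x i k]
      push_cast
      split_ifs <;> simp
  · intro x
    linarith
  · intro x
    obtain ⟨M, hM, hmax, hserve⟩ := hπ x
    have hMw : ∀ M' ∈ twoBucketSet L, (weight K x M' : ℝ) = ∑ k ∈ T, (M' k : ℝ) * typeCount K x k := by
      intro M' hM'
      rw [weight, Finsupp.sum_of_support_subset _ (twoBucketSet_subset L hM').1 _ (by simp)]
      push_cast
      rfl
    have hw : ∑ k ∈ T, (∑ i ∈ T, α i * twoBucketOption L i k) * typeCount K x k
        ≤ ∑ k ∈ T, (M k : ℝ) * typeCount K x k := by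
      calc ∑ k ∈ T, (∑ i ∈ T, α i * twoBucketOption L i k) * typeCount K x k
          = ∑ i ∈ T, α i * weight K x (twoBucketOption L i) := by
            simp only [Finset.sum_mul]
            rw [Finset.sum_comm]
            refine Finset.sum_congr rfl fun i hi => ?_
            rw [hMw _ (twoBucketOption_mem hi), Finset.mul_sum]
            exact Finset.sum_congr rfl fun k _ => by ring
        _ ≤ ∑ i ∈ T, α i * weight K x M := by
            refine Finset.sum_le_sum fun i hi => mul_le_mul_of_nonneg_left ?_ (hα i hi).le
            exact_mod_cast hmax _ (twoBucketOption_mem hi)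
        _ ≤ 1 * weight K x M := by
            rw [← Finset.sum_mul]
            gcongr
        _ = _ := by rw [one_mul, hMw M hM]
    have hterm : ∀ k ∈ T, (typeCount K x k : ℝ)
          * ∫ y, ((typeCount K y k : ℝ) - typeCount K x k) ∂(π.rates lam μ x)
        ≤ (∑ i ∈ T, α i * twoBucketOption L i k) * typeCount K x k - (M k : ℝ) * typeCount K x k
          + K ^ 2 - ε * typeCount K x k := by
      intro k hk
      rw [π.integral_rates_typeCount_sub hlam.le μ hKpos x hk, hserve k]
      have h1 := mul_sub_min_le (q := typeCount K x k)
        (serviceOptions_apply_le (twoBucketSet_subset L hM) k)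
      rw [← hK] at h1
      have h2 := mul_le_mul_of_nonneg_left (hεle k hk) (Nat.cast_nonneg (typeCount K x k))
      linarith
    refine (Finset.sum_le_sum hterm).trans ?_
    rw [Finset.sum_sub_distrib, Finset.sum_add_distrib, Finset.sum_sub_distrib, ← Finset.mul_sum]
    have hN : ∑ k ∈ T, (typeCount K x k : ℝ) = x.1 := by
      rw [← sum_typeCount hKpos x]; push_cast; rfl
    rw [hN]
    linarith
  · intro x hx
    have hxpos : 0 < x.1 := Nat.pos_of_ne_zero fun h => hx (eq_empty_of_fst_eq_zero h)
    obtain ⟨i, hi⟩ := hπ.exists_serve hxpos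
    have hset : MeasurableSet {y : JobList | y.1 < x.1} := JobList.measurable_fst measurableSet_Iio
    have h1 : (1 : ENNReal) ≤ π.rates lam μ x {y | y.1 < x.1} := by
      rw [← lintegral_indicator_one hset,
        π.lintegral_rates lam μ x _ (measurable_one.indicator hset)]
      refine le_add_left (le_trans ?_ (Finset.single_le_sum (fun _ _ => zero_le) hi))
      rw [Set.indicator_of_mem]
      · rfl
      · have := JobList.fst_remove x i
        exact Nat.lt_of_succ_le this.le
    have := ENNReal.toReal_mono (measure_ne_top _ _) h1
    rwa [ENNReal.toReal_one] at this
  · have hset := JobList.measurableSet_empty.compl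
    rw [← lintegral_indicator_one hset,
      π.lintegral_rates lam μ _ _ (measurable_one.indicator hset)]
    have : ∀ v, ({empty}ᶜ : Set JobList).indicator (1 : JobList → ENNReal) (arrive empty v) = 1 := by
      intro v
      refine Set.indicator_of_mem (fun h => ?_) _
      exact absurd (congrArg Sigma.fst h) (Nat.succ_ne_zero _)
    simp only [this, lintegral_one, measure_univ, mul_one]
    exact (add_pos_of_pos_of_nonneg (ENNReal.ofReal_pos.2 hlam) zero_le).ne'

/-! ### Stability under nMSR policies -/

theorem sum_inService (K : ℕ) (u : ℕ →₀ ℕ) (x : JobList) {β : Type*} [AddCommMonoid β] (H : ℕ → β) :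
    ∑ i ∈ inService K u x, H (jobType K (x.2 i))
      = ∑ k ∈ u.support, min (u k) (typeCount K x k) • H k := by
  have hmaps : ∀ i ∈ inService K u x, jobType K (x.2 i) ∈ u.support := by
    intro i hi
    have := (Finset.mem_filter.1 hi).2
    exact Finsupp.mem_support_iff.2 (by omega)
  rw [← Finset.sum_fiberwise_of_maps_to hmaps]
  refine Finset.sum_congr rfl fun k _ => ?_
  rw [Finset.sum_congr rfl fun i hi => by rw [(Finset.mem_filter.1 hi).2], Finset.sum_const,
    card_inService]

namespace NMSRPolicy

variable {K : ℕ} (P : NMSRPolicy K)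

theorem rates_apply (lam : ℝ) (μ : Measure Requirement) [SFinite μ] (p : Fin P.n × JobList) :
    P.rates lam μ p = ENNReal.ofReal lam • μ.map (fun v => (p.1, arrive p.2 v))
    + ∑ s', P.switchRate p.1 s' • Measure.dirac (s', p.2)
    + ∑ i ∈ inService K (P.slots p.1) p.2,
        Measure.dirac (P.afterCompletion p.1 (jobType K (p.2.2 i)), remove p.2 i)
    + ∑ k ∈ (P.slots p.1).support,
        (P.slots p.1 k - typeCount K p.2 k) • Measure.dirac (P.afterCompletion p.1 k, p.2) := rfl

theorem measurable_arrive_pair (s : Fin P.n) (x : JobList) :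
    Measurable fun v => (s, arrive x v) :=
  measurable_const.prodMk (measurable_arrive_left x)

theorem lintegral_rates (lam : ℝ) (μ : Measure Requirement) [SFinite μ] (p : Fin P.n × JobList)
    (F : Fin P.n × JobList → ENNReal) (hF : Measurable F) :
    ∫⁻ y, F y ∂(P.rates lam μ p)
      = ENNReal.ofReal lam * ∫⁻ v, F (p.1, arrive p.2 v) ∂μ
        + ∑ s', P.switchRate p.1 s' * F (s', p.2)
        + ∑ i ∈ inService K (P.slots p.1) p.2,
            F (P.afterCompletion p.1 (jobType K (p.2.2 i)), remove p.2 i)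
        + ∑ k ∈ (P.slots p.1).support,
            ((P.slots p.1 k - typeCount K p.2 k : ℕ) : ENNReal) * F (P.afterCompletion p.1 k, p.2) := by
  rw [rates_apply, lintegral_add_measure, lintegral_add_measure, lintegral_add_measure,
    lintegral_smul_measure, lintegral_finsetSum_measure, lintegral_finsetSum_measure,
    lintegral_finsetSum_measure, lintegral_map hF (P.measurable_arrive_pair _ _), smul_eq_mul]
  simp only [lintegral_smul_measure, lintegral_dirac' _ hF, nsmul_eq_mul]
  rfl

theorem integral_rates {lam : ℝ} (hlam : 0 ≤ lam) (μ : Measure Requirement) [SFinite μ]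
    (p : Fin P.n × JobList) (F : Fin P.n × JobList → ℝ) (hF : Measurable F)
    (hFi : Integrable (fun v => F (p.1, arrive p.2 v)) μ) :
    ∫ y, F y ∂(P.rates lam μ p)
      = lam * ∫ v, F (p.1, arrive p.2 v) ∂μ
        + ∑ s', (P.switchRate p.1 s' : ℝ) * F (s', p.2)
        + ∑ i ∈ inService K (P.slots p.1) p.2,
            F (P.afterCompletion p.1 (jobType K (p.2.2 i)), remove p.2 i)
        + ∑ k ∈ (P.slots p.1).support,
            ((P.slots p.1 k - typeCount K p.2 k : ℕ) : ℝ) * F (P.afterCompletion p.1 k, p.2) := by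
  have hdi : ∀ y, Integrable F (Measure.dirac y) := fun y =>
    integrable_dirac' hF.stronglyMeasurable (by simp)
  have hm := P.measurable_arrive_pair p.1 p.2
  have hmi : Integrable F (μ.map fun v => (p.1, arrive p.2 v)) :=
    (integrable_map_measure hF.aestronglyMeasurable hm.aemeasurable).2 hFi
  have i1 := hmi.smul_measure (c := ENNReal.ofReal lam) ENNReal.ofReal_ne_top
  have j2 : ∀ s', Integrable F (P.switchRate p.1 s' • Measure.dirac (s', p.2)) := fun s' =>
    (hdi _).smul_measure_nnreal
  have j4 : ∀ k, Integrable F ((P.slots p.1 k - typeCount K p.2 k)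
      • Measure.dirac (P.afterCompletion p.1 k, p.2)) := fun k => by
    rw [← Nat.cast_smul_eq_nsmul NNReal]
    exact (hdi _).smul_measure_nnreal
  have i2 := integrable_finsetSum_measure (s := Finset.univ).2 fun s' _ => j2 s'
  have i3 := integrable_finsetSum_measure (s := inService K (P.slots p.1) p.2).2 fun i _ =>
    hdi (P.afterCompletion p.1 (jobType K (p.2.2 i)), remove p.2 i)
  have i4 := integrable_finsetSum_measure (s := (P.slots p.1).support).2 fun k _ => j4 k
  rw [rates_apply, integral_add_measure ((i1.add_measure i2).add_measure i3) i4,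
    integral_add_measure (i1.add_measure i2) i3, integral_add_measure i1 i2,
    integral_smul_measure, integral_finsetSum_measure fun s' _ => j2 s',
    integral_finsetSum_measure fun i _ => hdi _, integral_finsetSum_measure fun k _ => j4 k,
    integral_map hm.aemeasurable hF.aestronglyMeasurable, ENNReal.toReal_ofReal hlam, smul_eq_mul]
  congr 1
  · congr 1
    · congr 1
      refine Finset.sum_congr rfl fun s' _ => ?_
      rw [integral_smul_nnreal_measure, integral_dirac' _ _ hF.stronglyMeasurable]
      rfl
    · simp only [integral_dirac' _ _ hF.stronglyMeasurable]
  · refine Finset.sum_congr rfl fun k _ => ?_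
    rw [← Nat.cast_smul_eq_nsmul NNReal, integral_smul_nnreal_measure,
      integral_dirac' _ _ hF.stronglyMeasurable]
    rw [NNReal.smul_def, smul_eq_mul, NNReal.coe_natCast]

theorem rates_univ (lam : ℝ) (μ : Measure Requirement) [IsProbabilityMeasure μ]
    (p : Fin P.n × JobList) : P.rates lam μ p Set.univ
      = ENNReal.ofReal lam + ∑ s', (P.switchRate p.1 s' : ENNReal)
        + ∑ k ∈ (P.slots p.1).support, (P.slots p.1 k : ENNReal) := by
  have h := P.lintegral_rates lam μ p (fun _ => 1) measurable_const
  simp only [lintegral_one, measure_univ, mul_one] at h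
  rw [h, sum_inService K (P.slots p.1) p.2 (fun _ => (1 : ENNReal)), add_assoc,
    ← Finset.sum_add_distrib]
  congr 1
  refine Finset.sum_congr rfl fun k _ => ?_
  rw [nsmul_eq_mul, mul_one, ← Nat.cast_add]
  congr 1
  omega

instance (lam : ℝ) (μ : Measure Requirement) [IsProbabilityMeasure μ]
    (p : Fin P.n × JobList) : IsFiniteMeasure (P.rates lam μ p) :=
  ⟨by
    rw [P.rates_univ]
    refine ENNReal.add_lt_top.2 ⟨ENNReal.add_lt_top.2 ⟨ENNReal.ofReal_lt_top, ?_⟩, ?_⟩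
    · exact ENNReal.sum_lt_top.2 fun _ _ => ENNReal.coe_lt_top
    · exact ENNReal.sum_lt_top.2 fun _ _ => ENNReal.natCast_lt_top _⟩

theorem rates_real_univ {lam : ℝ} (hlam : 0 ≤ lam) (μ : Measure Requirement)
    [IsProbabilityMeasure μ] (p : Fin P.n × JobList) : (P.rates lam μ p).real Set.univ
      = lam + ∑ s', (P.switchRate p.1 s' : ℝ) + ∑ k ∈ (P.slots p.1).support, (P.slots p.1 k : ℝ) := by
  rw [Measure.real, P.rates_univ, ENNReal.toReal_add, ENNReal.toReal_add ENNReal.ofReal_ne_top,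
    ENNReal.toReal_ofReal hlam, ENNReal.toReal_sum, ENNReal.toReal_sum]
  · simp
  · simp
  · simp
  · simp [ENNReal.sum_eq_top]
  · simp [ENNReal.sum_eq_top]
  · simp [ENNReal.sum_eq_top]

theorem ae_rates (lam : ℝ) (μ : Measure Requirement) [SFinite μ] (p : Fin P.n × JobList)
    (q : Fin P.n × JobList → Prop) (hq : MeasurableSet {y | q y})
    (h1 : ∀ s v, q (s, arrive p.2 v)) (h2 : ∀ s i, q (s, remove p.2 i)) (h3 : ∀ s, q (s, p.2)) :
    ∀ᵐ y ∂(P.rates lam μ p), q y := by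
  change P.rates lam μ p {y | q y}ᶜ = 0
  rw [← lintegral_indicator_one hq.compl,
    P.lintegral_rates lam μ p _ (measurable_one.indicator hq.compl)]
  simp [Set.indicator, h1, h2, h3]

theorem measurable_of_slots_typeCount {β : Type*} [MeasurableSpace β] (n K : ℕ)
    (F : Fin n → (ℕ → ℕ) → β) :
    Measurable fun p : Fin n × JobList => F p.1 (typeCount K p.2) :=
  measurable_from_prod_countable_right fun s => measurable_of_typeCount K (F s)

/-- The drift of `(number of type-k jobs) + (function of the modulating state)`. -/
theorem integral_rates_sub {lam : ℝ} (hlam : 0 ≤ lam) (μ : Measure Requirement)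
    [IsProbabilityMeasure μ] (hK : 0 < K) (g : Fin P.n → ℝ) (p : Fin P.n × JobList) {k : ℕ}
    (hk : k ∈ Finset.Icc 1 K) :
    ∫ y, ((typeCount K y.2 k + g y.1) - (typeCount K p.2 k + g p.1)) ∂(P.rates lam μ p)
      = lam * typeProb K μ k - (min (P.slots p.1 k) (typeCount K p.2 k) : ℕ)
        + (∑ s', (P.switchRate p.1 s' : ℝ) * (g s' - g p.1)
          + ∑ j ∈ (P.slots p.1).support,
            (P.slots p.1 j : ℝ) * (g (P.afterCompletion p.1 j) - g p.1)) := by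
  obtain ⟨s, x⟩ := p
  dsimp only
  have harr : ∀ v, ((typeCount K (arrive x v) k : ℝ) + g s) - (typeCount K x k + g s)
      = if jobType K v = k then 1 else 0 := fun v => by
    rw [typeCount_arrive]; push_cast; ring
  have hrem : ∀ i s', ((typeCount K (remove x i) k : ℝ) + g s') - (typeCount K x k + g s)
      = (g s' - g s) - if jobType K (x.2 i) = k then 1 else 0 := fun i s' => by
    rw [typeCount_remove K x i k]; push_cast; ring
  have hm : Measurable fun y : Fin P.n × JobList =>
      ((typeCount K y.2 k : ℝ) + g y.1) - (typeCount K x k + g s) :=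
    measurable_of_slots_typeCount P.n K fun s' q => ((q k : ℝ) + g s') - (typeCount K x k + g s)
  rw [P.integral_rates hlam μ (s, x) _ hm]
  · simp only [harr, hrem, add_sub_add_left_eq_sub]
    rw [integral_jobType hK μ fun j => if j = k then (1 : ℝ) else 0, sum_inService K (P.slots s) x
      (fun j => g (P.afterCompletion s j) - g s - if j = k then (1 : ℝ) else 0)]
    have h1 : ∑ j ∈ Finset.Icc 1 K, typeProb K μ j * (if j = k then (1 : ℝ) else 0)
        = typeProb K μ k := by
      simp [hk]
    have h2 : ∑ j ∈ (P.slots s).support, min (P.slots s j) (typeCount K x j) •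
          (g (P.afterCompletion s j) - g s - if j = k then (1 : ℝ) else 0)
        = ∑ j ∈ (P.slots s).support, (min (P.slots s j) (typeCount K x j) : ℕ)
            * (g (P.afterCompletion s j) - g s) - (min (P.slots s k) (typeCount K x k) : ℕ) := by
      simp only [nsmul_eq_mul, mul_sub, Finset.sum_sub_distrib, mul_ite, mul_one, mul_zero,
        Finset.sum_ite_eq']
      congr 1
      split_ifs with h
      · rfl
      · simp [Finsupp.notMem_support_iff.1 h]
    have h3 : ∑ j ∈ (P.slots s).support,
          (P.slots s j : ℝ) * (g (P.afterCompletion s j) - g s)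
        = ∑ j ∈ (P.slots s).support, (min (P.slots s j) (typeCount K x j) : ℕ)
            * (g (P.afterCompletion s j) - g s)
          + ∑ j ∈ (P.slots s).support, ((P.slots s j - typeCount K x j : ℕ) : ℝ)
            * (g (P.afterCompletion s j) - g s) := by
      rw [← Finset.sum_add_distrib]
      refine Finset.sum_congr rfl fun j _ => ?_
      rw [← add_mul, ← Nat.cast_add]
      congr 2
      omega
    rw [h1, h2, h3]
    ring
  · simp only [harr]
    refine Integrable.of_bound (C := 1) ?_ (ae_of_all _ fun v => ?_)
    · exact (Measurable.ite (measurableSet_jobType_eq K k) measurable_const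
        measurable_const).aestronglyMeasurable
    · split_ifs <;> simp

end NMSRPolicy

/-- A finite irreducible graph admits a function that decreases along some edge out of every
vertex but one. -/
theorem exists_descent {α : Type*} (r : α → α → Prop) (t : α)
    (h : ∀ s, Relation.ReflTransGen r s t) :
    ∃ D : α → ℕ, ∀ s, s ≠ t → ∃ b, r s b ∧ D b < D s := by
  classical
  let reach : ℕ → α → Prop := fun m =>
    Nat.rec (motive := fun _ => α → Prop) (fun s => s = t) (fun _ R s => ∃ b, r s b ∧ R b) m
  have hex : ∀ s, ∃ m, reach m s := fun s => by
    refine Relation.ReflTransGen.head_induction_on (h s) ⟨0, rfl⟩ ?_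
    rintro a b hab - ⟨m, hm⟩
    exact ⟨m + 1, b, hab, hm⟩
  let D : α → ℕ := fun s => Nat.find (hex s)
  refine ⟨D, fun s hs => ?_⟩
  have hspec := Nat.find_spec (hex s)
  cases hm : Nat.find (hex s) with
  | zero => rw [hm] at hspec; exact absurd hspec hs
  | succ m =>
    rw [hm] at hspec
    obtain ⟨b, hb, hR⟩ := hspec
    refine ⟨b, hb, ?_⟩
    change Nat.find (hex b) < Nat.find (hex s)
    rw [hm]
    exact Nat.lt_succ_of_le (Nat.find_min' (hex b) hR)

/-- An nMSR policy is stable if on average it offers more slots for each type than needed, where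
`avg k` is identified as the average number of type-`k` slots by a solution `g k` of the Poisson
equation for the modulating process. -/
theorem NMSRPolicy.stable_of_poisson {K : ℕ} (hK : 0 < K) (P : NMSRPolicy K) {lam : ℝ}
    (hlam : 0 < lam) (μ : Measure Requirement) [IsProbabilityMeasure μ] (avg : ℕ → ℝ)
    (g : ℕ → Fin P.n → ℝ)
    (hpoisson : ∀ k ∈ Finset.Icc 1 K, ∀ s,
      ∑ s', (P.switchRate s s' : ℝ) * (g k s' - g k s)
        + ∑ j ∈ (P.slots s).support, (P.slots s j : ℝ) * (g k (P.afterCompletion s j) - g k s)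
      = P.slots s k - avg k)
    (hload : ∀ k ∈ Finset.Icc 1 K, lam * typeProb K μ k < avg k)
    (hserve : ∀ k ∈ Finset.Icc 1 K, ∃ s, P.slots s k ≠ 0) : P.Stable lam μ := by
  classical
  intro s₀
  set T := Finset.Icc 1 K with hT
  set Q := P.rates lam μ with hQ
  obtain ⟨ε, hε, hεle⟩ := exists_pos_forall_le T _ fun k hk => sub_pos.2 (hload k hk)
  -- A bound for the solutions of the Poisson equation
  obtain ⟨Bg, hBg0, hBg⟩ : ∃ Bg : ℝ, 0 ≤ Bg ∧ ∀ k ∈ T, ∀ s, |g k s| ≤ Bg := by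
    refine ⟨∑ k ∈ T, ∑ s, |g k s|, by positivity, fun k hk s => ?_⟩
    exact (Finset.single_le_sum (f := fun s => |g k s|) (fun _ _ => abs_nonneg _)
      (Finset.mem_univ s)).trans (Finset.single_le_sum (f := fun k => ∑ s, |g k s|)
        (fun _ _ => Finset.sum_nonneg fun _ _ => abs_nonneg _) hk)
  -- Distances in the graph of the modulating process
  choose D hD using fun t => exists_descent _ t fun s => P.irreducible s t
  obtain ⟨Δ, hΔ⟩ : ∃ Δ, ∀ t s, D t s ≤ Δ :=
    ⟨∑ t, ∑ s, D t s, fun t s => (Finset.single_le_sum (f := fun s => D t s)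
      (fun _ _ => Nat.zero_le _) (Finset.mem_univ s)).trans (Finset.single_le_sum
        (f := fun t => ∑ s, D t s) (fun _ _ => Nat.zero_le _) (Finset.mem_univ t))⟩
  obtain ⟨δ, hδ, hδle⟩ := exists_pos_forall_le (Finset.univ : Finset (Fin P.n × Fin P.n))
    (fun z => if P.switchRate z.1 z.2 = 0 then 1 else (P.switchRate z.1 z.2 : ℝ)) (by
      intro z _
      split_ifs with h
      · exact one_pos
      · exact NNReal.coe_pos.2 (pos_iff_ne_zero.2 h))
  have : Nonempty (Fin P.n) := ⟨s₀⟩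
  choose! w hw using hserve
  -- A modulating state with a slot for some type that is present, or `s₀` if the system is empty.
  -- It depends on the type counts only, so it does not change while no job arrives or leaves.
  let tgt : (ℕ → ℕ) → Fin P.n := fun q =>
    if h : ∃ k ∈ T, 0 < q k then w h.choose else s₀
  -- The number of jobs comes first, then the distance to the target. The factor `Δ + 1` lets a
  -- departure lower `d` even when the target changes.
  let d : Fin P.n × JobList → ℕ := fun p =>
    (Δ + 1) * p.2.1 + D (tgt (typeCount K p.2)) p.1
  have hd : Measurable d := by
    have := NMSRPolicy.measurable_of_slots_typeCount P.n K fun s q =>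
      (Δ + 1) * (∑ k ∈ T, q k) + D (tgt q) s
    simpa only [hT, sum_typeCount hK] using this
  have hd_remove : ∀ s s' x i, d (s', remove x i) < d (s, x) := by
    intro s s' x i
    have h1 := JobList.fst_remove x i
    have h2 := hΔ (tgt (typeCount K (remove x i))) s'
    simp only [d]
    rw [← h1, mul_add]
    omega
  have hx₀ : MeasurableSet {(s₀, JobList.empty)} := by
    rw [← Set.singleton_prod_singleton]
    exact (measurableSet_singleton s₀).prod JobList.measurableSet_empty
  set CC : ℝ := ∑ s, (∑ s', (P.switchRate s s' : ℝ) + ∑ k ∈ (P.slots s).support, (P.slots s k : ℝ))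
    with hCC
  refine positiveRecurrent_of_quadratic_drift Q hx₀ (c := lam) (C := lam + CC) hlam ?_ ?_ T
    (fun k p => (typeCount K p.2 k : ℝ) + g k p.1) ?_ (B := 1 + 2 * Bg) ?_
    (fun p => (p.2.1 : ℝ)) (fun _ => Nat.cast_nonneg _) d hd
    (c₀ := ∑ k ∈ T, ((K : ℝ) ^ 2 + Bg * (|lam * typeProb K μ k - avg k| + K)))
    (c₁ := Δ + 1) (ε := ε) (δ := min δ 1) ?_ hε (lt_min hδ one_pos) ?_ ?_ ?_
  · intro p
    rw [hQ, P.rates_real_univ hlam.le, add_assoc]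
    exact le_add_of_nonneg_right (by positivity)
  · intro p
    rw [hQ, P.rates_real_univ hlam.le, add_assoc]
    gcongr
    exact Finset.single_le_sum (f := fun s => ∑ s', (P.switchRate s s' : ℝ)
      + ∑ k ∈ (P.slots s).support, (P.slots s k : ℝ)) (fun _ _ => by positivity)
      (Finset.mem_univ p.1)
  · exact fun k _ => NMSRPolicy.measurable_of_slots_typeCount P.n K fun s q => (q k : ℝ) + g k s
  · intro k hk p
    have hgd : ∀ s, |g k s - g k p.1| ≤ 2 * Bg := fun s => by
      have h1 := hBg k hk s
      have h2 := hBg k hk p.1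
      have := abs_sub (g k s) (g k p.1)
      linarith
    refine P.ae_rates lam μ p _ ?_ (fun s v => ?_) (fun s i => ?_) (fun s => ?_)
    · have : Measurable fun y : Fin P.n × JobList =>
          |((typeCount K y.2 k : ℝ) + g k y.1) - (typeCount K p.2 k + g k p.1)| :=
        NMSRPolicy.measurable_of_slots_typeCount P.n K fun s q =>
          |((q k : ℝ) + g k s) - (typeCount K p.2 k + g k p.1)|
      exact this measurableSet_Iic
    · have h := abs_le.1 (hgd s)
      rw [typeCount_arrive]
      push_cast
      split_ifs <;> exact abs_le.2 ⟨by linarith, by linarith⟩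
    · have h := abs_le.1 (hgd s)
      rw [typeCount_remove K p.2 i k]
      push_cast
      split_ifs <;> exact abs_le.2 ⟨by linarith, by linarith⟩
    · have h := abs_le.1 (hgd s)
      exact abs_le.2 ⟨by linarith, by linarith⟩
  · intro p
    have h2 : ((D (tgt (typeCount K p.2)) p.1 : ℕ) : ℝ) ≤ Δ := Nat.cast_le.2 (hΔ _ _)
    simp only [d]
    push_cast
    linarith
  · intro p
    have hterm : ∀ k ∈ T, ((typeCount K p.2 k : ℝ) + g k p.1)
          * ∫ y, (((typeCount K y.2 k : ℝ) + g k y.1) - (typeCount K p.2 k + g k p.1)) ∂(Q p)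
        ≤ ((K : ℝ) ^ 2 + Bg * (|lam * typeProb K μ k - avg k| + K)) - ε * typeCount K p.2 k := by
      intro k hk
      rw [hQ, P.integral_rates_sub hlam.le μ hK (g k) p hk, hpoisson k hk]
      have hle := serviceOptions_apply_le (P.slots_mem p.1) k
      have hleR : (P.slots p.1 k : ℝ) ≤ K := Nat.cast_le.2 hle
      have h1 := mul_sub_min_le (q := typeCount K p.2 k) hle
      have h2 := mul_le_mul_of_nonneg_left (hεle k hk) (Nat.cast_nonneg (typeCount K p.2 k))
      set m : ℝ := ((min (P.slots p.1 k) (typeCount K p.2 k) : ℕ) : ℝ) with hm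
      have hm0 : 0 ≤ m := Nat.cast_nonneg _
      have hm1 : m ≤ P.slots p.1 k := Nat.cast_le.2 (min_le_left _ _)
      -- By the Poisson equation the drift is `λ p k - m + (slots - avg k)`. Its product with the
      -- queue length is controlled by `λ p k < avg k` and by `slots - m` being positive only for
      -- short queues; its product with the bounded correction `g` is bounded.
      have h3 : g k p.1 * (lam * typeProb K μ k - m + (P.slots p.1 k - avg k))
          ≤ Bg * (|lam * typeProb K μ k - avg k| + K) := by
        refine (le_abs_self _).trans ?_
        rw [abs_mul]
        refine mul_le_mul (hBg k hk _) ?_ (abs_nonneg _) hBg0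
        have : lam * typeProb K μ k - m + (P.slots p.1 k - avg k)
            = (lam * typeProb K μ k - avg k) + (P.slots p.1 k - m) := by ring
        rw [this]
        refine (abs_add_le _ _).trans ?_
        rw [abs_of_nonneg (sub_nonneg.2 hm1)]
        linarith
      rw [add_mul]
      linarith
    refine (Finset.sum_le_sum hterm).trans ?_
    rw [Finset.sum_sub_distrib, ← Finset.mul_sum]
    have hN : ∑ k ∈ T, (typeCount K p.2 k : ℝ) = p.2.1 := by
      rw [← sum_typeCount hK p.2]; push_cast; rfl
    rw [hN]
  · rintro ⟨s, x⟩ hp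
    have hset : MeasurableSet {y | d y < d (s, x)} := hd measurableSet_Iio
    have hmeas : Measurable ({y | d y < d (s, x)}.indicator (1 : Fin P.n × JobList → ENNReal)) :=
      measurable_one.indicator hset
    suffices h : ENNReal.ofReal (min δ 1) ≤ Q (s, x) {y | d y < d (s, x)} by
      have := ENNReal.toReal_mono (measure_ne_top _ _) h
      rwa [ENNReal.toReal_ofReal (le_min hδ.le one_pos.le)] at this
    rw [← lintegral_indicator_one hset, hQ, P.lintegral_rates lam μ (s, x) _ hmeas]
    have hone : ∀ y, d y < d (s, x) →
        {y | d y < d (s, x)}.indicator (1 : Fin P.n × JobList → ENNReal) y = 1 := fun y hy =>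
      Set.indicator_of_mem (s := {y | d y < d (s, x)}) hy _
    have hle1 : ENNReal.ofReal (min δ 1) ≤ 1 := by
      simp
    by_cases hin : (inService K (P.slots s) x).Nonempty
    · obtain ⟨i, hi⟩ := hin
      refine le_add_right (le_add_left (le_trans ?_
        (Finset.single_le_sum (fun _ _ => zero_le) hi)))
      rw [hone _ (hd_remove _ _ _ _)]
      exact hle1
    -- With no job in service, all slots present are empty and the modulating state is not the
    -- target. Some spontaneous move, or completion of an empty slot, then brings it closer.
    · have hcount : ∀ k, min (P.slots s k) (typeCount K x k) = 0 := fun k => by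
        rw [← card_inService, Finset.not_nonempty_iff_eq_empty.1 hin]
        simp
      have hne : s ≠ tgt (typeCount K x) := by
        intro hs
        by_cases hex : ∃ k ∈ T, 0 < typeCount K x k
        · have h1 : tgt (typeCount K x) = w hex.choose := dif_pos hex
          have h2 := hex.choose_spec
          have h3 := hw _ h2.1
          have h4 := hcount hex.choose
          rw [hs, h1] at h4
          have := h2.2
          omega
        · have hx : x = JobList.empty := by
            refine eq_empty_of_fst_eq_zero (Nat.eq_zero_of_not_pos fun hpos => hex ?_)
            exact exists_typeCount_pos hK hpos
          have h1 : tgt (typeCount K x) = s₀ := dif_neg hex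
          exact hp (by rw [hs, h1, hx])
      obtain ⟨b, hb, hDb⟩ := hD _ s hne
      have hdb : d (b, x) < d (s, x) := Nat.add_lt_add_left hDb _
      rcases hb with hb | ⟨k, hk, rfl⟩
      · refine le_add_right (le_add_right (le_add_left (le_trans ?_
          (Finset.single_le_sum (fun _ _ => zero_le) (Finset.mem_univ b)))))
        rw [hone _ hdb, mul_one]
        have h1 := hδle (s, b) (Finset.mem_univ _)
        rw [if_neg hb] at h1
        rw [← ENNReal.ofReal_coe_nnreal]
        exact ENNReal.ofReal_le_ofReal ((min_le_left _ _).trans h1)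
      · refine le_add_left (le_trans ?_ (Finset.single_le_sum (fun _ _ => zero_le)
          (Finsupp.mem_support_iff.2 hk)))
        rw [hone _ hdb, mul_one]
        refine hle1.trans ?_
        have := hcount k
        exact_mod_cast (by omega : 1 ≤ P.slots s k - typeCount K x k)
  · have hset := hx₀.compl
    rw [← lintegral_indicator_one hset, hQ,
      P.lintegral_rates lam μ _ _ (measurable_one.indicator hset)]
    have : ∀ v, ({(s₀, JobList.empty)}ᶜ : Set (Fin P.n × JobList)).indicator
        (1 : Fin P.n × JobList → ENNReal) (s₀, arrive JobList.empty v) = 1 := by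
      intro v
      refine Set.indicator_of_mem (fun h => ?_) _
      exact absurd (congrArg (fun z : Fin P.n × JobList => z.2.1) h) (Nat.succ_ne_zero _)
    simp only [this, lintegral_one, measure_univ, mul_one]
    refine (lt_of_lt_of_le (ENNReal.ofReal_pos.2 hlam) ?_).ne'
    rw [add_assoc, add_assoc]
    exact le_self_add

/-! ### A cyclic modulating process -/

/-- The smallest type with a slot. -/
noncomputable def minType (u : ℕ →₀ ℕ) : ℕ := sInf (u.support : Set ℕ)

theorem minType_apply_ne_zero {u : ℕ →₀ ℕ} (hu : u ≠ 0) : u (minType u) ≠ 0 := by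
  have : minType u ∈ (u.support : Set ℕ) :=
    Nat.sInf_mem (Finset.coe_nonempty.2 (Finsupp.support_nonempty_iff.2 hu))
  exact Finsupp.mem_support_iff.1 this

/-- Give up one slot of the smallest type. -/
noncomputable def drain (u : ℕ →₀ ℕ) : ℕ →₀ ℕ := u - Finsupp.single (minType u) 1

theorem drain_le (u : ℕ →₀ ℕ) : drain u ≤ u := tsub_le_self

theorem iterate_drain_le (m : ℕ) (u : ℕ →₀ ℕ) : drain^[m] u ≤ u := by
  induction m with
  | zero => exact le_rfl
  | succ m ih => rw [Function.iterate_succ_apply']; exact (drain_le _).trans ih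

theorem degree_drain_lt {u : ℕ →₀ ℕ} (hu : u ≠ 0) : (drain u).degree < u.degree := by
  have h1 : Finsupp.single (minType u) 1 ≤ u :=
    Finsupp.single_le_iff.2 (Nat.one_le_iff_ne_zero.2 (minType_apply_ne_zero hu))
  have h2 : drain u + Finsupp.single (minType u) 1 = u := tsub_add_cancel_of_le h1
  have h3 := congrArg Finsupp.degree h2
  rw [map_add, Finsupp.degree_single] at h3
  omega

theorem iterate_drain_eq_zero {m : ℕ} {u : ℕ →₀ ℕ} (hu : u.degree ≤ m) : drain^[m] u = 0 := by
  induction m generalizing u with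
  | zero => exact (Finsupp.degree_eq_zero_iff u).1 (Nat.le_zero.1 hu)
  | succ m ih =>
    rw [Function.iterate_succ_apply]
    refine ih ?_
    by_cases h : u = 0
    · subst h
      have : drain 0 = 0 := by simp [drain]
      rw [this]; simp
    · have := degree_drain_lt h
      omega

theorem serviceOptions_of_le {K : ℕ} {u M : ℕ →₀ ℕ} (h : u ≤ M) (hM : M ∈ serviceOptions K) :
    u ∈ serviceOptions K := by
  refine ⟨(Finsupp.support_mono h).trans hM.1, le_trans ?_ hM.2⟩
  rw [Finsupp.sum, Finsupp.sum]
  exact (Finset.sum_le_sum fun k _ => Nat.mul_le_mul_left k (h k)).trans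
    (Finset.sum_le_sum_of_subset (Finsupp.support_mono h))

theorem degree_le_of_mem_serviceOptions {K : ℕ} {M : ℕ →₀ ℕ} (hM : M ∈ serviceOptions K) :
    M.degree ≤ K := by
  refine le_trans ?_ hM.2
  rw [Finsupp.degree_apply, Finsupp.sum]
  refine Finset.sum_le_sum fun k hk => ?_
  exact Nat.le_mul_of_pos_left _ (Finset.mem_Icc.1 (hM.1 hk)).1

/-- A cycle of stages: in each stage either the process advances spontaneously, or it advances at
the completion of a slot of a certain type. -/
structure SlotCycle (K : ℕ) where
  n : ℕ
  n_pos : 0 < n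
  slots : ℕ → ℕ →₀ ℕ
  slots_mem : ∀ t < n, slots t ∈ serviceOptions K
  spont : ℕ → NNReal
  key : ℕ → Option ℕ
  spont_nonpreemptive : ∀ t < n, spont t ≠ 0 → slots t ≤ slots ((t + 1) % n)
  key_nonpreemptive : ∀ t < n, ∀ k, key t = some k → slots t k ≠ 0 →
    slots t - Finsupp.single k 1 ≤ slots ((t + 1) % n)
  advances : ∀ t < n, spont t ≠ 0 ∨ ∃ k, key t = some k ∧ slots t k ≠ 0

namespace SlotCycle

variable {K : ℕ} (R : SlotCycle K)

/-- The stage after `s`. -/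
def next (s : Fin R.n) : Fin R.n := ⟨(s + 1) % R.n, Nat.mod_lt _ R.n_pos⟩

theorem next_iterate (s : Fin R.n) (m : ℕ) : ((R.next^[m] s : Fin R.n) : ℕ) = (s + m) % R.n := by
  induction m with
  | zero => exact (Nat.mod_eq_of_lt s.2).symm
  | succ m ih =>
    rw [Function.iterate_succ_apply']
    change ((R.next^[m] s : Fin R.n) + 1) % R.n = _
    rw [ih, Nat.mod_add_mod, add_assoc]

/-- The total rate at which the process leaves stage `t`. -/
noncomputable def rate (t : ℕ) : ℝ :=
  R.spont t + match R.key t with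
    | some k => (R.slots t k : ℝ)
    | none => 0

theorem rate_pos {t : ℕ} (ht : t < R.n) : 0 < R.rate t := by
  unfold rate
  rcases R.advances t ht with h | ⟨k, hk, h⟩
  · refine add_pos_of_pos_of_nonneg (NNReal.coe_pos.2 (pos_iff_ne_zero.2 h)) ?_
    split <;> positivity
  · rw [hk]
    exact add_pos_of_nonneg_of_pos (NNReal.coe_nonneg _) (Nat.cast_pos.2 (Nat.pos_of_ne_zero h))

open Classical in
/-- The nMSR policy that runs through the stages in cyclic order. -/
noncomputable def policy : NMSRPolicy K where
  n := R.n
  n_pos := R.n_pos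
  slots s := R.slots s
  slots_mem s := R.slots_mem s s.2
  switchRate s s' := if s' = R.next s then R.spont s else 0
  -- A completed slot of any type other than the key is simply kept for the next job.
  afterCompletion s k := if R.key s = some k then R.next s else s
  switch_nonpreemptive s s' h := by
    by_cases hs : s' = R.next s
    · rw [if_pos hs] at h
      rw [hs]
      exact R.spont_nonpreemptive s s.2 h
    · exact absurd (if_neg hs) h
  completion_nonpreemptive s k hk := by
    split_ifs with h
    · exact R.key_nonpreemptive s s.2 k h hk
    · exact tsub_le_self
  irreducible s s' := by
    have hedge : ∀ a, (if R.next a = R.next a then R.spont a else 0) ≠ 0 ∨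
        ∃ k, R.slots a k ≠ 0 ∧ (if R.key a = some k then R.next a else a) = R.next a := by
      intro a
      rcases R.advances a a.2 with h | ⟨k, hk, h⟩
      · exact Or.inl (by rwa [if_pos rfl])
      · exact Or.inr ⟨k, h, if_pos hk⟩
    have hiter : ∀ m, Relation.ReflTransGen (fun a b => (if b = R.next a then R.spont a else 0) ≠ 0 ∨
        ∃ k, R.slots a k ≠ 0 ∧ (if R.key a = some k then R.next a else a) = b) s (R.next^[m] s) := by
      intro m
      induction m with
      | zero => exact Relation.ReflTransGen.refl
      | succ m ih =>
        rw [Function.iterate_succ_apply']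
        exact ih.tail (hedge _)
    have heq : R.next^[s' + R.n - s] s = s' := by
      apply Fin.ext
      rw [R.next_iterate]
      have h1 : (s : ℕ) + (s' + R.n - s) = s' + R.n := by have := s.2; omega
      rw [h1, Nat.add_mod_right, Nat.mod_eq_of_lt s'.2]
    exact heq ▸ hiter _

/-- The long-run average of `c`. -/
noncomputable def average (c : ℕ → ℝ) : ℝ :=
  (∑ t ∈ Finset.range R.n, c t / R.rate t) / ∑ t ∈ Finset.range R.n, 1 / R.rate t

/-- The solution of the Poisson equation for the function `c` of the stage. -/
noncomputable def potential (c : ℕ → ℝ) (t : ℕ) : ℝ :=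
  ∑ r ∈ Finset.range t, (c r - R.average c) / R.rate r

theorem sum_holding_pos : 0 < ∑ t ∈ Finset.range R.n, 1 / R.rate t :=
  Finset.sum_pos (fun _ ht => one_div_pos.2 (R.rate_pos (Finset.mem_range.1 ht)))
    ⟨0, Finset.mem_range.2 R.n_pos⟩

/-- On a cycle the Poisson equation prescribes every increment of the solution. The increments must
add up to zero around the cycle, and this is exactly the definition of `average`. -/
theorem rate_mul_potential_sub (c : ℕ → ℝ) (s : Fin R.n) :
    R.rate s * (R.potential c (R.next s) - R.potential c s) = c s - R.average c := by
  have hstep : R.potential c (s + 1) - R.potential c s = (c s - R.average c) / R.rate s := by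
    rw [potential, potential, Finset.sum_range_succ, add_sub_cancel_left]
  have hend : R.potential c R.n = 0 := by
    rw [potential]
    simp only [sub_div, Finset.sum_sub_distrib]
    have h1 : ∑ t ∈ Finset.range R.n, R.average c / R.rate t
        = R.average c * ∑ t ∈ Finset.range R.n, 1 / R.rate t := by
      rw [Finset.mul_sum]
      exact Finset.sum_congr rfl fun t _ => by ring
    rw [h1, average, div_mul_cancel₀ _ R.sum_holding_pos.ne', sub_self]
  have hnext : R.potential c (R.next s) = R.potential c (s + 1) := by
    change R.potential c ((s + 1) % R.n) = _
    rcases (Nat.succ_le_of_lt s.2).lt_or_eq with h | h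
    · rw [Nat.mod_eq_of_lt h]
    · have h' : (s : ℕ) + 1 = R.n := h
      rw [h', Nat.mod_self, hend]
      exact Finset.sum_range_zero _
  rw [hnext, hstep, mul_div_cancel₀ _ (R.rate_pos s.2).ne']

/-- The only moves that change the stage lead to the next one, at total rate `rate`. The generator
is therefore `rate` times a forward difference, and `potential` solves the required equation. -/
theorem policy_stable (hK : 0 < K) {lam : ℝ} (hlam : 0 < lam) (μ : Measure Requirement)
    [IsProbabilityMeasure μ]
    (hload : ∀ k ∈ Finset.Icc 1 K, lam * typeProb K μ k < R.average fun t => R.slots t k)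
    (hserve : ∀ k ∈ Finset.Icc 1 K, ∃ t < R.n, R.slots t k ≠ 0) : R.policy.Stable lam μ := by
  classical
  refine R.policy.stable_of_poisson hK hlam μ (fun k => R.average fun t => R.slots t k)
    (fun k s => R.potential (fun t => R.slots t k) (s : Fin R.n)) ?_ hload ?_
  · intro k _ s
    change Fin R.n at s
    set G : Fin R.n → ℝ := fun s => R.potential (fun t => R.slots t k) s with hG
    refine Eq.trans ?_ (R.rate_mul_potential_sub (fun t => R.slots t k) s)
    change ∑ s' : Fin R.n, ((if s' = R.next s then R.spont s else 0 : NNReal) : ℝ) * (G s' - G s)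
      + ∑ j ∈ (R.slots s).support,
        (R.slots s j : ℝ) * (G (if R.key s = some j then R.next s else s) - G s)
      = R.rate s * (G (R.next s) - G s)
    rw [rate, add_mul]
    congr 1
    · rw [Finset.sum_eq_single_of_mem (R.next s) (Finset.mem_univ _)]
      · rw [if_pos rfl]
      · intro b _ hb
        rw [if_neg hb, NNReal.coe_zero, zero_mul]
    · cases hkey : R.key s with
      | none => simp
      | some k' =>
        simp only [Option.some.injEq]
        by_cases hk' : R.slots s k' = 0
        · rw [hk']
          simp only [Nat.cast_zero, zero_mul]
          refine Finset.sum_eq_zero fun j hj => ?_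
          rw [if_neg, sub_self, mul_zero]
          rintro rfl
          exact Finsupp.mem_support_iff.1 hj hk'
        · rw [Finset.sum_eq_single_of_mem k' (Finsupp.mem_support_iff.2 hk')]
          · rw [if_pos rfl]
          · intro b _ hb
            rw [if_neg (Ne.symm hb), sub_self, mul_zero]
  · intro k hk
    obtain ⟨t, ht, h⟩ := hserve k hk
    exact ⟨⟨t, ht⟩, h⟩

end SlotCycle

/-! ### The two-bucket cycle -/

/-- The slots in stage `t`: the stages come in blocks of `2 ^ L + 2`, in which an option is
maintained and then given up slot by slot. -/
noncomputable def stageSlots (L t : ℕ) : ℕ →₀ ℕ :=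
  -- Truncated subtraction gives the full option at positions `0` and `1`: the first is the long
  -- holding stage, which ends spontaneously without giving up a slot, and draining starts from the
  -- second. At the last position, `2 ^ L + 1`, the option has been drained `2 ^ L` times.
  drain^[t % (2 ^ L + 2) - 1] (twoBucketOption L (t / (2 ^ L + 2) + 1))

theorem block_mem {L t : ℕ} (ht : t < 2 ^ L * (2 ^ L + 2)) :
    t / (2 ^ L + 2) + 1 ∈ Finset.Icc 1 (2 ^ L) := by
  have := Nat.div_lt_of_lt_mul (mul_comm (2 ^ L) (2 ^ L + 2) ▸ ht)
  exact Finset.mem_Icc.2 ⟨Nat.succ_pos _, this⟩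

theorem stageSlots_le (L t : ℕ) : stageSlots L t ≤ twoBucketOption L (t / (2 ^ L + 2) + 1) :=
  iterate_drain_le _ _

theorem stageSlots_succ {L t : ℕ} (h : t % (2 ^ L + 2) + 1 < 2 ^ L + 2) :
    stageSlots L (t + 1) = drain^[t % (2 ^ L + 2)] (twoBucketOption L (t / (2 ^ L + 2) + 1)) := by
  have hL := Nat.one_le_two_pow (n := L)
  have h1 : (t + 1) % (2 ^ L + 2) = t % (2 ^ L + 2) + 1 := by
    rw [Nat.add_mod, Nat.mod_eq_of_lt (by omega : 1 < 2 ^ L + 2), Nat.mod_eq_of_lt h]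
  have h2 : (t + 1) / (2 ^ L + 2) = t / (2 ^ L + 2) := by
    rw [Nat.succ_div, if_neg, add_zero]
    intro hd
    rw [Nat.dvd_iff_mod_eq_zero, h1] at hd
    omega
  rw [stageSlots, h1, h2, Nat.add_sub_cancel]

theorem stage_succ_mod {L t : ℕ} (h : t % (2 ^ L + 2) + 1 < 2 ^ L + 2)
    (ht : t < 2 ^ L * (2 ^ L + 2)) : (t + 1) % (2 ^ L * (2 ^ L + 2)) = t + 1 := by
  have hL := Nat.one_le_two_pow (n := L)
  refine Nat.mod_eq_of_lt (lt_of_le_of_ne ht fun heq => ?_)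
  have h1 : (t + 1) % (2 ^ L + 2) = t % (2 ^ L + 2) + 1 := by
    rw [Nat.add_mod, Nat.mod_eq_of_lt (by omega : 1 < 2 ^ L + 2), Nat.mod_eq_of_lt h]
  rw [heq, Nat.mul_mod_left] at h1
  omega

/-- An option has at most `2 ^ L` slots, so the draining is over by the end of the block. Passing to
the next option then preempts nothing. -/
theorem stageSlots_last {L t : ℕ} (ht : t < 2 ^ L * (2 ^ L + 2))
    (h : ¬ t % (2 ^ L + 2) + 1 < 2 ^ L + 2) : stageSlots L t = 0 := by
  have := Nat.mod_lt t (Nat.succ_pos (2 ^ L + 1))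
  refine iterate_drain_eq_zero ?_
  refine (degree_le_of_mem_serviceOptions
    (twoBucketSet_subset L (twoBucketOption_mem (block_mem ht)))).trans ?_
  omega

open Classical in
/-- The cycle through the two-bucket options, in which option `i` is maintained for a mean time
`h i`. -/
noncomputable def twoBucketCycle (L : ℕ) (h : ℕ → NNReal) (hh : ∀ i, h i ≠ 0) :
    SlotCycle (2 ^ L) where
  n := 2 ^ L * (2 ^ L + 2)
  n_pos := by positivity
  slots := stageSlots L
  slots_mem t ht := serviceOptions_of_le (stageSlots_le L t)
    (twoBucketSet_subset L (twoBucketOption_mem (block_mem ht)))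
  spont t := if t % (2 ^ L + 2) = 0 then (h (t / (2 ^ L + 2) + 1))⁻¹
    else if stageSlots L t = 0 then 1 else 0
  -- This is the type whose slot `drain` gives up. The default value of `minType` at the zero option
  -- is harmless, as nothing completes there.
  key t := if t % (2 ^ L + 2) = 0 then none else some (minType (stageSlots L t))
  spont_nonpreemptive t ht hne := by
    split_ifs at hne with h0 h1
    · have hlt : t % (2 ^ L + 2) + 1 < 2 ^ L + 2 := by rw [h0]; exact Nat.lt_add_left _ (by norm_num)
      rw [stage_succ_mod hlt ht, stageSlots_succ hlt, stageSlots, h0]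
    · rw [h1]; exact zero_le
    · exact absurd rfl hne
  key_nonpreemptive t ht k hk hne := by
    split_ifs at hk with h0
    obtain rfl := Option.some.inj hk
    by_cases hlt : t % (2 ^ L + 2) + 1 < 2 ^ L + 2
    · rw [stage_succ_mod hlt ht, stageSlots_succ hlt]
      obtain ⟨j, hj⟩ := Nat.exists_eq_succ_of_ne_zero h0
      rw [hj, Nat.succ_eq_add_one, Function.iterate_succ_apply']
      have : stageSlots L t = drain^[j] (twoBucketOption L (t / (2 ^ L + 2) + 1)) := by
        rw [stageSlots, hj, Nat.succ_eq_add_one, Nat.add_sub_cancel]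
      rw [← this]
      exact le_rfl
    · rw [stageSlots_last ht hlt] at hne
      exact absurd rfl hne
  advances t ht := by
    by_cases h0 : t % (2 ^ L + 2) = 0
    · left
      rw [if_pos h0]
      exact inv_ne_zero (hh _)
    · by_cases h1 : stageSlots L t = 0
      · left
        rw [if_neg h0, if_pos h1]
        exact one_ne_zero
      · right
        exact ⟨_, if_neg h0, minType_apply_ne_zero h1⟩

theorem twoBucketCycle_rate_zero (L : ℕ) (h : ℕ → NNReal) (hh : ∀ i, h i ≠ 0) {t : ℕ}
    (ht : t % (2 ^ L + 2) = 0) :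
    (twoBucketCycle L h hh).rate t = (h (t / (2 ^ L + 2) + 1) : ℝ)⁻¹ := by
  simp [SlotCycle.rate, twoBucketCycle, ht]

/-- Stages other than the holding stages last at most `1` on average, however long the holding times
are. -/
theorem one_le_twoBucketCycle_rate (L : ℕ) (h : ℕ → NNReal) (hh : ∀ i, h i ≠ 0) {t : ℕ}
    (ht : t % (2 ^ L + 2) ≠ 0) : 1 ≤ (twoBucketCycle L h hh).rate t := by
  simp only [SlotCycle.rate, twoBucketCycle, if_neg ht]
  split_ifs with h1
  · exact le_add_of_nonneg_right (Nat.cast_nonneg _)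
  · have : (1 : ℝ) ≤ stageSlots L t (minType (stageSlots L t)) :=
      Nat.one_le_cast.2 (Nat.one_le_iff_ne_zero.2 (minType_apply_ne_zero h1))
    simpa using this

theorem twoBucketCycle_isEfficient (L : ℕ) (h : ℕ → NNReal) (hh : ∀ i, h i ≠ 0) :
    (twoBucketCycle L h hh).policy.IsEfficient (twoBucketSet L) := by
  classical
  have hlt : ∀ i, i < 2 ^ L → i * (2 ^ L + 2) < 2 ^ L * (2 ^ L + 2) := fun i hi =>
    Nat.mul_lt_mul_of_pos_right hi (Nat.succ_pos _)
  have hslots : ∀ i, stageSlots L (i * (2 ^ L + 2)) = twoBucketOption L (i + 1) := fun i => by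
    rw [stageSlots, Nat.mul_mod_left, Nat.mul_div_cancel _ (Nat.succ_pos _)]
    rfl
  -- The working states are the holding stages, one for each of the `2 ^ L` options.
  let e : Fin (2 ^ L) → Fin (twoBucketCycle L h hh).policy.n := fun i =>
    ⟨i * (2 ^ L + 2), hlt i i.2⟩
  refine ⟨Finset.univ.image e, Finset.card_image_le.trans (by simp), ?_, ?_⟩
  · intro w hw
    obtain ⟨i, -, rfl⟩ := Finset.mem_image.1 hw
    change stageSlots L (i * (2 ^ L + 2)) ∈ _
    rw [hslots]
    exact twoBucketOption_mem (Finset.mem_Icc.2 ⟨Nat.succ_pos _, i.2⟩)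
  · rintro s -
    have hb := Finset.mem_Icc.1 (block_mem s.2)
    refine ⟨e ⟨s / (2 ^ L + 2), hb.2⟩, Finset.mem_image_of_mem _ (Finset.mem_univ _), ?_⟩
    change stageSlots L s ≤ stageSlots L (s / (2 ^ L + 2) * (2 ^ L + 2))
    rw [hslots]
    exact stageSlots_le L s

theorem sum_range_mul_ite (m : ℕ) (hm : 0 < m) (K : ℕ) (F : ℕ → ℝ) :
    ∑ t ∈ Finset.range (K * m), (if t % m = 0 then F (t / m + 1) else 0)
      = ∑ i ∈ Finset.Icc 1 K, F i := by
  induction K with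
  | zero => simp
  | succ K ih =>
    rw [Nat.succ_mul, Finset.sum_range_add, ih, Finset.sum_Icc_succ_top (by omega)]
    congr 1
    rw [Finset.sum_eq_single_of_mem 0 (Finset.mem_range.2 hm)]
    · rw [add_zero, if_pos (Nat.mul_mod_left _ _), Nat.mul_div_cancel _ hm]
    · intro j hj hj0
      rw [if_neg]
      rw [add_comm, Nat.add_mul_mod_self_right, Nat.mod_eq_of_lt (Finset.mem_range.1 hj)]
      exact hj0

/-- The two-bucket nMSR policies are stable whenever the two-bucket options can serve all types
faster than they arrive. -/
theorem stableTwoBucketEnMSR_of_fractions {L : ℕ} {lam : ℝ} (hlam : 0 < lam)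
    (μ : Measure Requirement) [IsProbabilityMeasure μ] (α : ℕ → ℝ)
    (hα : ∀ i ∈ Finset.Icc 1 (2 ^ L), 0 < α i) (hα1 : ∑ i ∈ Finset.Icc 1 (2 ^ L), α i ≤ 1)
    (hload : ∀ k ∈ Finset.Icc 1 (2 ^ L), lam * typeProb (2 ^ L) μ k
      < ∑ i ∈ Finset.Icc 1 (2 ^ L), α i * twoBucketOption L i k) :
    StableTwoBucketEnMSR L lam μ := by
  classical
  obtain ⟨ε, hε, hεle⟩ := exists_pos_forall_le _ _ fun k hk => sub_pos.2 (hload k hk)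
  set T := Finset.Icc 1 (2 ^ L) with hT
  set n : ℕ := 2 ^ L * (2 ^ L + 2) with hn
  -- Option `i` is held for the mean time `H α i`. A cycle lasts at most `H + n`, while the holding
  -- stages alone offer type `k` an amount `H ∑ α i M i k`. The margin `H ε` has to exceed the
  -- arrivals during the lost time, at most `λ n`.
  obtain ⟨H, hH0, hH⟩ : ∃ H : ℝ, 0 < H ∧ lam * n < H * ε := by
    refine ⟨lam * n / ε + 1, by positivity, ?_⟩
    rw [add_mul, div_mul_cancel₀ _ hε.ne']
    linarith
  -- The value `1` outside `T` only keeps `h` nonzero; no such stage occurs.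
  let h : ℕ → NNReal := fun i => if i ∈ T then Real.toNNReal (H * α i) else 1
  have hh : ∀ i, h i ≠ 0 := fun i => by
    simp only [h]
    split_ifs with hi
    · exact (Real.toNNReal_pos.2 (mul_pos hH0 (hα i hi))).ne'
    · exact one_ne_zero
  have hhT : ∀ i ∈ T, (h i : ℝ) = H * α i := fun i hi => by
    simp only [h, if_pos hi]
    exact Real.coe_toNNReal _ (mul_pos hH0 (hα i hi)).le
  set R := twoBucketCycle L h hh with hR
  have hrate : ∀ {t : ℕ}, t % (2 ^ L + 2) = 0 → _ := twoBucketCycle_rate_zero L h hh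
  have hm : 0 < 2 ^ L + 2 := Nat.succ_pos _
  refine ⟨R.policy, twoBucketCycle_isEfficient L h hh, R.policy_stable (by positivity) hlam μ ?_ ?_⟩
  · intro k hk
    have hp0 : 0 ≤ typeProb (2 ^ L) μ k := measureReal_nonneg
    have hp1 : typeProb (2 ^ L) μ k ≤ 1 := measureReal_le_one
    rw [SlotCycle.average, lt_div_iff₀ R.sum_holding_pos]
    have hden : ∑ t ∈ Finset.range R.n, 1 / R.rate t ≤ H + n := by
      have h1 : ∀ t ∈ Finset.range R.n, 1 / R.rate t
          ≤ (if t % (2 ^ L + 2) = 0 then (h (t / (2 ^ L + 2) + 1) : ℝ) else 0) + 1 := by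
        intro t _
        split_ifs with h0
        · rw [hR, hrate h0, one_div, inv_inv]
          linarith
        · rw [zero_add]
          have := one_le_twoBucketCycle_rate L h hh h0
          exact (div_le_one (by linarith)).2 this
      refine (Finset.sum_le_sum h1).trans ?_
      rw [Finset.sum_add_distrib]
      change ∑ t ∈ Finset.range (2 ^ L * (2 ^ L + 2)), _ + ∑ t ∈ Finset.range n, (1 : ℝ) ≤ _
      rw [sum_range_mul_ite _ hm _ fun i => (h i : ℝ), Finset.sum_congr rfl hhT, ← Finset.mul_sum]
      simp only [Finset.sum_const, Finset.card_range, nsmul_eq_mul, mul_one]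
      nlinarith
    have hnum : H * ∑ i ∈ T, α i * twoBucketOption L i k
        ≤ ∑ t ∈ Finset.range R.n, (R.slots t k : ℝ) / R.rate t := by
      have h1 : ∀ t ∈ Finset.range R.n,
          (if t % (2 ^ L + 2) = 0 then (h (t / (2 ^ L + 2) + 1) : ℝ)
            * twoBucketOption L (t / (2 ^ L + 2) + 1) k else 0)
          ≤ (R.slots t k : ℝ) / R.rate t := by
        intro t ht
        split_ifs with h0
        · have hs : R.slots t = twoBucketOption L (t / (2 ^ L + 2) + 1) := by
            change stageSlots L t = _
            rw [stageSlots, h0]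
            rfl
          rw [hs, hR, hrate h0, div_inv_eq_mul, mul_comm]
        · exact div_nonneg (Nat.cast_nonneg _) (R.rate_pos (Finset.mem_range.1 ht)).le
      refine le_trans (le_of_eq ?_) (Finset.sum_le_sum h1)
      change _ = ∑ t ∈ Finset.range (2 ^ L * (2 ^ L + 2)), _
      rw [sum_range_mul_ite _ hm _ fun i => (h i : ℝ) * twoBucketOption L i k, Finset.mul_sum]
      refine Finset.sum_congr rfl fun i hi => ?_
      rw [hhT i hi, mul_assoc]
    have hlp : 0 ≤ lam * typeProb (2 ^ L) μ k := mul_nonneg hlam.le hp0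
    have hlp1 : lam * typeProb (2 ^ L) μ k * n ≤ lam * n := by
      have : lam * typeProb (2 ^ L) μ k ≤ lam := mul_le_of_le_one_right hlam.le hp1
      gcongr
    have h3 := mul_le_mul_of_nonneg_left hden hlp
    have h4 := mul_le_mul_of_nonneg_left (hεle k hk) hH0.le
    refine lt_of_le_of_lt h3 (lt_of_lt_of_le ?_ hnum)
    rw [mul_sub] at h4
    linarith
  · intro k hk
    obtain ⟨hk1, hk2⟩ := Finset.mem_Icc.1 hk
    refine ⟨(k - 1) * (2 ^ L + 2), Nat.mul_lt_mul_of_pos_right (by omega) hm, ?_⟩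
    change stageSlots L ((k - 1) * (2 ^ L + 2)) k ≠ 0
    rw [stageSlots, Nat.mul_mod_left, Nat.mul_div_cancel _ hm, Nat.sub_add_cancel hk1]
    exact Nat.one_le_iff_ne_zero.1 (one_le_twoBucketOption_self L k)

/-! ### Throughput optimality -/

theorem mean_requirement_pos (μ : Measure Requirement) [IsProbabilityMeasure μ] :
    0 < ∫ v, (v : ℝ) ∂μ := by
  rw [integral_pos_iff_support_of_nonneg (fun v => v.2.1.le) (integrable_requirement μ)]
  have : Function.support (fun v : Requirement => (v : ℝ)) = Set.univ :=
    Set.eq_univ_of_forall fun v => v.2.1.ne'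
  rw [this, measure_univ]
  exact one_pos

theorem MarkovPolicy.Stable.lt_inv_mean {π : MarkovPolicy} {lam : ℝ} {μ : Measure Requirement}
    [IsProbabilityMeasure μ] (hstable : π.Stable lam μ) (hlam : 0 < lam) :
    lam < 1 / ∫ v, (v : ℝ) ∂μ := by
  have h := hstable.load_lt_one hlam
  rw [← ofReal_integral_eq_lintegral_ofReal (integrable_requirement μ)
    (ae_of_all _ fun v => v.2.1.le), ← ENNReal.ofReal_mul hlam.le, ENNReal.ofReal_lt_one] at h
  rwa [lt_div_iff₀ (mean_requirement_pos μ)]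

/-- The `+ 1` after the floor makes the inequality strict. Passing to a natural number takes the
maximum with `0`, which can only enlarge the exponent. -/
theorem one_lt_two_pow_mul {x : ℝ} (hx : 0 < x) :
    1 < 2 ^ (⌊-Real.logb 2 x⌋ + 1).toNat * x := by
  have h1 : -Real.logb 2 x < (⌊-Real.logb 2 x⌋ + 1).toNat := by
    refine (Int.lt_floor_add_one _).trans_le ?_
    have := Int.self_le_toNat (⌊-Real.logb 2 x⌋ + 1)
    exact_mod_cast this
  have h2 : x⁻¹ < 2 ^ (⌊-Real.logb 2 x⌋ + 1).toNat := by
    rw [← Real.rpow_natCast, ← Real.logb_lt_iff_lt_rpow one_lt_two (inv_pos.2 hx), Real.logb_inv]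
    exact h1
  rwa [inv_lt_iff_one_lt_mul₀ hx] at h2

/-- Both two-bucket policies are stable for all loads below `1` when `2 ^ L` is large enough. -/
theorem stable_of_load_lt_one {f : Requirement → ℝ} (hf : Antitone f) {μ : Measure Requirement}
    [IsProbabilityMeasure μ]
    (hμ : μ = ((volume : Measure ℝ).comap (↑)).withDensity fun v => ENNReal.ofReal (f v))
    {lam : ℝ} (hlam : 0 < lam) (hload : lam < 1 / ∫ v, (v : ℝ) ∂μ) :
    StableTwoBucketEMW (⌊-Real.logb 2 (1 / lam - ∫ v, (v : ℝ) ∂μ)⌋ + 1).toNat lam μ ∧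
      StableTwoBucketEnMSR (⌊-Real.logb 2 (1 / lam - ∫ v, (v : ℝ) ∂μ)⌋ + 1).toNat lam μ := by
  set m := ∫ v, (v : ℝ) ∂μ with hm
  have hm0 : 0 < m := mean_requirement_pos μ
  have hx : 0 < 1 / lam - m := by
    rw [sub_pos, lt_div_iff₀ hlam, mul_comm]
    rwa [lt_div_iff₀ hm0] at hload
  have hL := one_lt_two_pow_mul hx
  set L := (⌊-Real.logb 2 (1 / lam - m)⌋ + 1).toNat
  have hK : 0 < 2 ^ L := by positivity
  obtain ⟨α, hα, hα1, hαp⟩ := exists_twoBucket_fractions L (fun k => lam * typeProb (2 ^ L) μ k)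
    (fun k _ => mul_nonneg hlam.le measureReal_nonneg)
    (fun i j hi hij hj =>
      mul_le_mul_of_nonneg_left (typeProb_antitone hf hμ hi hij hj.le) hlam.le) (by
      -- Multiplied by `λ`, the inequality `1 < 2 ^ L (1 / λ - m)` says that `λ (2 ^ L m + 1) < 2 ^
      -- L`, and the left side bounds the discretized load.
      have h1 := mul_le_mul_of_nonneg_left (sum_mul_typeProb_le hK μ) hlam.le
      rw [Finset.mul_sum] at h1
      have h2 : ∑ k ∈ (Finset.Icc 1 (2 ^ L) : Finset ℕ), (k : ℝ) * (lam * typeProb (2 ^ L) μ k)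
          = ∑ k ∈ (Finset.Icc 1 (2 ^ L) : Finset ℕ), lam * ((k : ℝ) * typeProb (2 ^ L) μ k) :=
        Finset.sum_congr rfl fun k _ => by ring
      rw [h2]
      refine h1.trans_lt ?_
      push_cast
      have h3 := mul_lt_mul_of_pos_left hL hlam
      have h4 : lam * (2 ^ L * (1 / lam - m)) = 2 ^ L - lam * (2 ^ L * m) := by
        field_simp
      rw [← hm]
      linarith)
  exact ⟨fun π hπ => hπ.stable hlam μ α hα hα1 hαp,
    stableTwoBucketEnMSR_of_fractions hlam μ α hα hα1 hαp⟩

end MSJ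

theorem mainTheorem4 (f : Set.Ioc (0 : ℝ) 1 → ℝ) (hf_nonneg : ∀ v, 0 ≤ f v) (hf_anti : Antitone f)
    (μ : Measure (Set.Ioc (0 : ℝ) 1)) [IsProbabilityMeasure μ]
    (hμ : μ = ((volume : Measure ℝ).comap (↑)).withDensity fun v => ENNReal.ofReal (f v)) :
    MSJ.ThroughputOptimal μ (fun L lam => MSJ.StableTwoBucketEMW L lam μ) ∧
    MSJ.ThroughputOptimal μ (fun L lam => MSJ.StableTwoBucketEnMSR L lam μ) ∧
    ∀ lam : ℝ, 0 < lam → lam < 1 / (∫ v, (v : ℝ) ∂μ) →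
      ∀ L : ℕ, L = (⌊-Real.logb 2 (1 / lam - ∫ v, (v : ℝ) ∂μ)⌋ + 1).toNat →
        MSJ.StableTwoBucketEMW L lam μ ∧ MSJ.StableTwoBucketEnMSR L lam μ := by
  have hload : ∀ lam : ℝ, 0 < lam → (∃ π : MSJ.MarkovPolicy, π.Stable lam μ) →
      lam < 1 / ∫ v, (v : ℝ) ∂μ := fun lam hlam ⟨π, hπ⟩ => hπ.lt_inv_mean hlam
  exact ⟨fun lam hlam h => ⟨_, (MSJ.stable_of_load_lt_one hf_anti hμ hlam (hload lam hlam h)).1⟩,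
    fun lam hlam h => ⟨_, (MSJ.stable_of_load_lt_one hf_anti hμ hlam (hload lam hlam h)).2⟩,
    fun lam hlam h L hL => hL ▸ MSJ.stable_of_load_lt_one hf_anti hμ hlam h⟩
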